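/- Let $(X_n)_{n\ge 0}$ be a time-homogeneous Markov chain with transition kernel $P$ on a measurable space $(S,\mathcal B)$. Suppose there are $C\in\mathcal B$, a probability measure $\nu$ on $S$, a measurable $V:S\to[1,\infty)$, and constants $b>0$, $0<\lambda<1$, $K<\infty$ such that (with minorization constant $\bar b=1$) 1. $P(x,A)\ge \nu(A)$ for all $x\in C$, $A\in\mathcal B$ (so $C$ is an atom); 2. $PV(x)\le \lambda V(x)$ for $x\notin C$ and $PV(x)\le K$ for $x\in C$; 3. $\nu(C)\ge b$. For a weight $W$ (a measurable function $S\to[1,\infty)$) let $B_W$ be the Banach space of measurable functions with $\|g\|_W=\sup_x |g(x)|/W(x)<\infty$. Then the chain is geometrically ergodic: it has a unique invariant probability measure $\pi$, $\int V\,d\pi<\infty$, the operator $P-1\otimes\pi:\ f\mapsto Pf-\int f\,d\pi$ is bounded on (complex) $B_V$ with spectral radius $\rho_V<1$, and for every real $\rho$ with $\rho_V<\rho\le 1$ there is a finite constant $M$ such that $$\Big\|P^ng-\int g\,d\pi\Big\|_V\le M\,\rho^{n}\,\|g\|_V,\qquad n\ge 1,\ g\in B_V .$$ For $r>1$ let $M_1(r)\in[0,\infty]$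 be the optimal constant in $$\Big\|P^ng-\int g\,d\pi\Big\|_V\le M_1(r)\,r^{-n}\,\sup_x|g(x)|,\qquad n\ge 1,\ g \text{ bounded measurable}.$$ Put $R=\lambda^{-1}$, $L=\lambda^{-1}K$, $N=\frac{L-1}{R-1}$ and $$D(\alpha)=\frac{\big|1+\frac{b}{1-b}(1-e^{i\pi/(1+\alpha)})\big|-1}{|1-e^{i\pi/(1+\alpha)}|},\qquad \kappa(\alpha)=\frac{\log\frac{N-1}{(1-b)\alpha}}{\log R},\qquad \alpha_0=\frac{\log\frac{L-bR}{(1-b)R}}{\log R}.$$ (a) If $b<1$ and $\alpha_0\ge 1$, define $$r_0=\min\Big\{R,\ \min_{1\le\alpha\le\alpha_0}\Big(1+\frac{D(\alpha)}{\alpha}\Big)^{1/\kappa(\alpha)}\Big\},\qquad K_0(r)=\max_{1\le\alpha\le\alpha_0}\frac{r^{\kappa(\alpha)}-1}{(r-1)(\alpha^{-1}D(\alpha)-r^{\kappa(\alpha)}+1)} .$$ Then $r_0>1$, $\rho_V\le r_0^{-1}$, and for all $1<r<r_0$ $$M_1(r)\le \frac{2r\lambda}{1-\lambda}+\frac{r\lambda(K-1)}{(1-\lambda)^2}+\frac{r(K-\lambda)}{1-\lambda}K_0(r).$$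 (b) If $\pi(C)<1$, the same three conclusions hold when, with $\alpha=\frac{\pi(C)^{-1}-1}{1-b}$, the quantities $r_0$ and $K_0(r)$ are replaced by $$r_0=\min\Big\{R,\Big(1+\frac{D(\alpha)}{\alpha}\Big)^{1/\kappa(\alpha)}\Big\},\qquad K_0(r)=\frac{\pi(C)\,(r^{\kappa(\alpha)}-1)}{(r-1)(\alpha^{-1}D(\alpha)-r^{\kappa(\alpha)}+1)} .$$ -/

import Mathlib

open MeasureTheory ProbabilityTheory
open scoped ENNReal NNReal

namespace GeomErg

/-! ### Weights and the weighted Banach spaces `B_V` -/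

/-- A weight: a measurable function `V : S → [1, ∞)`. -/
structure Weight (S : Type*) [MeasurableSpace S] where
  toFun : S → ℝ
  measurable' : Measurable toFun
  one_le' : ∀ x, 1 ≤ toFun x

instance {S : Type*} [MeasurableSpace S] : CoeFun (Weight S) (fun _ => S → ℝ) := ⟨Weight.toFun⟩

/-- The constant weight `1`. -/
instance {S : Type*} [MeasurableSpace S] : One (Weight S) :=
  ⟨⟨fun _ => 1, measurable_const, fun _ => le_rfl⟩⟩

lemma Weight.pos {S : Type*} [MeasurableSpace S] (V : Weight S) (x : S) : 0 < V x :=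
  lt_of_lt_of_le one_pos (V.one_le' x)

/-- The `𝕜`-valued measurable functions `f` on `S` with `sup |f| / V < ∞`, as a vector space. -/
def BVSubmodule (𝕜 : Type*) [RCLike 𝕜] {S : Type*} [MeasurableSpace S] (V : Weight S) :
    Submodule 𝕜 (S → 𝕜) where
  carrier := {f | Measurable f ∧ ∃ c : ℝ, ∀ x, ‖f x‖ / V x ≤ c}
  zero_mem' := ⟨measurable_const, 0, fun x => by simp⟩
  add_mem' := by
    rintro f g ⟨hf, c, hc⟩ ⟨hg, d, hd⟩
    refine ⟨hf.add hg, c + d, fun x => ?_⟩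
    calc ‖f x + g x‖ / V x ≤ (‖f x‖ + ‖g x‖) / V x :=
          div_le_div_of_nonneg_right (norm_add_le _ _) (V.pos x).le
      _ = ‖f x‖ / V x + ‖g x‖ / V x := add_div _ _ _
      _ ≤ c + d := add_le_add (hc x) (hd x)
  smul_mem' := by
    rintro a f ⟨hf, c, hc⟩
    refine ⟨hf.const_smul a, ‖a‖ * c, fun x => ?_⟩
    calc ‖a • f x‖ / V x = ‖a‖ * (‖f x‖ / V x) := by rw [norm_smul, mul_div_assoc]
      _ ≤ ‖a‖ * c := mul_le_mul_of_nonneg_left (hc x) (norm_nonneg a)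

/-- The space `B_V` of `𝕜`-valued measurable functions `f` with
`‖f‖_V = sup_x |f x| / V x < ∞`. -/
def BV (𝕜 : Type*) [RCLike 𝕜] {S : Type*} [MeasurableSpace S] (V : Weight S) : Type _ :=
  BVSubmodule 𝕜 V

section BVNorm

variable {𝕜 : Type*} [RCLike 𝕜] {S : Type*} [MeasurableSpace S] {V : Weight S}

noncomputable instance : AddCommGroup (BV 𝕜 V) :=
  inferInstanceAs (AddCommGroup (BVSubmodule 𝕜 V))

noncomputable instance : Module 𝕜 (BV 𝕜 V) :=
  inferInstanceAs (Module 𝕜 (BVSubmodule 𝕜 V))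

instance : CoeFun (BV 𝕜 V) (fun _ => S → 𝕜) := ⟨fun f => f.1⟩

/-- The weighted supremum norm `‖f‖_V = sup_x |f x| / V x`. -/
noncomputable instance : Norm (BV 𝕜 V) := ⟨fun f => ⨆ x, ‖f x‖ / V x⟩

lemma BV.norm_def (f : BV 𝕜 V) : ‖f‖ = ⨆ x, ‖f x‖ / V x := rfl

lemma BV.bddAbove (f : BV 𝕜 V) : BddAbove (Set.range fun x => ‖f x‖ / V x) := by
  obtain ⟨c, hc⟩ := f.2.2
  exact ⟨c, by rintro _ ⟨x, rfl⟩; exact hc x⟩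

lemma BV.div_le_norm (f : BV 𝕜 V) (x : S) : ‖f x‖ / V x ≤ ‖f‖ := le_ciSup f.bddAbove x

lemma BV.norm_nonneg' (f : BV 𝕜 V) : 0 ≤ ‖f‖ :=
  Real.iSup_nonneg fun x => div_nonneg (norm_nonneg _) (V.pos x).le

lemma BV.core : NormedSpace.Core 𝕜 (BV 𝕜 V) where
  norm_nonneg f := f.norm_nonneg'
  norm_smul a f := by
    rw [BV.norm_def, BV.norm_def, Real.mul_iSup_of_nonneg (norm_nonneg a)]
    refine iSup_congr fun x => ?_
    have h : (a • f) x = a • f x := rfl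
    rw [h, norm_smul, mul_div_assoc]
  norm_triangle f g := by
    refine Real.iSup_le (fun x => ?_) (add_nonneg f.norm_nonneg' g.norm_nonneg')
    have h : (f + g) x = f x + g x := rfl
    rw [h]
    calc ‖f x + g x‖ / V x ≤ (‖f x‖ + ‖g x‖) / V x :=
          div_le_div_of_nonneg_right (norm_add_le _ _) (V.pos x).le
      _ = ‖f x‖ / V x + ‖g x‖ / V x := add_div _ _ _
      _ ≤ ‖f‖ + ‖g‖ := add_le_add (f.div_le_norm x) (g.div_le_norm x)
  norm_eq_zero_iff f := by
    constructor
    · intro h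
      refine Subtype.ext (funext fun x => ?_)
      have h1 : ‖f x‖ / V x ≤ 0 := h ▸ f.div_le_norm x
      have h2 : ‖f x‖ ≤ 0 := by
        have := (div_le_iff₀ (V.pos x)).1 h1
        simpa using this
      exact norm_le_zero_iff.1 h2
    · rintro rfl
      have h : ∀ x, (0 : BV 𝕜 V) x = 0 := fun _ => rfl
      simp [BV.norm_def, h]

noncomputable instance : NormedAddCommGroup (BV 𝕜 V) := NormedAddCommGroup.ofCore BV.core

noncomputable instance : NormedSpace 𝕜 (BV 𝕜 V) := NormedSpace.ofCore BV.core

end BVNorm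

/-! ### The conditions on the chain

The chain is given by its transition kernel `P`; `P ^ n` is the `n`-step transition kernel. -/

section Conditions

variable {S : Type*} [MeasurableSpace S]

/-- Minorization: `P(x, A) ≥ b̄ ν(A)` for `x ∈ C`. -/
def Minorization (P : Kernel S S) (C : Set S) (bbar : ℝ) (ν : Measure S) : Prop :=
  ∀ x ∈ C, ∀ A, MeasurableSet A → ENNReal.ofReal bbar * ν A ≤ P x A

/-- Drift: `PV ≤ λ V` off `C` and `PV ≤ K` on `C`. -/
def Drift (P : Kernel S S) (C : Set S) (V : Weight S) (lam K : ℝ) : Prop :=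
  (∀ x ∉ C, ∫⁻ y, ENNReal.ofReal (V y) ∂(P x) ≤ ENNReal.ofReal (lam * V x)) ∧
    ∀ x ∈ C, ∫⁻ y, ENNReal.ofReal (V y) ∂(P x) ≤ ENNReal.ofReal K

/-- Strong aperiodicity: `b̄ ν(C) ≥ b > 0`. -/
def StronglyAperiodic (C : Set S) (bbar b : ℝ) (ν : Measure S) : Prop :=
  0 < b ∧ b ≤ bbar * ν.real C

/-- `T` is the operator `P - 1 ⊗ π` on (complex) `B_V`, i.e. `(T f)(x) = (P f)(x) - ∫ f dπ`. -/
def IsCenteredOperator (P : Kernel S S) (π : Measure S) (V : Weight S)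
    (T : BV ℂ V →L[ℂ] BV ℂ V) : Prop :=
  ∀ (f : BV ℂ V) (x : S), T f x = ∫ y, f y ∂(P x) - ∫ y, f y ∂π

/-- `‖P^n g - ∫ g dπ‖_V ≤ M ρ^n ‖g‖_W` for all `g ∈ B_W` and `n ≥ 1`. -/
def IsConvConst (P : Kernel S S) (π : Measure S) (V W : Weight S) (ρ M : ℝ) : Prop :=
  ∀ n : ℕ, 1 ≤ n → ∀ g : BV ℝ W, ∀ x : S,
    |∫ y, g y ∂((P ^ n) x) - ∫ y, g y ∂π| ≤ M * ρ ^ n * ‖g‖ * V x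

/-- The optimal constant `M_W` at rate `ρ`: the least `M ≥ 0` with
`‖P^n g - ∫ g dπ‖_V ≤ M ρ^n ‖g‖_W` for all `g ∈ B_W` and `n ≥ 1` (`∞` if there is none). -/
noncomputable def optConst (P : Kernel S S) (π : Measure S) (V W : Weight S) (ρ : ℝ) : ℝ≥0∞ :=
  ⨅ (M : ℝ≥0) (_ : IsConvConst P π V W ρ M), (M : ℝ≥0∞)

end Conditions

/-! ### The explicit constants -/

/-- `D(α) = (|1 + b/(1-b) (1 - e^{iπ/(1+α)})| - 1) / |1 - e^{iπ/(1+α)}|`. -/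
noncomputable def D (b α : ℝ) : ℝ :=
  (‖1 + (b / (1 - b) : ℂ) * (1 - Complex.exp (Complex.I * Real.pi / (1 + α)))‖ - 1) /
    ‖1 - Complex.exp (Complex.I * Real.pi / (1 + α))‖

/-- `κ(α) = log ((N - 1) / ((1 - b) α)) / log R` with `N = (L - 1) / (R - 1)`. -/
noncomputable def kappa (b R L α : ℝ) : ℝ :=
  Real.log (((L - 1) / (R - 1) - 1) / ((1 - b) * α)) / Real.log R

/-- `α₀ = log ((L - b R) / ((1 - b) R)) / log R`. -/
noncomputable def alpha0 (b R L : ℝ) : ℝ :=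
  Real.log ((L - b * R) / ((1 - b) * R)) / Real.log R

/-- `(1 + D(α) / α) ^ (1 / κ(α))`. -/
noncomputable def radius (b R L α : ℝ) : ℝ :=
  (1 + D b α / α) ^ (1 / kappa b R L α)

/-- `(r^{κ(α)} - 1) / ((r - 1) (α⁻¹ D(α) - r^{κ(α)} + 1))`. -/
noncomputable def renewalBound (r b R L α : ℝ) : ℝ :=
  (r ^ kappa b R L α - 1) / ((r - 1) * (α⁻¹ * D b α - r ^ kappa b R L α + 1))

/-- `α = (π(C)⁻¹ - 1) / (1 - b)`, where `p` stands for `π(C)`. -/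
noncomputable def alphaOf (b p : ℝ) : ℝ := (p⁻¹ - 1) / (1 - b)

/-- `r₀` when `p = π(C)` is known. -/
noncomputable def r0Known (b R L p : ℝ) : ℝ := min R (radius b R L (alphaOf b p))

/-- `K₀(r)` when `p = π(C)` is known. -/
noncomputable def K0Known (r b R L p : ℝ) : ℝ := p * renewalBound r b R L (alphaOf b p)

/-- `r₀(b, R, L) = min {R, min_{1 ≤ α ≤ α₀} (1 + D(α) / α) ^ (1 / κ(α))}`. -/
noncomputable def r0 (b R L : ℝ) : ℝ :=
  min R (sInf (radius b R L '' Set.Icc 1 (alpha0 b R L)))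

/-- `K₀(r, b, R, L)`, the maximum over `1 ≤ α ≤ α₀` of
`(r^{κ(α)} - 1) / ((r - 1) (α⁻¹ D(α) - r^{κ(α)} + 1))`. -/
noncomputable def K0 (r b R L : ℝ) : ℝ :=
  sSup (renewalBound r b R L '' Set.Icc 1 (alpha0 b R L))

/-- The bound on `M₁(r)`, as a function of the value `k` of `K₀(r)`. -/
noncomputable def M1Bound (lam K r k : ℝ) : ℝ :=
  2 * r * lam / (1 - lam) + r * lam * (K - 1) / (1 - lam) ^ 2 + r * (K - lam) / (1 - lam) * k

end GeomErg

open GeomErg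

namespace GeomErg

open Filter Topology

/-! ### Monotone sequences and their generating functions on the unit circle -/

/-! With minorization constant 1 the kernel equals ν at every point of C, so the chain regenerates
one step after each visit to C and is governed by the return time τ to C. Let c_n = P(τ > n)
(`tailMass`) and let u_n be the probability of being in C at time n after starting in C
(`visitProb`). Decomposing at the last visit to C gives ∑ c_k u_{n-k} = 1. Writing c(z) = ∑ c_k z^k,
m = ∑_{k ≥ 1} c_k and p = 1/(1+m), which turns out to be π(C), this says ∑ (u_n - p) z^n = p (c(1) -
c(z)) / ((1 - z) c(z)). A disc on which c has no zero therefore gives a geometric rate for u_n → p,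
and a lower bound of |c| on a circle gives a constant by Cauchy's estimate
(`IsRenewalPair.abs_sub_mul_pow_le`).

The heart is a lower bound of |c| on the unit circle that uses only that c decreases from 1, that
c_1 ≤ 1 - b, and that m = (1 - b)α (`mul_D_le_norm_gen`). At angles beyond π/(1+α) it follows from
(1 - z)c(z) = 1 - bz - (remaining mass 1 - b). At smaller angles a rotated imaginary part of c is
bounded below by Abel summation against partial sums of sines. The two bounds meet at the angle
π/(1+α), and their common value is (1 - b)D(α).

To leave the unit circle, the drift gives ∑_{k ≥ 1} c_k R^k ≤ N - 1, and log-convexity interpolates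
this to ∑_{k ≥ 1} c_k r^k ≤ (1 - b)α r^κ. So |c| drops by at most (1 - b)α(r^κ - 1) between radius 1
and radius r, and stays positive while r^κ < 1 + D(α)/α. This is the bound for known π(C). If π(C)
is unknown, α ≤ α₀ is forced by the monotonicity of c (`HasGeomTail.le_alpha0`), while α ≤ 1 is
covered by the value at 1 through an elementary contraction
(`IsRenewalPair.abs_sub_mul_pow_le_renewalBound_one`).

Decomposing P^n(x, ·) at the first visit to C, and the law started from ν at the last one, transfers
the rate of u_n to P^n g, for bounded g with the explicit constant and for g dominated by V with
some constant. Gelfand's formula translates between these bounds and the spectral radius of P - 1 ⊗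
π. -/

lemma mul_le_sum_mul_of_le_partial_sums {c s : ℕ → ℝ} (hc : Antitone c) (h0 : ∀ k, 0 ≤ c k)
    {A : ℝ} (hA : ∀ n, A ≤ ∑ k ∈ Finset.range (n + 1), s k) (n : ℕ) :
    A * c 0 ≤ ∑ k ∈ Finset.range (n + 1), c k * s k := by
  -- Abel summation in a form that survives induction: the step adds (c n - c (n+1)) times the slack
  -- in `hA n`.
  have key : A * (c 0 - c n) + c n * ∑ k ∈ Finset.range (n + 1), s k ≤
      ∑ k ∈ Finset.range (n + 1), c k * s k := by
    induction n with
    | zero => simp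
    | succ n ih =>
      rw [Finset.sum_range_succ s (n + 1), Finset.sum_range_succ (fun k => c k * s k) (n + 1)]
      have h1 := mul_nonneg (sub_nonneg.2 (hc n.le_succ)) (sub_nonneg.2 (hA n))
      rw [Nat.succ_eq_add_one] at h1
      nlinarith
  have := mul_le_mul_of_nonneg_left (hA n) (h0 n)
  linarith

/-- Multiplying by 1 - z turns c into its jumps, whose total mass is at most 1. The jump at 1 is at
least b, so once b z is split off the remaining coefficients have mass at most 1 - b. Finite
truncations are used so that the bound passes to the limit. -/
lemma norm_one_sub_mul_sum_ge {c : ℕ → ℝ} (hc : Antitone c) (h0 : ∀ k, 0 ≤ c k) (hc0 : c 0 = 1)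
    {b : ℝ} (hb : c 1 ≤ 1 - b) {z : ℂ} (hz : ‖z‖ ≤ 1) (n : ℕ) :
    ‖1 - b * z‖ - (1 - b) * ‖z‖ ≤ ‖(1 - z) * ∑ k ∈ Finset.range (n + 2), (c k : ℂ) * z ^ k‖ := by
  -- This is the sum of the jumps (c (k-1) - c k) z^k for 2 ≤ k ≤ n + 1.
  set A : ℕ → ℂ := fun n => 1 - (1 - c 1) * z -
    (1 - z) * (∑ k ∈ Finset.range (n + 2), (c k : ℂ) * z ^ k) - c (n + 1) * z ^ (n + 2) with hA
  have hpow : ∀ k, ‖z‖ ^ (k + 1) ≤ ‖z‖ := fun k => by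
    rw [pow_succ]; exact mul_le_of_le_one_left (norm_nonneg z) (pow_le_one₀ (norm_nonneg z) hz)
  have hAn : ‖A n‖ ≤ (c 1 - c (n + 1)) * ‖z‖ := by
    induction n with
    | zero =>
      have : A 0 = 0 := by simp [hA, Finset.sum_range_succ, hc0]; ring
      simp [this]
    | succ n ih =>
      have h1 : A (n + 1) = A n + ((c (n + 1) - c (n + 2) : ℝ) : ℂ) * z ^ (n + 2) := by
        simp only [hA]; rw [Finset.sum_range_succ _ (n + 2)]; push_cast; ring
      rw [h1]
      refine (norm_add_le _ _).trans ?_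
      rw [norm_mul, Complex.norm_real, Real.norm_of_nonneg (sub_nonneg.2 (hc (Nat.le_succ _))),
        norm_pow]
      have h2 := mul_le_mul_of_nonneg_left (hpow (n + 1)) (sub_nonneg.2 (hc (Nat.le_succ (n + 1))))
      simp only [Nat.succ_eq_add_one] at h2
      rw [show n + 1 + 1 = n + 2 from rfl] at *
      linarith
  have hE : (1 - z) * ∑ k ∈ Finset.range (n + 2), (c k : ℂ) * z ^ k =
      (1 - b * z) - (((1 - b - c 1 : ℝ) : ℂ) * z + A n + c (n + 1) * z ^ (n + 2)) := by
    simp only [hA]; push_cast; ring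
  have hB : ‖((1 - b - c 1 : ℝ) : ℂ) * z + A n + c (n + 1) * z ^ (n + 2)‖ ≤ (1 - b) * ‖z‖ := by
    refine (norm_add₃_le).trans ?_
    rw [norm_mul, norm_mul, Complex.norm_real, Complex.norm_real,
      Real.norm_of_nonneg (by linarith), Real.norm_of_nonneg (h0 _), norm_pow]
    have := mul_le_mul_of_nonneg_left (hpow (n + 1)) (h0 (n + 1))
    rw [show n + 1 + 1 = n + 2 from rfl] at this
    linarith
  rw [hE]
  have := norm_sub_norm_le (1 - b * z)
    (((1 - b - c 1 : ℝ) : ℂ) * z + A n + c (n + 1) * z ^ (n + 2))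
  linarith

/-! ### Trigonometric estimates for the minimum modulus on the unit circle -/

/-- The left side is nonpositive until θ reaches 2(π - w), where the cosine returns to its initial
value, and never exceeds 1 - cos w. The right side is the line through the origin that takes the
value 1 - cos w exactly at that θ. -/
lemma cos_add_sub_cos_le {w θ : ℝ} (hw0 : 0 ≤ w) (hw : w < Real.pi) (hθ : 0 ≤ θ) :
    Real.cos (θ + w) - Real.cos w ≤ θ * ((1 - Real.cos w) / (2 * (Real.pi - w))) := by
  have h1 : 0 ≤ 1 - Real.cos w := by linarith [Real.cos_le_one w]
  have h2 : 0 < 2 * (Real.pi - w) := by linarith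
  rcases le_or_gt θ (2 * (Real.pi - w)) with h | h
  · have h3 : Real.cos (θ + w) ≤ Real.cos w := by
      rcases le_or_gt (θ + w) Real.pi with h4 | h4
      · exact Real.cos_le_cos_of_nonneg_of_le_pi hw0 h4 (by linarith)
      · rw [← Real.cos_two_pi_sub (θ + w)]
        exact Real.cos_le_cos_of_nonneg_of_le_pi hw0 (by linarith) (by linarith)
    have := mul_nonneg hθ (div_nonneg h1 h2.le)
    linarith
  · rw [← mul_div_assoc, le_div_iff₀ h2]
    have h5 : Real.cos (θ + w) - Real.cos w ≤ 1 - Real.cos w := by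
      linarith [Real.cos_le_one (θ + w)]
    nlinarith

lemma sum_sin_eq (φ δ : ℝ) (n : ℕ) :
    2 * Real.sin (φ / 2) * ∑ k ∈ Finset.range n, Real.sin ((k + 1) * φ + δ) =
      Real.cos (φ / 2 + δ) - Real.cos (n * φ + (φ / 2 + δ)) := by
  induction n with
  | zero => simp
  | succ n ih =>
    rw [Finset.sum_range_succ, mul_add, ih]
    have h1 : Real.cos (n * φ + (φ / 2 + δ)) = Real.cos ((((n : ℝ) + 1) * φ + δ) - φ / 2) := by
      congr 1; ring
    have h2 : Real.cos (((n + 1 : ℕ) : ℝ) * φ + (φ / 2 + δ)) =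
        Real.cos ((((n : ℝ) + 1) * φ + δ) + φ / 2) := by
      congr 1; push_cast; ring
    rw [h1, h2, Real.cos_sub _ (φ / 2), Real.cos_add (((n : ℝ) + 1) * φ + δ) (φ / 2)]; ring

/-- The distance of `1 / (1 - b)` to a circle, as a function of the half chord `s`. -/
noncomputable def circleGap (b s : ℝ) : ℝ :=
  (Real.sqrt ((1 - b) ^ 2 + 4 * b * s ^ 2) - (1 - b)) / (2 * s)

/-- The rationalized form makes positivity and monotonicity in s visible. -/
lemma circleGap_eq {b s : ℝ} (hb0 : 0 < b) (hb1 : b < 1) (hs : 0 < s) :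
    circleGap b s = 2 * b / (Real.sqrt ((1 - b) ^ 2 / s ^ 2 + 4 * b) + (1 - b) / s) := by
  have h1 : Real.sqrt ((1 - b) ^ 2 + 4 * b * s ^ 2) =
      s * Real.sqrt ((1 - b) ^ 2 / s ^ 2 + 4 * b) := by
    rw [← Real.sqrt_sq hs.le, ← Real.sqrt_mul (sq_nonneg _), Real.sqrt_sq hs.le]
    congr 1; field_simp
  set t := Real.sqrt ((1 - b) ^ 2 / s ^ 2 + 4 * b) with ht
  have ht2 : t ^ 2 = (1 - b) ^ 2 / s ^ 2 + 4 * b := Real.sq_sqrt (by positivity)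
  have ht0 : 0 ≤ t := Real.sqrt_nonneg _
  have h3 : 0 < (1 - b) / s := div_pos (by linarith) hs
  have h2 : 0 < t + (1 - b) / s := by linarith
  rw [circleGap, h1, div_eq_div_iff (by positivity) h2.ne']
  field_simp at ht2 ⊢
  nlinarith

lemma circleGap_pos {b s : ℝ} (hb0 : 0 < b) (hb1 : b < 1) (hs : 0 < s) : 0 < circleGap b s := by
  rw [circleGap_eq hb0 hb1 hs]
  have h3 : 0 < (1 - b) / s := div_pos (by linarith) hs
  positivity

lemma circleGap_mono {b s t : ℝ} (hb0 : 0 < b) (hb1 : b < 1) (hs : 0 < s) (hst : s ≤ t) :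
    circleGap b s ≤ circleGap b t := by
  have ht := hs.trans_le hst
  rw [circleGap_eq hb0 hb1 hs, circleGap_eq hb0 hb1 ht]
  have h3 : 0 < (1 - b) / t := div_pos (by linarith) ht
  have h4 : 0 ≤ 1 - b := by linarith
  gcongr

lemma circleGap_le {b s : ℝ} (hb0 : 0 < b) (hb1 : b < 1) (hs : 0 < s) (hs1 : s ≤ 1) :
    circleGap b s ≤ b := by
  refine (circleGap_mono hb0 hb1 hs hs1).trans_eq ?_
  rw [circleGap, show (1 - b) ^ 2 + 4 * b * 1 ^ 2 = (1 + b) ^ 2 by ring,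
    Real.sqrt_sq (by linarith)]
  ring

lemma norm_one_sub_mul_exp {b : ℝ} (φ : ℝ) :
    ‖1 - (b : ℂ) * Complex.exp (φ * Complex.I)‖ =
      Real.sqrt ((1 - b) ^ 2 + 4 * b * Real.sin (φ / 2) ^ 2) := by
  rw [Complex.norm_def, Complex.normSq_apply]
  congr 1
  have h := Real.cos_sq_add_sin_sq φ
  have h2 : Real.cos φ = 1 - 2 * Real.sin (φ / 2) ^ 2 := by
    have := Real.cos_two_mul' (φ / 2)
    rw [show 2 * (φ / 2) = φ by ring] at this
    have h' := Real.cos_sq_add_sin_sq (φ / 2)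
    linarith
  simp only [Complex.sub_re, Complex.one_re, Complex.re_ofReal_mul, Complex.sub_im, Complex.one_im,
    Complex.im_ofReal_mul, Complex.exp_ofReal_mul_I_re, Complex.exp_ofReal_mul_I_im]
  linear_combination b ^ 2 * h - 2 * b * h2

lemma norm_one_sub_exp {φ : ℝ} (h0 : 0 ≤ φ) (h1 : φ ≤ 2 * Real.pi) :
    ‖1 - Complex.exp (φ * Complex.I)‖ = 2 * Real.sin (φ / 2) := by
  have := norm_one_sub_mul_exp (b := 1) φ
  simp only [Complex.ofReal_one, one_mul, sub_self, mul_one] at this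
  rw [this, show (0 : ℝ) ^ 2 + 4 * Real.sin (φ / 2) ^ 2 = (2 * Real.sin (φ / 2)) ^ 2 by ring,
    Real.sqrt_sq]
  have := Real.sin_nonneg_of_nonneg_of_le_pi (x := φ / 2) (by linarith) (by linarith)
  linarith

lemma one_sub_mul_D {b α : ℝ} (hb1 : b < 1) (hα : 0 < α) :
    (1 - b) * D b α = circleGap b (Real.sin (Real.pi / (1 + α) / 2)) := by
  have hpi := Real.pi_pos
  have hφ0 : 0 < Real.pi / (1 + α) := by positivity
  have hφ1 : Real.pi / (1 + α) ≤ Real.pi := div_le_self hpi.le (by linarith)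
  have he : Complex.exp (Complex.I * Real.pi / (1 + α)) =
      Complex.exp ((Real.pi / (1 + α) : ℝ) * Complex.I) := by
    congr 1; push_cast; ring
  have hb : (0 : ℝ) < 1 - b := by linarith
  have hbc : (1 - b : ℂ) ≠ 0 := by
    have : ((1 - b : ℝ) : ℂ) ≠ 0 := Complex.ofReal_ne_zero.2 hb.ne'
    simpa using this
  rw [D, he, norm_one_sub_exp hφ0.le (by linarith), circleGap, ← norm_one_sub_mul_exp]
  set z := Complex.exp ((Real.pi / (1 + α) : ℝ) * Complex.I)
  have : ‖1 - (b : ℂ) * z‖ = (1 - b) * ‖1 + (b / (1 - b) : ℂ) * (1 - z)‖ := by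
    rw [← Real.norm_of_nonneg hb.le, ← Complex.norm_real, ← norm_mul]
    congr 1; push_cast; field_simp; ring
  rw [this]; ring

lemma D_pos {b α : ℝ} (hb0 : 0 < b) (hb1 : b < 1) (hα : 0 < α) : 0 < D b α := by
  have hpi := Real.pi_pos
  have hφ1 : Real.pi / (1 + α) ≤ Real.pi := div_le_self hpi.le (by linarith)
  have h := circleGap_pos hb0 hb1 (s := Real.sin (Real.pi / (1 + α) / 2))
    (Real.sin_pos_of_pos_of_lt_pi (by positivity) (by linarith))
  rw [← one_sub_mul_D hb1 hα] at h
  exact pos_of_mul_pos_right h (by linarith)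

/-- Times 2 sin h, the expression is |x| cos(δ - arg x) - (1 - b) with x = (1 - b) cos h + i (1 + b)
sin h. The best rotation is therefore δ = arg x, and |x| is the square root in `circleGap`. -/
lemma sin_sub_ge_circleGap {b h : ℝ} (hb0 : 0 < b) (hb1 : b < 1) (h0 : 0 < h)
    (h1 : h < Real.pi / 2) : ∃ δ : ℝ, 0 < δ ∧ δ ≤ Real.pi / 2 ∧
      Real.sin δ - (1 - b) * (1 - Real.cos (h + δ)) / (2 * Real.sin h) =
        circleGap b (Real.sin h) := by
  set x : ℂ := ⟨(1 - b) * Real.cos h, (1 + b) * Real.sin h⟩ with hx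
  have hs : 0 < Real.sin h := Real.sin_pos_of_pos_of_lt_pi h0 (by linarith [Real.pi_pos])
  have hcs : 0 < Real.cos h := Real.cos_pos_of_mem_Ioo ⟨by linarith, h1⟩
  have hre : 0 < x.re := mul_pos (by linarith) hcs
  have him : 0 < x.im := mul_pos (by linarith) hs
  have hx0 : x ≠ 0 := fun h => by rw [h] at hre; simp at hre
  have hn : ‖x‖ = Real.sqrt ((1 - b) ^ 2 + 4 * b * Real.sin h ^ 2) := by
    rw [Complex.norm_def, Complex.normSq_apply]
    congr 1
    have := Real.cos_sq_add_sin_sq h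
    simp only [hx]
    linear_combination (1 - b) ^ 2 * this
  have hnp : 0 < ‖x‖ := norm_pos_iff.2 hx0
  refine ⟨Complex.arg x, ?_, ?_, ?_⟩
  · have h3 := Complex.arg_nonneg_iff.2 him.le
    rcases h3.lt_or_eq with h4 | h4
    · exact h4
    · exact absurd ((Complex.arg_eq_zero_iff.1 h4.symm).2) him.ne'
  · exact (Complex.arg_le_pi_div_two_iff.2 (Or.inl hre.le))
  · have hc' : Real.cos (Complex.arg x) = x.re / ‖x‖ := Complex.cos_arg hx0
    have hs' : Real.sin (Complex.arg x) = x.im / ‖x‖ := Complex.sin_arg x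
    have hsq : ‖x‖ ^ 2 = x.re ^ 2 + x.im ^ 2 := by
      rw [← Complex.normSq_eq_norm_sq, Complex.normSq_apply]; ring
    rw [circleGap, ← hn, Real.cos_add, hc', hs']
    have hxr : x.re = (1 - b) * Real.cos h := rfl
    have hxi : x.im = (1 + b) * Real.sin h := rfl
    field_simp
    rw [hxr, hxi] at *
    nlinarith

/-- The modulus dominates the imaginary part after a rotation by δ. The sines appearing there, each
raised by the constant ζ, have nonnegative partial sums by `cos_add_sub_cos_le`, so Abel summation
against the decreasing c loses at most ζ ∑ c_k. -/
lemma sub_mul_sum_le_norm_sum {c : ℕ → ℝ} (hc : Antitone c) (h0 : ∀ k, 0 ≤ c k) (hc0 : c 0 = 1)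
    {φ δ : ℝ} (hφ0 : 0 < φ) (hφ : φ ≤ Real.pi) (hw0 : 0 ≤ φ / 2 + δ) (hw : φ / 2 + δ < Real.pi)
    (n : ℕ) :
    Real.sin δ - φ * ((1 - Real.cos (φ / 2 + δ)) / (2 * (Real.pi - (φ / 2 + δ)))) /
        (2 * Real.sin (φ / 2)) * ∑ k ∈ Finset.range (n + 1), c (k + 1) ≤
      ‖∑ k ∈ Finset.range (n + 2), (c k : ℂ) * Complex.exp (φ * Complex.I) ^ k‖ := by
  set ζ := φ * ((1 - Real.cos (φ / 2 + δ)) / (2 * (Real.pi - (φ / 2 + δ)))) /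
        (2 * Real.sin (φ / 2)) with hζ
  have hs : 0 < Real.sin (φ / 2) :=
    Real.sin_pos_of_pos_of_lt_pi (by linarith) (by linarith)
  have hpart : ∀ j : ℕ, (0 : ℝ) ≤ ∑ k ∈ Finset.range (j + 1), (Real.sin ((k + 1) * φ + δ) + ζ) := by
    intro j
    rw [Finset.sum_add_distrib, Finset.sum_const, Finset.card_range, nsmul_eq_mul]
    have h1 := sum_sin_eq φ δ (j + 1)
    have h2 := cos_add_sub_cos_le hw0 hw (θ := ((j + 1 : ℕ) : ℝ) * φ) (by positivity)
    have h3 : 2 * Real.sin (φ / 2) * ζ =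
        φ * ((1 - Real.cos (φ / 2 + δ)) / (2 * (Real.pi - (φ / 2 + δ)))) := by
      rw [hζ]; field_simp
    refine nonneg_of_mul_nonneg_right (a := 2 * Real.sin (φ / 2)) ?_ (by linarith)
    rw [mul_add, h1]
    have : 2 * Real.sin (φ / 2) * (((j + 1 : ℕ) : ℝ) * ζ) = ((j + 1 : ℕ) : ℝ) *
        (2 * Real.sin (φ / 2) * ζ) := by ring
    rw [this, h3]
    linarith
  have habel := mul_le_sum_mul_of_le_partial_sums (c := fun k => c (k + 1))
    (fun i j h => hc (by omega)) (fun k => h0 _) hpart n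
  have him : (Complex.exp (δ * Complex.I) * ∑ k ∈ Finset.range (n + 2),
      (c k : ℂ) * Complex.exp (φ * Complex.I) ^ k).im =
      Real.sin δ + ∑ k ∈ Finset.range (n + 1), c (k + 1) * Real.sin ((k + 1) * φ + δ) := by
    rw [Finset.sum_range_succ', mul_add, Finset.mul_sum, Complex.add_im, Complex.im_sum, add_comm]
    congr 1
    · simp [hc0, Complex.exp_ofReal_mul_I_im]
    · refine Finset.sum_congr rfl fun k _ => ?_
      rw [← Complex.exp_nat_mul, mul_left_comm, ← Complex.exp_add, Complex.im_ofReal_mul,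
        ← Complex.exp_ofReal_mul_I_im]
      congr 3; push_cast; ring
  have hn : ‖Complex.exp (δ * Complex.I) * ∑ k ∈ Finset.range (n + 2),
      (c k : ℂ) * Complex.exp (φ * Complex.I) ^ k‖ =
      ‖∑ k ∈ Finset.range (n + 2), (c k : ℂ) * Complex.exp (φ * Complex.I) ^ k‖ := by
    rw [norm_mul, Complex.norm_exp_ofReal_mul_I, one_mul]
  rw [← hn]
  refine le_trans ?_ ((le_abs_self _).trans (Complex.abs_im_le_norm _))
  rw [him, Finset.mul_sum]
  simp only [mul_add, Finset.sum_add_distrib, zero_mul] at habel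
  have : ∑ k ∈ Finset.range (n + 1), c (k + 1) * ζ = ∑ k ∈ Finset.range (n + 1), ζ * c (k + 1) :=
    Finset.sum_congr rfl fun k _ => mul_comm _ _
  linarith

/-- The rotation optimal at φ₀ serves every smaller angle, because each factor of the loss is
largest at φ₀: φ / sin(φ/2) by concavity of the sine, the numerator by monotonicity of the cosine,
and the denominator because δ ≤ π/2. The relation `hm` between m and φ₀ brings the loss at φ₀ to the
form required by `sin_sub_ge_circleGap`. -/
lemma circleGap_le_of_angle_le {b m φ φ₀ : ℝ} (hb0 : 0 < b) (hb1 : b < 1) (hφ0 : 0 < φ)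
    (hφ : φ ≤ φ₀) (hφ₀ : φ₀ < Real.pi) (hm : m * φ₀ = (1 - b) * (Real.pi - φ₀)) :
    ∃ δ : ℝ, 0 ≤ φ / 2 + δ ∧ φ / 2 + δ < Real.pi ∧ circleGap b (Real.sin (φ₀ / 2)) ≤
      Real.sin δ - φ * ((1 - Real.cos (φ / 2 + δ)) / (2 * (Real.pi - (φ / 2 + δ)))) /
        (2 * Real.sin (φ / 2)) * m := by
  obtain ⟨δ, hδ0, hδ1, hδ⟩ := sin_sub_ge_circleGap hb0 hb1 (h := φ₀ / 2) (by linarith) (by linarith)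
  have hpi := Real.pi_pos
  refine ⟨δ, by linarith, by linarith, ?_⟩
  rw [← hδ]
  have hs : 0 < Real.sin (φ / 2) := Real.sin_pos_of_pos_of_lt_pi (by linarith) (by linarith)
  have hs0 : 0 < Real.sin (φ₀ / 2) := Real.sin_pos_of_pos_of_lt_pi (by linarith) (by linarith)
  have hmpos : 0 < m := pos_of_mul_pos_left (by rw [hm]; exact mul_pos (by linarith) (by linarith)) (by linarith : 0 ≤ φ₀)
  -- concavity of the sine
  have hconc : φ / Real.sin (φ / 2) ≤ φ₀ / Real.sin (φ₀ / 2) := by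
    rw [div_le_div_iff₀ hs hs0]
    have hmem : φ₀ / 2 ∈ Set.Icc 0 Real.pi := ⟨by linarith, by linarith⟩
    have hmem0 : (0 : ℝ) ∈ Set.Icc 0 Real.pi := ⟨le_rfl, hpi.le⟩
    have h1 := strictConcaveOn_sin_Icc.concaveOn.2 hmem0 hmem
      (show 0 ≤ 1 - φ / φ₀ by rw [sub_nonneg, div_le_one (by linarith)]; exact hφ)
      (div_nonneg hφ0.le (by linarith)) (sub_add_cancel 1 (φ / φ₀))
    have h2 : φ / φ₀ * (φ₀ / 2) = φ / 2 := by
      have : φ₀ ≠ 0 := by linarith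
      field_simp
    simp only [smul_eq_mul, mul_zero, Real.sin_zero, zero_add, h2] at h1
    have h3 := mul_le_mul_of_nonneg_right h1 (by linarith : 0 ≤ φ₀)
    have h4 : φ / φ₀ * Real.sin (φ₀ / 2) * φ₀ = φ * Real.sin (φ₀ / 2) := by
      have : φ₀ ≠ 0 := by linarith
      field_simp
    linarith
  have hcos : 1 - Real.cos (φ / 2 + δ) ≤ 1 - Real.cos (φ₀ / 2 + δ) := by
    have := Real.cos_le_cos_of_nonneg_of_le_pi (x := φ / 2 + δ) (y := φ₀ / 2 + δ) (by linarith)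
      (by linarith) (by linarith)
    linarith
  have hc0 : 0 ≤ 1 - Real.cos (φ / 2 + δ) := by linarith [Real.cos_le_one (φ / 2 + δ)]
  have hdiv : (1 - Real.cos (φ / 2 + δ)) / (2 * (Real.pi - (φ / 2 + δ))) ≤
      (1 - Real.cos (φ₀ / 2 + δ)) / (Real.pi - φ₀) :=
    div_le_div₀ (by linarith) hcos (by linarith) (by linarith)
  have hkey : φ * ((1 - Real.cos (φ / 2 + δ)) / (2 * (Real.pi - (φ / 2 + δ)))) /
        (2 * Real.sin (φ / 2)) * m ≤ (1 - b) * (1 - Real.cos (φ₀ / 2 + δ)) / (2 * Real.sin (φ₀ / 2)) := by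
    calc _ = (φ / Real.sin (φ / 2)) * ((1 - Real.cos (φ / 2 + δ)) /
          (2 * (Real.pi - (φ / 2 + δ)))) * (m / 2) := by field_simp
      _ ≤ (φ₀ / Real.sin (φ₀ / 2)) * ((1 - Real.cos (φ₀ / 2 + δ)) / (Real.pi - φ₀)) * (m / 2) := by
          refine mul_le_mul_of_nonneg_right (mul_le_mul hconc hdiv ?_ ?_) (by linarith)
          · exact div_nonneg hc0 (by linarith)
          · exact div_nonneg (by linarith) hs0.le
      _ = (m * φ₀) * (1 - Real.cos (φ₀ / 2 + δ)) / (2 * Real.sin (φ₀ / 2) * (Real.pi - φ₀)) := by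
          field_simp
      _ = _ := by
          rw [hm]
          have : Real.pi - φ₀ ≠ 0 := by linarith
          field_simp
  linarith

/-! ### The generating function of a decreasing sequence -/

/-- The generating function of a sequence. -/
noncomputable def gen (c : ℕ → ℝ) (z : ℂ) : ℂ := ∑' k, (c k : ℂ) * z ^ k

lemma summable_gen {c : ℕ → ℝ} (h0 : ∀ k, 0 ≤ c k) {r : ℝ} (hs : Summable fun k => c k * r ^ k)
    {z : ℂ} (hz : ‖z‖ ≤ r) : Summable fun k => ‖(c k : ℂ) * z ^ k‖ := by
  refine Summable.of_nonneg_of_le (fun k => norm_nonneg _) (fun k => ?_) hs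
  rw [norm_mul, norm_pow, Complex.norm_real, Real.norm_of_nonneg (h0 k)]
  exact mul_le_mul_of_nonneg_left (pow_le_pow_left₀ (norm_nonneg _) hz k) (h0 k)

lemma tendsto_gen {c : ℕ → ℝ} (h0 : ∀ k, 0 ≤ c k) {r : ℝ} (hs : Summable fun k => c k * r ^ k)
    {z : ℂ} (hz : ‖z‖ ≤ r) (a : ℕ) :
    Tendsto (fun n => ∑ k ∈ Finset.range (n + a), (c k : ℂ) * z ^ k) atTop (𝓝 (gen c z)) :=
  ((tendsto_add_atTop_iff_nat a).2 (summable_gen h0 hs hz).of_norm.hasSum.tendsto_sum_nat)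

lemma gen_far {c : ℕ → ℝ} (hc : Antitone c) (h0 : ∀ k, 0 ≤ c k) (hc0 : c 0 = 1)
    (hs : Summable c) {b : ℝ} (hb : c 1 ≤ 1 - b) {z : ℂ} (hz : ‖z‖ ≤ 1) :
    ‖1 - b * z‖ - (1 - b) * ‖z‖ ≤ ‖1 - z‖ * ‖gen c z‖ := by
  rw [← norm_mul]
  refine ge_of_tendsto' ((tendsto_gen h0 (r := 1) (by simpa using hs) hz 2).const_mul (1 - z)).norm
    fun n => norm_one_sub_mul_sum_ge hc h0 hc0 hb hz n

/-- The bound `gen_far` with b = 0 reads 1 - |z| ≤ |1 - z| |c(z)|. -/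
lemma gen_ne_zero_of_norm_lt_one {c : ℕ → ℝ} (hc : Antitone c) (h0 : ∀ k, 0 ≤ c k)
    (hc0 : c 0 = 1) (hs : Summable c) {z : ℂ} (hz : ‖z‖ < 1) : gen c z ≠ 0 := by
  have h := gen_far hc h0 hc0 hs (b := 0) (by rw [← hc0, sub_zero]; exact hc zero_le_one) hz.le
  intro h1
  rw [h1] at h
  simp at h
  linarith

lemma gen_conj (c : ℕ → ℝ) (z : ℂ) :
    gen c (starRingEnd ℂ z) = starRingEnd ℂ (gen c z) := by
  rw [gen, gen, Complex.conj_tsum]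
  simp

/-- Angles up to φ₀ use the rotated imaginary part; larger angles use `gen_far`, whose bound
increases with the chord. Conjugation covers negative arguments, and at z = 1 the value is at least
1. -/
lemma circleGap_le_norm_gen {c : ℕ → ℝ} (hc : Antitone c) (h0 : ∀ k, 0 ≤ c k) (hc0 : c 0 = 1)
    (hs : Summable c) {b : ℝ} (hb0 : 0 < b) (hb1 : b < 1) (hb : c 1 ≤ 1 - b) {φ₀ : ℝ}
    (hφ0 : 0 < φ₀) (hφ₀ : φ₀ < Real.pi)
    (hm : (∑' k, c (k + 1)) * φ₀ = (1 - b) * (Real.pi - φ₀)) {z : ℂ} (hz : ‖z‖ = 1) :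
    circleGap b (Real.sin (φ₀ / 2)) ≤ ‖gen c z‖ := by
  have hpi := Real.pi_pos
  have hs1 : Summable fun k => c k * 1 ^ k := by simpa using hs
  have hs' : Summable fun k => c (k + 1) := (summable_nat_add_iff 1).2 hs
  have hsφ : 0 < Real.sin (φ₀ / 2) := Real.sin_pos_of_pos_of_lt_pi (by linarith) (by linarith)
  have main : ∀ φ : ℝ, 0 < φ → φ ≤ Real.pi →
      circleGap b (Real.sin (φ₀ / 2)) ≤ ‖gen c (Complex.exp (φ * Complex.I))‖ := by
    intro φ h1 h2
    have hz : ‖Complex.exp (φ * Complex.I)‖ = 1 := Complex.norm_exp_ofReal_mul_I φ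
    rcases le_total φ φ₀ with h | h
    · obtain ⟨δ, hw0, hw1, hle⟩ := circleGap_le_of_angle_le hb0 hb1 h1 h hφ₀ hm
      refine hle.trans ?_
      exact le_of_tendsto_of_tendsto' (tendsto_const_nhds.sub (tendsto_const_nhds.mul
        ((tendsto_add_atTop_iff_nat 1).2 hs'.hasSum.tendsto_sum_nat)))
        (tendsto_gen h0 hs1 hz.le 2).norm
        (fun n => sub_mul_sum_le_norm_sum hc h0 hc0 h1 h2 hw0 hw1 n)
    · have h3 : circleGap b (Real.sin (φ₀ / 2)) ≤ circleGap b (Real.sin (φ / 2)) :=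
        circleGap_mono hb0 hb1 hsφ
          (Real.sin_le_sin_of_le_of_le_pi_div_two (by linarith) (by linarith) (by linarith))
      have hsφ' : 0 < Real.sin (φ / 2) := Real.sin_pos_of_pos_of_lt_pi (by linarith) (by linarith)
      have h4 := gen_far hc h0 hc0 hs hb hz.le
      rw [hz, norm_one_sub_mul_exp, norm_one_sub_exp h1.le (by linarith), mul_one] at h4
      refine h3.trans ?_
      rw [circleGap, div_le_iff₀ (by linarith)]
      linarith
  have hze : z = Complex.exp (Complex.arg z * Complex.I) := by
    have := Complex.norm_mul_exp_arg_mul_I z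
    rw [hz] at this
    simpa using this.symm
  rcases lt_trichotomy (Complex.arg z) 0 with h | h | h
  · have h1 := main (-Complex.arg z) (by linarith) (by linarith [Complex.neg_pi_lt_arg z])
    have h2 : Complex.exp ((-Complex.arg z : ℝ) * Complex.I) = starRingEnd ℂ z := by
      conv_rhs => rw [hze]
      rw [← Complex.exp_conj]
      congr 1
      simp
    rw [h2, gen_conj, Complex.norm_conj] at h1
    exact h1
  · rw [h] at hze
    have hz1 : z = 1 := by simpa using hze
    have h1 : gen c z = ((1 + ∑' k, c (k + 1) : ℝ) : ℂ) := by
      rw [hz1, gen]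
      simp only [one_pow, mul_one]
      rw [← Complex.ofReal_tsum, hs.tsum_eq_zero_add, hc0]
    have hm0 : 0 ≤ ∑' k, c (k + 1) := tsum_nonneg fun k => h0 _
    rw [h1, Complex.norm_real, Real.norm_of_nonneg (by linarith)]
    linarith [circleGap_le hb0 hb1 hsφ (Real.sin_le_one _)]
  · rw [hze]
    exact main _ h (Complex.arg_le_pi z)

lemma mul_D_le_norm_gen {c : ℕ → ℝ} (hc : Antitone c) (h0 : ∀ k, 0 ≤ c k) (hc0 : c 0 = 1)
    (hs : Summable c) {b : ℝ} (hb0 : 0 < b) (hb1 : b < 1) (hb : c 1 ≤ 1 - b) {α : ℝ}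
    (hα : 0 < α) (hm : ∑' k, c (k + 1) = (1 - b) * α) {z : ℂ} (hz : ‖z‖ = 1) :
    (1 - b) * D b α ≤ ‖gen c z‖ := by
  have hpi := Real.pi_pos
  rw [one_sub_mul_D hb1 hα]
  refine circleGap_le_norm_gen hc h0 hc0 hs hb0 hb1 hb (by positivity)
    (div_lt_self hpi (by linarith)) ?_ hz
  rw [hm]; field_simp; ring

/-! ### Renewal sequences and geometric tails -/

/-- A decreasing sequence `c` with `c 0 = 1` (the tails of a waiting time distribution), together
with the associated renewal sequence `u`. -/
structure IsRenewalPair (c u : ℕ → ℝ) : Prop where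
  anti : Antitone c
  nonneg : ∀ k, 0 ≤ c k
  zero : c 0 = 1
  u_nonneg : ∀ k, 0 ≤ u k
  u_le_one : ∀ k, u k ≤ 1
  conv : ∀ n, ∑ k ∈ Finset.range (n + 1), c k * u (n - k) = 1

/-- The tails `c` have a geometric moment: `∑_{k ≥ 1} c k R ^ k ≤ A`. -/
structure HasGeomTail (c : ℕ → ℝ) (R A : ℝ) : Prop where
  one_lt : 1 < R
  summable : Summable fun k => c k * R ^ k
  tsum_le : ∑' k, c (k + 1) * R ^ (k + 1) ≤ A

lemma HasGeomTail.summable_of_le {c : ℕ → ℝ} {R A r : ℝ} (h : HasGeomTail c R A)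
    (h0 : ∀ k, 0 ≤ c k) (hr0 : 0 ≤ r) (hr : r ≤ R) : Summable fun k => c k * r ^ k :=
  Summable.of_nonneg_of_le (fun k => mul_nonneg (h0 k) (pow_nonneg hr0 k))
    (fun k => mul_le_mul_of_nonneg_left (pow_le_pow_left₀ hr0 hr k) (h0 k)) h.summable

lemma HasGeomTail.summable_one {c : ℕ → ℝ} {R A : ℝ} (h : HasGeomTail c R A)
    (h0 : ∀ k, 0 ≤ c k) : Summable c := by
  simpa using h.summable_of_le h0 zero_le_one h.one_lt.le

/-- Every index is at least 1, so each weight is at least R. This is what makes κ ≥ 1. -/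
lemma HasGeomTail.mul_tsum_le {c : ℕ → ℝ} {R A : ℝ} (h : HasGeomTail c R A)
    (h0 : ∀ k, 0 ≤ c k) : R * ∑' k, c (k + 1) ≤ A := by
  refine le_trans ?_ h.tsum_le
  rw [← tsum_mul_left]
  have h1 := h.one_lt
  refine Summable.tsum_le_tsum (fun k => ?_)
    (((summable_nat_add_iff 1).2 (h.summable_one h0)).mul_left R)
    ((summable_nat_add_iff 1).2 h.summable)
  rw [mul_comm, pow_succ]
  refine mul_le_mul_of_nonneg_left ?_ (h0 _)
  exact le_mul_of_one_le_left (by linarith) (one_le_pow₀ h1.le)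

/-- Weighted AM-GM, that is, the tangent at t to the concave function x ↦ x^θ. The free t allows
interpolation between upper bounds of two sums instead of their exact values; the choice t = A/M
gives the power of r with exponent log(A/M)/log R. -/
lemma rpow_pow_le {R θ t : ℝ} (hR : 0 < R) (h0 : 0 ≤ θ) (h1 : θ ≤ 1) (ht : 0 < t) (k : ℕ) :
    (R ^ θ) ^ k ≤ (1 - θ) * t ^ θ + θ * t ^ (θ - 1) * R ^ k := by
  have h := Real.geom_mean_le_arith_mean2_weighted (w₁ := 1 - θ) (w₂ := θ) (p₁ := t)
    (p₂ := R ^ k) (by linarith) h0 ht.le (pow_nonneg hR.le k) (by ring)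
  have h2 := mul_le_mul_of_nonneg_left h (Real.rpow_nonneg ht.le (θ - 1))
  have h3 : t ^ (θ - 1) * (t ^ (1 - θ) * (R ^ k) ^ θ) = (R ^ θ) ^ k := by
    rw [← mul_assoc, ← Real.rpow_add ht, show θ - 1 + (1 - θ) = 0 by ring, Real.rpow_zero, one_mul,
      ← Real.rpow_natCast, ← Real.rpow_natCast, ← Real.rpow_mul hR.le, ← Real.rpow_mul hR.le,
      mul_comm]
  have h4 : t ^ (θ - 1) * t = t ^ θ := by
    nth_rewrite 2 [← Real.rpow_one t]
    rw [← Real.rpow_add ht]; congr 1; ring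
  rw [h3] at h2
  calc _ ≤ _ := h2
    _ = (1 - θ) * (t ^ (θ - 1) * t) + θ * t ^ (θ - 1) * R ^ k := by ring
    _ = _ := by rw [h4]

/-- Log-convexity of `r ↦ ∑_{k ≥ 1} c k r ^ k`. -/
lemma HasGeomTail.tsum_le_mul_rpow {c : ℕ → ℝ} {R A r M : ℝ} (h : HasGeomTail c R A)
    (h0 : ∀ k, 0 ≤ c k) (hr1 : 1 ≤ r) (hr : r ≤ R) (hA : 0 < A) (hM : 0 < M)
    (hm : ∑' k, c (k + 1) ≤ M) :
    ∑' k, c (k + 1) * r ^ (k + 1) ≤ M * r ^ (Real.log (A / M) / Real.log R) := by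
  have hR0 : 0 < R := by linarith [h.one_lt]
  have hr0 : 0 < r := by linarith
  have hlR : 0 < Real.log R := Real.log_pos h.one_lt
  set θ := Real.log r / Real.log R with hθ
  have hθ0 : 0 ≤ θ := div_nonneg (Real.log_nonneg hr1) hlR.le
  have hθ1 : θ ≤ 1 := (div_le_one hlR).2 (Real.log_le_log hr0 hr)
  have hrθ : R ^ θ = r := by
    rw [Real.rpow_def_of_pos hR0, hθ, mul_div_cancel₀ _ hlR.ne', Real.exp_log hr0]
  have ht : 0 < A / M := div_pos hA hM
  have hκ : r ^ (Real.log (A / M) / Real.log R) = (A / M) ^ θ := by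
    rw [Real.rpow_def_of_pos hr0, Real.rpow_def_of_pos ht, hθ]; congr 1; ring
  have hs := (summable_nat_add_iff 1).2 (h.summable_one h0)
  have hsR := (summable_nat_add_iff 1).2 h.summable
  have hsr := (summable_nat_add_iff 1).2 (h.summable_of_le h0 hr0.le hr)
  have h4 : (A / M) ^ (θ - 1) * A = (A / M) ^ θ * M := by
    have : (A / M) ^ (θ - 1) * (A / M) = (A / M) ^ θ := by
      nth_rewrite 2 [← Real.rpow_one (A / M)]
      rw [← Real.rpow_add ht]; congr 1; ring
    rw [← this]; field_simp
  rw [hκ]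
  have ht0 : 0 ≤ (A / M) ^ θ := Real.rpow_nonneg ht.le _
  have ht1 : 0 ≤ (A / M) ^ (θ - 1) := Real.rpow_nonneg ht.le _
  calc ∑' k, c (k + 1) * r ^ (k + 1)
      ≤ ∑' k, ((1 - θ) * (A / M) ^ θ * c (k + 1) +
          θ * (A / M) ^ (θ - 1) * (c (k + 1) * R ^ (k + 1))) := by
        refine Summable.tsum_le_tsum (fun k => ?_) hsr ((hs.mul_left _).add (hsR.mul_left _))
        have := mul_le_mul_of_nonneg_left (rpow_pow_le hR0 hθ0 hθ1 ht (k + 1)) (h0 (k + 1))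
        rw [hrθ] at this
        linarith
    _ = (1 - θ) * (A / M) ^ θ * ∑' k, c (k + 1) +
          θ * (A / M) ^ (θ - 1) * ∑' k, c (k + 1) * R ^ (k + 1) := by
        rw [Summable.tsum_add (hs.mul_left _) (hsR.mul_left _), tsum_mul_left, tsum_mul_left]
    _ ≤ (1 - θ) * (A / M) ^ θ * M + θ * (A / M) ^ (θ - 1) * A :=
        add_le_add
          (mul_le_mul_of_nonneg_left hm (mul_nonneg (by linarith) ht0))
          (mul_le_mul_of_nonneg_left h.tsum_le (mul_nonneg hθ0 ht1))
    _ = M * (A / M) ^ θ := by rw [mul_assoc θ, h4]; ring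

lemma norm_gen_sub_le {c : ℕ → ℝ} (h0 : ∀ k, 0 ≤ c k) {r : ℝ} (hr1 : 1 ≤ r)
    (hs : Summable fun k => c k * r ^ k) {w : ℂ} (hw : ‖w‖ = 1) :
    ‖gen c (r * w) - gen c w‖ ≤ ∑' k, c (k + 1) * r ^ (k + 1) - ∑' k, c (k + 1) := by
  have hr0 : 0 ≤ r := by linarith
  have hs1 : Summable c := Summable.of_nonneg_of_le h0 (fun k =>
    le_mul_of_one_le_right (h0 k) (one_le_pow₀ hr1)) hs
  have hsa := (summable_gen h0 hs (z := r * w) (by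
    rw [norm_mul, hw, Complex.norm_real, Real.norm_of_nonneg hr0, mul_one])).of_norm
  have hsb := (summable_gen h0 (r := 1) (by simpa using hs1) hw.le).of_norm
  have hs1' := (summable_nat_add_iff 1).2 hs1
  have hs' := (summable_nat_add_iff 1).2 hs
  rw [gen, gen, ← Summable.tsum_sub hsa hsb, (hsa.sub hsb).tsum_eq_zero_add,
    ← Summable.tsum_sub hs' hs1']
  simp only [pow_zero, mul_one, sub_self, zero_add]
  refine tsum_of_norm_bounded (hs'.sub hs1').hasSum fun k => ?_
  rw [mul_pow, ← mul_sub, ← sub_one_mul, norm_mul, norm_mul, norm_pow, hw, one_pow, mul_one,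
    Complex.norm_real, Real.norm_of_nonneg (h0 _)]
  have : ((r : ℂ) ^ (k + 1) - 1) = ((r ^ (k + 1) - 1 : ℝ) : ℂ) := by push_cast; rfl
  rw [this, Complex.norm_real, Real.norm_of_nonneg (by linarith [one_le_pow₀ hr1 (n := k + 1)])]
  linarith

/-- Dividing 1 - z^k by 1 - z leaves a geometric sum, of modulus at most (r^k - 1)/(r - 1) on the
circle. The pole of the renewal series at 1 thus costs no more than the factor 1/(r - 1). -/
lemma norm_gen_one_sub_le {c : ℕ → ℝ} (h0 : ∀ k, 0 ≤ c k) {r : ℝ} (hr1 : 1 < r)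
    (hs : Summable fun k => c k * r ^ k) {z : ℂ} (hz : ‖z‖ = r) :
    ‖gen c 1 - gen c z‖ ≤
      ‖1 - z‖ * ((∑' k, c (k + 1) * r ^ (k + 1) - ∑' k, c (k + 1)) / (r - 1)) := by
  have hs1 : Summable c := Summable.of_nonneg_of_le h0 (fun k =>
    le_mul_of_one_le_right (h0 k) (one_le_pow₀ hr1.le)) hs
  have hsa := (summable_gen h0 hs hz.le).of_norm
  have hsb := (summable_gen h0 (r := 1) (z := 1) (by simpa using hs1) (by simp)).of_norm
  have hs1' := (summable_nat_add_iff 1).2 hs1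
  have hs' := (summable_nat_add_iff 1).2 hs
  rw [gen, gen, ← Summable.tsum_sub hsb hsa, (hsb.sub hsa).tsum_eq_zero_add,
    ← Summable.tsum_sub hs' hs1']
  simp only [pow_zero, mul_one, sub_self, zero_add, one_pow]
  refine tsum_of_norm_bounded (((hs'.sub hs1').hasSum.div_const (r - 1)).mul_left ‖1 - z‖)
    fun k => ?_
  have h1 : (c (k + 1) : ℂ) - c (k + 1) * z ^ (k + 1) =
      (1 - z) * (c (k + 1) * ∑ i ∈ Finset.range (k + 1), z ^ i) := by
    have := mul_neg_geom_sum z (k + 1)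
    linear_combination -(c (k + 1) : ℂ) * this
  rw [h1, norm_mul, norm_mul, Complex.norm_real, Real.norm_of_nonneg (h0 _)]
  refine mul_le_mul_of_nonneg_left ?_ (norm_nonneg _)
  rw [← mul_sub_one, mul_div_assoc]
  refine mul_le_mul_of_nonneg_left ?_ (h0 _)
  rw [← geom_sum_eq hr1.ne']
  refine (norm_sum_le _ _).trans_eq ?_
  simp [norm_pow, hz]

lemma differentiableOn_gen {c : ℕ → ℝ} (h0 : ∀ k, 0 ≤ c k) {R : ℝ}
    (hs : Summable fun k => c k * R ^ k) :
    DifferentiableOn ℂ (gen c) (Metric.ball 0 R) := by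
  refine Complex.differentiableOn_tsum_of_summable_norm hs (fun k => ?_) Metric.isOpen_ball
    fun k w hw => ?_
  · exact ((differentiable_id.pow k).const_mul _).differentiableOn
  · rw [norm_mul, norm_pow, Complex.norm_real, Real.norm_of_nonneg (h0 k)]
    refine mul_le_mul_of_nonneg_left (pow_le_pow_left₀ (norm_nonneg _) ?_ k) (h0 k)
    exact (mem_ball_zero_iff.1 hw).le

/-- Cauchy's estimate, for coefficients known only through a power series near 0. -/
lemma norm_coeff_le {d : ℕ → ℂ} {H : ℂ → ℂ} {r B : ℝ} (hr : 0 < r)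
    (hH : DiffContOnCl ℂ H (Metric.ball 0 r)) (hB : ∀ z, ‖z‖ = r → ‖H z‖ ≤ B)
    (hd : ∀ᶠ z in 𝓝 (0 : ℂ), HasSum (fun n => d n * z ^ n) (H z)) (n : ℕ) :
    ‖d n‖ * r ^ n ≤ B := by
  have h1 : HasFPowerSeriesAt H (FormalMultilinearSeries.ofScalars ℂ d) 0 := by
    rw [hasFPowerSeriesAt_iff]
    filter_upwards [hd] with z hz
    simpa [FormalMultilinearSeries.coeff_ofScalars, mul_comm] using hz
  have h2 := h1.eq_formalMultilinearSeries h1.analyticAt.hasFPowerSeriesAt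
  have h3 : d n = iteratedDeriv n H 0 / n.factorial := by
    have := congrArg (fun p => FormalMultilinearSeries.coeff p n) h2
    simpa [FormalMultilinearSeries.coeff_ofScalars] using this
  have h4 := Complex.norm_iteratedDeriv_le_of_forall_mem_sphere_norm_le n hr hH
    (C := B) fun z hz => hB z (by simpa using hz)
  have hf : (0 : ℝ) < n.factorial := by exact_mod_cast n.factorial_pos
  rw [h3, norm_div, Complex.norm_natCast, div_mul_eq_mul_div, div_le_iff₀ hf]
  rw [le_div_iff₀ (pow_pos hr n)] at h4
  linarith

/-- The generating function of `u n - 1 / c(1)`, from a lower bound of `|c|` on circles. -/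
lemma IsRenewalPair.abs_sub_mul_pow_le {c u : ℕ → ℝ} (h : IsRenewalPair c u) {r ρ E : ℝ}
    (hr1 : 1 < r) (hrρ : r < ρ) (hs : Summable fun k => c k * ρ ^ k)
    (hne : ∀ z : ℂ, ‖z‖ < ρ → gen c z ≠ 0) (hE : 0 < E) (hlow : ∀ z : ℂ, ‖z‖ = r → E ≤ ‖gen c z‖)
    (n : ℕ) :
    |u n - (1 + ∑' k, c (k + 1))⁻¹| * r ^ n ≤ (1 + ∑' k, c (k + 1))⁻¹ *
      ((∑' k, c (k + 1) * r ^ (k + 1) - ∑' k, c (k + 1)) / ((r - 1) * E)) := by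
  have h0 := h.nonneg
  have hr0 : 0 < r := by linarith
  have hρ1 : 1 < ρ := hr1.trans hrρ
  have hs1 : Summable c := Summable.of_nonneg_of_le h0 (fun k =>
    le_mul_of_one_le_right (h0 k) (one_le_pow₀ hρ1.le)) hs
  have hsr : Summable fun k => c k * r ^ k := Summable.of_nonneg_of_le
    (fun k => mul_nonneg (h0 k) (pow_nonneg hr0.le k))
    (fun k => mul_le_mul_of_nonneg_left (pow_le_pow_left₀ hr0.le hrρ.le k) (h0 k)) hs
  set m := ∑' k, c (k + 1) with hm
  have hm0 : 0 ≤ m := tsum_nonneg fun k => h0 _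
  set p := (1 + m)⁻¹ with hp
  have hp0 : 0 < p := inv_pos.2 (by linarith)
  have hg1 : gen c 1 = ((1 + m : ℝ) : ℂ) := by
    rw [gen]
    simp only [one_pow, mul_one]
    rw [← Complex.ofReal_tsum, hs1.tsum_eq_zero_add, h.zero]
  have hpg : (p : ℂ) * gen c 1 = 1 := by
    rw [hg1, ← Complex.ofReal_mul, hp, inv_mul_cancel₀ (by linarith : (1 + m) ≠ 0),
      Complex.ofReal_one]
  have hdiff := differentiableOn_gen h0 hs
  have hnhds : Metric.ball (0 : ℂ) ρ ∈ 𝓝 (1 : ℂ) :=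
    Metric.isOpen_ball.mem_nhds (by simpa using hρ1)
  -- `dslope` removes the singularity at z = 1, so that H is holomorphic wherever c has no zero.
  set H : ℂ → ℂ := fun z => p * dslope (gen c) 1 z / gen c z with hHdef
  have hHd : DifferentiableOn ℂ H (Metric.ball 0 ρ) :=
    (((Complex.differentiableOn_dslope hnhds).2 hdiff).const_mul _).div hdiff
      fun z hz => hne z (by simpa using hz)
  have hslope : ∀ z : ℂ, z ≠ 1 → dslope (gen c) 1 z = (gen c 1 - gen c z) / (1 - z) := by
    intro z hz
    rw [dslope_of_ne _ hz, slope_def_field, ← neg_sub (gen c 1), ← neg_sub 1 z, neg_div_neg_eq]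
  have hz1 : ∀ z : ℂ, ‖z‖ ≠ 1 → z ≠ 1 := fun z hz h => hz (by simp [h])
  have hB := norm_coeff_le (d := fun n => ((u n - p : ℝ) : ℂ)) (H := H) (r := r)
    (B := p * ((∑' k, c (k + 1) * r ^ (k + 1) - m) / ((r - 1) * E))) hr0
    ((hHd.mono (fun z hz => by
      rw [closure_ball (0 : ℂ) hr0.ne'] at hz
      have : ‖z‖ ≤ r := by simpa using hz
      simpa using this.trans_lt hrρ)).diffContOnCl) ?_ ?_ n
  · simpa only [Complex.norm_real, Real.norm_eq_abs] using hB
  · intro z hz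
    have hzne := hz1 z (by rw [hz]; exact hr1.ne')
    have hg := norm_gen_one_sub_le h0 hr1 hsr hz
    have hnz : 0 < ‖1 - z‖ := norm_pos_iff.2 (sub_ne_zero.2 (Ne.symm hzne))
    have hlz := hlow z hz
    simp only [hHdef]
    rw [hslope z hzne, norm_div, norm_mul, Complex.norm_real, Real.norm_of_nonneg hp0.le, norm_div,
      mul_div_assoc]
    refine mul_le_mul_of_nonneg_left ?_ hp0.le
    rw [← div_div]
    have hq : ‖gen c 1 - gen c z‖ / ‖1 - z‖ ≤
        (∑' k, c (k + 1) * r ^ (k + 1) - m) / (r - 1) := by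
      rw [div_le_iff₀ hnz]; linarith
    exact div_le_div₀ (le_trans (by positivity) hq) hq hE hlz
  · filter_upwards [Metric.ball_mem_nhds (0 : ℂ) one_pos] with z hz
    have hz1' : ‖z‖ < 1 := by simpa using hz
    have hzne := hz1 z hz1'.ne
    have hsc := summable_gen h0 (r := 1) (by simpa using hs1) hz1'.le
    have hgeo := summable_geometric_of_lt_one (norm_nonneg z) hz1'
    have hsu : Summable fun n => ‖(u n : ℂ) * z ^ n‖ := by
      refine Summable.of_nonneg_of_le (fun n => norm_nonneg _) (fun n => ?_) hgeo
      rw [norm_mul, norm_pow, Complex.norm_real, Real.norm_of_nonneg (h.u_nonneg n)]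
      exact mul_le_of_le_one_left (by positivity) (h.u_le_one n)
    have hprod := tsum_mul_tsum_eq_tsum_sum_range_of_summable_norm hsc hsu
    have hinner : ∀ n, ∑ k ∈ Finset.range (n + 1), (c k : ℂ) * z ^ k * (u (n - k) * z ^ (n - k)) =
        z ^ n := by
      intro n
      calc _ = ∑ k ∈ Finset.range (n + 1), ((c k * u (n - k) : ℝ) : ℂ) * z ^ n := by
            refine Finset.sum_congr rfl fun k hk => ?_
            have : z ^ n = z ^ k * z ^ (n - k) := by
              rw [← pow_add, Nat.add_sub_cancel' (Nat.lt_succ_iff.1 (Finset.mem_range.1 hk))]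
            rw [this]; push_cast; ring
        _ = z ^ n := by
            rw [← Finset.sum_mul, ← Complex.ofReal_sum, h.conv n, Complex.ofReal_one, one_mul]
    simp only [hinner] at hprod
    rw [tsum_geometric_of_norm_lt_one hz1'] at hprod
    have hcz := hne z (hz1'.trans hρ1)
    have hgz : (∑' k, (c k : ℂ) * z ^ k) = gen c z := rfl
    rw [hgz] at hprod
    have hHz : H z = (∑' n, (u n : ℂ) * z ^ n) - p * (1 - z)⁻¹ := by
      simp only [hHdef]
      rw [hslope z hzne]
      have h1z : 1 - z ≠ 0 := sub_ne_zero.2 (Ne.symm hzne)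
      have hU : (∑' n, (u n : ℂ) * z ^ n) = (1 - z)⁻¹ / gen c z := by
        rw [eq_div_iff hcz, mul_comm]; exact hprod
      rw [hU]
      field_simp
      linear_combination hpg
    rw [hHz]
    have hsum := hsu.of_norm.hasSum.sub ((hasSum_geometric_of_norm_lt_one hz1').mul_left (p : ℂ))
    have hterm : (fun n => ((u n - p : ℝ) : ℂ) * z ^ n) =
        fun n => (u n : ℂ) * z ^ n - (p : ℂ) * z ^ n := by
      funext n; push_cast; ring
    rw [hterm]
    exact hsum

/-! ### Explicit renewal estimates -/

lemma one_le_kappa {b R L α : ℝ} (hR : 1 < R) (hb1 : b < 1) (hα : 0 < α)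
    (h : R * ((1 - b) * α) ≤ (L - 1) / (R - 1) - 1) : 1 ≤ kappa b R L α := by
  have hM : 0 < (1 - b) * α := mul_pos (by linarith) hα
  rw [kappa, one_le_div (Real.log_pos hR)]
  exact Real.log_le_log (by linarith) ((le_div_iff₀ hM).2 h)

lemma one_lt_radius {b R L α : ℝ} (hb0 : 0 < b) (hb1 : b < 1) (hα : 0 < α)
    (hκ : 1 ≤ kappa b R L α) : 1 < radius b R L α :=
  Real.one_lt_rpow (by linarith [div_pos (D_pos hb0 hb1 hα) hα]) (one_div_pos.2 (by linarith))

lemma rpow_kappa_lt {b R L α r : ℝ} (hb0 : 0 < b) (hb1 : b < 1) (hα : 0 < α)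
    (hκ : 1 ≤ kappa b R L α) (hr0 : 0 ≤ r) (hr : r < radius b R L α) :
    r ^ kappa b R L α < 1 + D b α / α := by
  have hκ0 : 0 < kappa b R L α := by linarith
  have h1 : 0 ≤ 1 + D b α / α := by linarith [div_pos (D_pos hb0 hb1 hα) hα]
  have := Real.rpow_lt_rpow hr0 hr hκ0
  rwa [radius, ← Real.rpow_mul h1, one_div, inv_mul_cancel₀ hκ0.ne', Real.rpow_one] at this

lemma renewalBound_nonneg {b R L α r : ℝ} (hb0 : 0 < b) (hb1 : b < 1) (hα : 0 < α)
    (hκ : 1 ≤ kappa b R L α) (hr1 : 1 < r) (hr : r < radius b R L α) :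
    0 ≤ renewalBound r b R L α := by
  have h1 := rpow_kappa_lt hb0 hb1 hα hκ (by linarith) hr
  have h2 := Real.one_le_rpow hr1.le (by linarith : 0 ≤ kappa b R L α)
  rw [div_eq_inv_mul] at h1
  exact div_nonneg (by linarith) (mul_nonneg (by linarith) (by linarith))

/-- The minimum (1 - b)D(α) on the unit circle is carried radially outwards: going from w to |z|w
changes c by at most ∑ c_k(|z|^k - 1), which log-convexity bounds by (1 - b)α(|z|^κ - 1). -/
theorem IsRenewalPair.abs_sub_mul_pow_le_renewalBound {c u : ℕ → ℝ} (h : IsRenewalPair c u)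
    {b R L α r : ℝ} (hA : HasGeomTail c R ((L - 1) / (R - 1) - 1)) (hb0 : 0 < b) (hb1 : b < 1)
    (hb : c 1 ≤ 1 - b) (hα : 0 < α) (hm : ∑' k, c (k + 1) = (1 - b) * α) (hr1 : 1 < r)
    (hrR : r < R) (hr : r < radius b R L α) (n : ℕ) :
    |u n - (1 + ∑' k, c (k + 1))⁻¹| * r ^ n ≤
      (1 + ∑' k, c (k + 1))⁻¹ * renewalBound r b R L α := by
  have h0 := h.nonneg
  have hs1 := hA.summable_one h0
  have hM : 0 < (1 - b) * α := mul_pos (by linarith) hα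
  have hRm : R * ((1 - b) * α) ≤ (L - 1) / (R - 1) - 1 := hm ▸ hA.mul_tsum_le h0
  have hκ := one_le_kappa hA.one_lt hb1 hα hRm
  have hA0 : 0 < (L - 1) / (R - 1) - 1 := (mul_pos (by linarith) hM).trans_le hRm
  set κ := kappa b R L α with hκdef
  have htail : ∀ ρ, 1 ≤ ρ → ρ ≤ R →
      ∑' k, c (k + 1) * ρ ^ (k + 1) ≤ (1 - b) * α * ρ ^ κ := fun ρ h1 h2 =>
    hA.tsum_le_mul_rpow h0 h1 h2 hA0 hM hm.le
  have hcirc : ∀ z : ℂ, 1 ≤ ‖z‖ → ‖z‖ ≤ R →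
      (1 - b) * α * (α⁻¹ * D b α - ‖z‖ ^ κ + 1) ≤ ‖gen c z‖ := by
    intro z hz1 hzR
    have hz0 : (‖z‖ : ℂ) ≠ 0 := by
      rw [Complex.ofReal_ne_zero]; linarith
    set w : ℂ := z / ‖z‖ with hw
    have hwn : ‖w‖ = 1 := by
      rw [hw, norm_div, Complex.norm_real, norm_norm, div_self (by linarith)]
    have hzw : (‖z‖ : ℂ) * w = z := by rw [hw, mul_div_cancel₀ _ hz0]
    have h1 := norm_gen_sub_le h0 hz1 (hA.summable_of_le h0 (by linarith) hzR) hwn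
    rw [hzw] at h1
    have h2 := mul_D_le_norm_gen h.anti h0 h.zero hs1 hb0 hb1 hb hα hm hwn
    have h3 := htail _ hz1 hzR
    have h4 := norm_sub_norm_le (gen c w) (gen c z)
    rw [norm_sub_rev] at h4
    have h5 : (1 - b) * α * (α⁻¹ * D b α - ‖z‖ ^ κ + 1) =
        (1 - b) * D b α - ((1 - b) * α * ‖z‖ ^ κ - (1 - b) * α) := by
      field_simp; ring
    rw [h5]
    linarith
  have hpos : ∀ x : ℝ, 0 ≤ x → x < radius b R L α → 0 < α⁻¹ * D b α - x ^ κ + 1 := by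
    intro x hx0 hx
    have := rpow_kappa_lt hb0 hb1 hα hκ hx0 hx
    rw [div_eq_inv_mul] at this
    linarith
  -- A slightly larger radius makes H holomorphic on a neighbourhood of the closed disc of radius r.
  obtain ⟨ρ, hρ1, hρ2⟩ := exists_between (lt_min hrR hr)
  rw [lt_min_iff] at hρ2
  have hne : ∀ z : ℂ, ‖z‖ < ρ → gen c z ≠ 0 := by
    intro z hz
    rcases lt_or_ge ‖z‖ 1 with h1 | h1
    · exact gen_ne_zero_of_norm_lt_one h.anti h0 h.zero hs1 h1
    · have h2 := hcirc z h1 (by linarith)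
      have h3 := mul_pos hM (hpos ‖z‖ (norm_nonneg _) (by linarith))
      exact norm_pos_iff.1 (by linarith)
  have hE : 0 < (1 - b) * α * (α⁻¹ * D b α - r ^ κ + 1) :=
    mul_pos hM (hpos r (by linarith) hr)
  have hfin := h.abs_sub_mul_pow_le hr1 hρ1 (hA.summable_of_le h0 (by linarith) hρ2.1.le) hne hE
    (fun z hz => by
      have := hcirc z (by linarith) (by linarith)
      rwa [hz] at this) n
  refine hfin.trans (mul_le_mul_of_nonneg_left ?_ ?_)
  · have h3 := htail r hr1.le hrR.le
    have h4 : renewalBound r b R L α = ((1 - b) * α * r ^ κ - (1 - b) * α) /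
        ((r - 1) * ((1 - b) * α * (α⁻¹ * D b α - r ^ κ + 1))) := by
      rw [renewalBound, ← hκdef]
      rw [show (1 - b) * α * r ^ κ - (1 - b) * α = (1 - b) * α * (r ^ κ - 1) by ring,
        mul_left_comm (r - 1), mul_div_mul_left _ _ hM.ne']
    rw [h4, hm]
    exact div_le_div_of_nonneg_right (by linarith) (mul_nonneg (by linarith) hE.le)
  · have : 0 ≤ ∑' k, c (k + 1) := tsum_nonneg fun k => h0 _
    positivity

lemma sub_sum_mul_pow_le {c : ℕ → ℝ} (h0 : ∀ k, 0 ≤ c k) (hs : Summable c) {r : ℝ} (hr1 : 1 ≤ r)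
    (hsr : Summable fun k => c k * r ^ k) (n : ℕ) :
    (∑' k, c (k + (n + 1))) * r ^ n ≤ (∑' k, c (k + 1) * r ^ (k + 1)) / r := by
  have hr0 : 0 < r := by linarith
  rw [le_div_iff₀ hr0, mul_assoc, ← pow_succ, ← tsum_mul_right]
  have hs' := (summable_nat_add_iff 1).2 hsr
  have h1 : (∑' k, c (k + n + 1) * r ^ (k + n + 1)) ≤ ∑' k, c (k + 1) * r ^ (k + 1) := by
    rw [← hs'.sum_add_tsum_nat_add n]
    have : 0 ≤ ∑ k ∈ Finset.range n, c (k + 1) * r ^ (k + 1) :=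
      Finset.sum_nonneg fun k _ => mul_nonneg (h0 _) (pow_nonneg hr0.le _)
    linarith
  refine le_trans (Summable.tsum_le_tsum (fun k => ?_)
    (((summable_nat_add_iff (n + 1)).2 hs).mul_right _) ((summable_nat_add_iff n).2 hs')) h1
  exact mul_le_mul_of_nonneg_left (pow_le_pow_right₀ hr1 (by omega)) (h0 _)

/-- The elementary bound when `∑_{k ≥ 1} c k r ^ k < 1`. -/
lemma IsRenewalPair.abs_sub_mul_pow_le_of_tsum_lt_one {c u : ℕ → ℝ} (h : IsRenewalPair c u)
    {r q : ℝ} (hr1 : 1 ≤ r) (hsr : Summable fun k => c k * r ^ k)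
    (hq : ∑' k, c (k + 1) * r ^ (k + 1) ≤ q) (hq1 : q < 1) (n : ℕ) :
    |u n - (1 + ∑' k, c (k + 1))⁻¹| * r ^ n ≤ q / (r * (1 - q)) := by
  have h0 := h.nonneg
  have hr0 : 0 < r := by linarith
  have hs1 : Summable c := Summable.of_nonneg_of_le h0 (fun k =>
    le_mul_of_one_le_right (h0 k) (one_le_pow₀ hr1)) hsr
  set m := ∑' k, c (k + 1) with hm
  have hm0 : 0 ≤ m := tsum_nonneg fun k => h0 _
  set p := (1 + m)⁻¹ with hp
  have hp0 : 0 < p := inv_pos.2 (by linarith)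
  have hp1 : p ≤ 1 := inv_le_one_of_one_le₀ (by linarith)
  have htot : ∑' k, c k = 1 + m := by rw [hs1.tsum_eq_zero_add, h.zero]
  have hq0 : 0 ≤ q := le_trans (tsum_nonneg fun k => mul_nonneg (h0 _) (pow_nonneg hr0.le _)) hq
  induction n using Nat.strong_induction_on with
  | _ n ih =>
  have htail : ∑ k ∈ Finset.range (n + 1), c k = (1 + m) - ∑' k, c (k + (n + 1)) := by
    rw [← htot, ← hs1.sum_add_tsum_nat_add (n + 1)]; ring
  have hrec : u n - p = p * ∑' k, c (k + (n + 1)) -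
      ∑ k ∈ Finset.range n, c (k + 1) * (u (n - (k + 1)) - p) := by
    have h1 : ∑ k ∈ Finset.range (n + 1), c k * (u (n - k) - p) = p * ∑' k, c (k + (n + 1)) := by
      simp only [mul_sub, Finset.sum_sub_distrib, ← Finset.sum_mul]
      rw [h.conv n, htail]
      have : p * (1 + m) = 1 := inv_mul_cancel₀ (by linarith)
      linear_combination -this
    rw [Finset.sum_range_succ', h.zero, Nat.sub_zero, one_mul] at h1
    linarith
  have hB : 0 ≤ q / (r * (1 - q)) := div_nonneg hq0 (mul_nonneg hr0.le (by linarith))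
  have hsum : |∑ k ∈ Finset.range n, c (k + 1) * (u (n - (k + 1)) - p)| * r ^ n ≤
      q * (q / (r * (1 - q))) := by
    rw [← abs_of_nonneg (pow_nonneg hr0.le n), ← abs_mul, Finset.sum_mul]
    refine (Finset.abs_sum_le_sum_abs _ _).trans ?_
    calc _ ≤ ∑ k ∈ Finset.range n, c (k + 1) * r ^ (k + 1) * (q / (r * (1 - q))) := by
          refine Finset.sum_le_sum fun k hk => ?_
          have hk' := Finset.mem_range.1 hk
          rw [abs_mul, abs_mul, abs_of_nonneg (h0 _), abs_of_nonneg (pow_nonneg hr0.le n)]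
          have h2 := ih (n - (k + 1)) (by omega)
          have h3 : r ^ n = r ^ (k + 1) * r ^ (n - (k + 1)) := by
            rw [← pow_add]; congr 1; omega
          calc _ = c (k + 1) * r ^ (k + 1) * (|u (n - (k + 1)) - p| * r ^ (n - (k + 1))) := by
                rw [h3]; ring
            _ ≤ _ := mul_le_mul_of_nonneg_left h2 (mul_nonneg (h0 _) (pow_nonneg hr0.le _))
      _ = (∑ k ∈ Finset.range n, c (k + 1) * r ^ (k + 1)) * (q / (r * (1 - q))) := by
          rw [Finset.sum_mul]
      _ ≤ _ := by
          refine mul_le_mul_of_nonneg_right (le_trans ?_ hq) hB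
          exact Summable.sum_le_tsum _ (fun k _ => mul_nonneg (h0 _) (pow_nonneg hr0.le _))
            ((summable_nat_add_iff 1).2 hsr)
  have hlead : |p * ∑' k, c (k + (n + 1))| * r ^ n ≤ q / r := by
    have h3 : 0 ≤ ∑' k, c (k + (n + 1)) := tsum_nonneg fun k => h0 _
    rw [abs_of_nonneg (mul_nonneg hp0.le h3), mul_assoc]
    refine (mul_le_of_le_one_left (mul_nonneg h3 (pow_nonneg hr0.le _)) hp1).trans ?_
    refine (sub_sum_mul_pow_le h0 hs1 hr1 hsr n).trans ?_
    gcongr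
  rw [hrec]
  have h4 := abs_sub (p * ∑' k, c (k + (n + 1)))
    (∑ k ∈ Finset.range n, c (k + 1) * (u (n - (k + 1)) - p))
  have h5 := mul_le_mul_of_nonneg_right h4 (pow_nonneg hr0.le n)
  -- The bound q / (r(1 - q)) is the fixed point of B ↦ q/r + qB, where q/r comes from the tail of c
  -- and qB from the convolution with earlier terms.
  have h6 : q / r + q * (q / (r * (1 - q))) = q / (r * (1 - q)) := by
    have : 1 - q ≠ 0 := by linarith
    field_simp; ring
  linarith

/-- This covers α ≤ 1. Since (1 - b)D(1) ≤ b, the condition r^κ < 1 + D(1) forces q = (1 - b) r^κ <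
1, so the contraction argument applies; its constant is then compared with the one at α = 1. -/
lemma IsRenewalPair.abs_sub_mul_pow_le_renewalBound_one {c u : ℕ → ℝ} (h : IsRenewalPair c u)
    {b R L r : ℝ} (hA : HasGeomTail c R ((L - 1) / (R - 1) - 1)) (hb0 : 0 < b) (hb1 : b < 1)
    (hm : ∑' k, c (k + 1) ≤ 1 - b) (hRA : R * (1 - b) ≤ (L - 1) / (R - 1) - 1) (hr1 : 1 < r)
    (hrR : r < R) (hr : r < radius b R L 1) (n : ℕ) :
    |u n - (1 + ∑' k, c (k + 1))⁻¹| * r ^ n ≤ renewalBound r b R L 1 := by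
  have h0 := h.nonneg
  have hr0 : 0 < r := by linarith
  have hR := hA.one_lt
  have hκ := one_le_kappa hR hb1 one_pos (L := L) (by rwa [mul_one])
  have hM : 0 < 1 - b := by linarith
  have hq := hA.tsum_le_mul_rpow h0 hr1.le hrR.le ((mul_pos (by linarith) hM).trans_le hRA) hM hm
  have hκ' : Real.log (((L - 1) / (R - 1) - 1) / (1 - b)) / Real.log R = kappa b R L 1 := by
    rw [kappa, mul_one]
  rw [hκ'] at hq
  have hlt := rpow_kappa_lt hb0 hb1 one_pos hκ hr0.le hr
  have hD : (1 - b) * D b 1 ≤ b := by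
    rw [one_sub_mul_D hb1 one_pos]
    refine circleGap_le hb0 hb1 (Real.sin_pos_of_pos_of_lt_pi ?_ ?_) (Real.sin_le_one _)
    · have := Real.pi_pos; positivity
    · linarith [Real.pi_pos]
  rw [div_one] at hlt
  rw [renewalBound]
  set κ := kappa b R L 1 with hκd
  have hq1 : (1 - b) * r ^ κ < 1 := by nlinarith
  refine (h.abs_sub_mul_pow_le_of_tsum_lt_one hr1.le (hA.summable_of_le h0 hr0.le hrR.le) hq hq1
    n).trans ?_
  have hrκ : r ≤ r ^ κ := Real.self_le_rpow_of_one_le hr1.le hκ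
  have hden : 0 < 1⁻¹ * D b 1 - r ^ κ + 1 := by rw [inv_one]; linarith
  rw [div_le_div_iff₀ (mul_pos hr0 (by linarith)) (mul_pos (by linarith) hden)]
  have h1 : (1 - b) * (1⁻¹ * D b 1 - r ^ κ + 1) ≤ 1 - (1 - b) * r ^ κ := by
    rw [inv_one]; nlinarith
  have h2 : r ^ κ * (r - 1) ≤ (r ^ κ - 1) * r := by linarith
  calc (1 - b) * r ^ κ * ((r - 1) * (1⁻¹ * D b 1 - r ^ κ + 1))
      = (r ^ κ * (r - 1)) * ((1 - b) * (1⁻¹ * D b 1 - r ^ κ + 1)) := by ring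
    _ ≤ ((r ^ κ - 1) * r) * (1 - (1 - b) * r ^ κ) :=
        mul_le_mul h2 h1 (mul_pos hM hden).le (mul_nonneg (by linarith) hr0.le)
    _ = _ := by ring

/-! ### The range of `α` -/

lemma rpow_alpha0 {b R L : ℝ} (hR : 1 < R) (hb1 : b < 1) (hL : R ≤ L) :
    R ^ alpha0 b R L = 1 + ((L - 1) / (R - 1) - 1) * (R - 1) / ((1 - b) * R) := by
  have hR0 : 0 < R := by linarith
  have hpos : 0 < (L - b * R) / ((1 - b) * R) :=
    div_pos (by nlinarith) (mul_pos (by linarith) hR0)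
  rw [alpha0, Real.rpow_def_of_pos hR0, mul_div_cancel₀ _ (Real.log_pos hR).ne',
    Real.exp_log hpos]
  have h1 : R - 1 ≠ 0 := by linarith
  have h2 : 1 - b ≠ 0 := by linarith
  field_simp; ring

/-- By Bernoulli, α(R - 1) ≤ R^α - 1 ≤ R^α₀ - 1. Hence κ ≥ 1 on the whole interval, including values
of α that no chain realizes. -/
lemma mul_le_of_mem_Icc_alpha0 {b R L α : ℝ} (hR : 1 < R) (hb1 : b < 1) (hL : R ≤ L)
    (hα : α ∈ Set.Icc 1 (alpha0 b R L)) : R * ((1 - b) * α) ≤ (L - 1) / (R - 1) - 1 := by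
  have h1 := one_add_mul_self_le_rpow_one_add (s := R - 1) (by linarith) hα.1
  rw [add_sub_cancel] at h1
  have h2 := h1.trans (Real.rpow_le_rpow_of_exponent_le hR.le hα.2)
  rw [rpow_alpha0 hR hb1 hL] at h2
  have h3 : 0 < (1 - b) * R := mul_pos (by linarith) (by linarith)
  have h4 : α * (R - 1) ≤ ((L - 1) / (R - 1) - 1) * (R - 1) / ((1 - b) * R) := by linarith
  rw [le_div_iff₀ h3] at h4
  have h5 : R * ((1 - b) * α) * (R - 1) ≤ ((L - 1) / (R - 1) - 1) * (R - 1) := by linarith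
  exact le_of_mul_le_mul_right h5 (by linarith)

/-- Among decreasing sequences bounded by 1 - b with given sum (1 - b)α, the geometric moment is
least for the one that is constant over the first α indices, which would give (1 - b)R(R^α - 1)/(R -
1) ≤ N - 1. For non-integral α the comparison uses the tangent at α of the convex function x ↦ R(R^x
- 1)/(R - 1), together with Abel summation. -/
lemma HasGeomTail.le_alpha0 {c : ℕ → ℝ} {b R L α : ℝ} (hA : HasGeomTail c R ((L - 1) / (R - 1) - 1))
    (hc : Antitone c) (h0 : ∀ k, 0 ≤ c k) (hb1 : b < 1) (hb : c 1 ≤ 1 - b) (hL : R ≤ L)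
    (hm : ∑' k, c (k + 1) = (1 - b) * α) : α ≤ alpha0 b R L := by
  have hR := hA.one_lt
  have hR0 : 0 < R := by linarith
  have hR1 : 0 < R - 1 := by linarith
  have hlog := Real.log_pos hR
  -- B is the slope of that tangent and a its intercept.
  set B := R * R ^ α * Real.log R / (R - 1) with hB
  set a := R / (R - 1) * (R ^ α - 1) - B * α with ha
  have hRα : 0 < R ^ α := Real.rpow_pos_of_pos hR0 α
  have htan : ∀ x : ℝ, R ^ α * (1 + Real.log R * (x - α)) ≤ R ^ x := by
    intro x
    have h1 := Real.add_one_le_exp (Real.log R * (x - α))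
    have h2 : R ^ x = R ^ α * Real.exp (Real.log R * (x - α)) := by
      rw [← Real.rpow_def_of_pos hR0, ← Real.rpow_add hR0]; congr 1; ring
    rw [h2]
    exact mul_le_mul_of_nonneg_left (by linarith) hRα.le
  have ha0 : a ≤ 0 := by
    have h1 := htan 0
    rw [Real.rpow_zero] at h1
    have h2 : a = R / (R - 1) * (R ^ α * (1 + Real.log R * (0 - α)) - 1) := by
      rw [ha, hB]; field_simp; ring
    rw [h2]
    exact mul_nonpos_of_nonneg_of_nonpos (div_nonneg hR0.le hR1.le) (by linarith)
  have hpart : ∀ n : ℕ, a ≤ ∑ k ∈ Finset.range (n + 1), (R ^ (k + 1) - B) := by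
    intro n
    rw [Finset.sum_sub_distrib, Finset.sum_const, Finset.card_range, nsmul_eq_mul]
    have h1 : ∑ k ∈ Finset.range (n + 1), R ^ (k + 1) = R / (R - 1) * (R ^ (n + 1) - 1) := by
      simp only [pow_succ' R]
      rw [← Finset.mul_sum]
      have := geom_sum_eq hR.ne' (n + 1)
      rw [pow_succ'] at this
      rw [this]; ring
    have h2 := htan ((n + 1 : ℕ) : ℝ)
    rw [Real.rpow_natCast] at h2
    have h3 := mul_le_mul_of_nonneg_left h2 (div_nonneg hR0.le hR1.le)
    rw [h1, ha]
    have h4 : R / (R - 1) * (R ^ α * (1 + Real.log R * (((n + 1 : ℕ) : ℝ) - α))) =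
        R / (R - 1) * R ^ α + B * ((n + 1 : ℕ) : ℝ) - B * α := by
      rw [hB]; field_simp; ring
    linarith
  have hs' := (summable_nat_add_iff 1).2 (hA.summable_one h0)
  have hsR := (summable_nat_add_iff 1).2 hA.summable
  have hlim : a * c 1 ≤ ∑' k, c (k + 1) * R ^ (k + 1) - B * ∑' k, c (k + 1) := by
    have hsum := (hsR.hasSum.sub (hs'.hasSum.mul_left B)).tendsto_sum_nat
    refine ge_of_tendsto' ((tendsto_add_atTop_iff_nat 1).2 hsum) fun n => ?_
    have := mul_le_sum_mul_of_le_partial_sums (c := fun k => c (k + 1))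
      (fun i j h => hc (by omega)) (fun k => h0 _) hpart n
    refine this.trans_eq (Finset.sum_congr rfl fun k _ => by ring)
  -- The intercept is nonpositive, so the upper bound on c 1 is the one needed.
  have h1 : a * (1 - b) ≤ a * c 1 := mul_le_mul_of_nonpos_left hb ha0
  rw [hm] at hlim
  have h2 : (1 - b) * (R / (R - 1) * (R ^ α - 1)) ≤ (L - 1) / (R - 1) - 1 := by
    have := hA.tsum_le
    have h3 : (1 - b) * (R / (R - 1) * (R ^ α - 1)) = a * (1 - b) + B * ((1 - b) * α) := by
      rw [ha]; ring
    linarith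
  have h3 : R ^ α ≤ R ^ alpha0 b R L := by
    rw [rpow_alpha0 hR hb1 hL]
    have h4 : 0 < (1 - b) * R := mul_pos (by linarith) hR0
    rw [← sub_le_iff_le_add', le_div_iff₀ h4]
    calc (R ^ α - 1) * ((1 - b) * R) = (1 - b) * (R / (R - 1) * (R ^ α - 1)) * (R - 1) := by
          field_simp
      _ ≤ _ := mul_le_mul_of_nonneg_right h2 hR1.le
  exact (Real.rpow_le_rpow_left_iff hR).1 h3

/-- Continuity in α makes the infimum in r₀ attained and the supremum in K₀ finite on the compact
range of α. -/
lemma continuousOn_D {b : ℝ} (hb1 : b < 1) : ContinuousOn (D b) (Set.Ioi 0) := by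
  have h1 : ContinuousOn (fun α : ℝ => circleGap b (Real.sin (Real.pi / (1 + α) / 2)) / (1 - b))
      (Set.Ioi 0) := by
    have hs : ContinuousOn (fun α : ℝ => Real.sin (Real.pi / (1 + α) / 2)) (Set.Ioi 0) := by
      refine Real.continuous_sin.comp_continuousOn (ContinuousOn.div_const
        (continuousOn_const.div (by fun_prop) fun x hx => ?_) _)
      have : (0 : ℝ) < x := hx
      linarith
    refine ContinuousOn.div_const ?_ _
    unfold circleGap
    refine ContinuousOn.div ?_ (continuousOn_const.mul hs) fun x hx => ?_
    · exact (Real.continuous_sqrt.comp_continuousOn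
        (continuousOn_const.add (continuousOn_const.mul (hs.pow 2)))).sub continuousOn_const
    · have hx' : (0 : ℝ) < x := hx
      have hpi := Real.pi_pos
      have := Real.sin_pos_of_pos_of_lt_pi (x := Real.pi / (1 + x) / 2) (by positivity) (by
        have : Real.pi / (1 + x) ≤ Real.pi := div_le_self hpi.le (by linarith)
        linarith)
      positivity
  refine h1.congr fun x hx => ?_
  have hb : 1 - b ≠ 0 := by linarith
  change D b x = circleGap b (Real.sin (Real.pi / (1 + x) / 2)) / (1 - b)
  rw [← one_sub_mul_D hb1 hx, mul_div_cancel_left₀ _ hb]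

lemma continuousOn_kappa {b R L : ℝ} (hb1 : b < 1) (hA : 0 < (L - 1) / (R - 1) - 1) :
    ContinuousOn (kappa b R L) (Set.Ioi 0) := by
  have hpos : ∀ x : ℝ, x ∈ Set.Ioi (0 : ℝ) → 0 < (1 - b) * x := fun x hx =>
    mul_pos (by linarith) hx
  refine ContinuousOn.div_const (ContinuousOn.log (continuousOn_const.div (by fun_prop)
    fun x hx => (hpos x hx).ne') fun x hx => ?_) _
  exact (div_pos hA (hpos x hx)).ne'

lemma one_le_kappa_of_mem {b R L α : ℝ} (hR : 1 < R) (hb1 : b < 1) (hL : R ≤ L)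
    (hα : α ∈ Set.Icc 1 (alpha0 b R L)) : 1 ≤ kappa b R L α :=
  one_le_kappa hR hb1 (by linarith [hα.1]) (mul_le_of_mem_Icc_alpha0 hR hb1 hL hα)

lemma tail_pos_of_one_le_alpha0 {b R L : ℝ} (hR : 1 < R) (hb1 : b < 1) (hL : R ≤ L)
    (hα0 : 1 ≤ alpha0 b R L) : R * (1 - b) ≤ (L - 1) / (R - 1) - 1 := by
  simpa using mul_le_of_mem_Icc_alpha0 hR hb1 hL (α := 1) ⟨le_rfl, hα0⟩

lemma continuousOn_radius {b R L : ℝ} (hR : 1 < R) (hb0 : 0 < b) (hb1 : b < 1) (hL : R ≤ L)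
    (hα0 : 1 ≤ alpha0 b R L) :
    ContinuousOn (radius b R L) (Set.Icc 1 (alpha0 b R L)) := by
  have hsub : Set.Icc 1 (alpha0 b R L) ⊆ Set.Ioi 0 := fun x hx => lt_of_lt_of_le one_pos hx.1
  have hA : 0 < (L - 1) / (R - 1) - 1 :=
    (mul_pos (by linarith) (by linarith)).trans_le (tail_pos_of_one_le_alpha0 hR hb1 hL hα0)
  refine ContinuousOn.rpow (continuousOn_const.add
    (((continuousOn_D hb1).mono hsub).div continuousOn_id fun x hx => (hsub hx).ne'))
    (continuousOn_const.div ((continuousOn_kappa hb1 hA).mono hsub) fun x hx => ?_) fun x hx => ?_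
  · linarith [one_le_kappa_of_mem hR hb1 hL hx]
  · left
    have := div_pos (D_pos hb0 hb1 (hsub hx)) (hsub hx)
    exact ne_of_gt (by linarith : 0 < 1 + D b x / x)

lemma one_lt_r0 {b R L : ℝ} (hR : 1 < R) (hb0 : 0 < b) (hb1 : b < 1) (hL : R ≤ L)
    (hα0 : 1 ≤ alpha0 b R L) : 1 < r0 b R L := by
  have hcomp := isCompact_Icc.image_of_continuousOn (continuousOn_radius hR hb0 hb1 hL hα0)
  obtain ⟨α, hα, h⟩ := hcomp.sInf_mem ((Set.nonempty_Icc.2 hα0).image _)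
  rw [r0, ← h]
  exact lt_min hR (one_lt_radius hb0 hb1 (by linarith [hα.1]) (one_le_kappa_of_mem hR hb1 hL hα))

lemma r0_le_radius {b R L : ℝ} (hR : 1 < R) (hb0 : 0 < b) (hb1 : b < 1) (hL : R ≤ L)
    (hα0 : 1 ≤ alpha0 b R L) {α : ℝ} (hα : α ∈ Set.Icc 1 (alpha0 b R L)) :
    r0 b R L ≤ radius b R L α :=
  (min_le_right _ _).trans (csInf_le
    (isCompact_Icc.image_of_continuousOn (continuousOn_radius hR hb0 hb1 hL hα0)).bddBelow
    (Set.mem_image_of_mem _ hα))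

lemma renewalBound_le_K0 {b R L r : ℝ} (hR : 1 < R) (hb0 : 0 < b) (hb1 : b < 1) (hL : R ≤ L)
    (hα0 : 1 ≤ alpha0 b R L) (hr1 : 1 < r) (hr : r < r0 b R L) {α : ℝ}
    (hα : α ∈ Set.Icc 1 (alpha0 b R L)) : renewalBound r b R L α ≤ K0 r b R L := by
  have hsub : Set.Icc 1 (alpha0 b R L) ⊆ Set.Ioi 0 := fun x hx => lt_of_lt_of_le one_pos hx.1
  have hA : 0 < (L - 1) / (R - 1) - 1 :=
    (mul_pos (by linarith) (by linarith)).trans_le (tail_pos_of_one_le_alpha0 hR hb1 hL hα0)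
  have hrκ : ContinuousOn (fun x => r ^ kappa b R L x) (Set.Icc 1 (alpha0 b R L)) :=
    continuousOn_const.rpow ((continuousOn_kappa hb1 hA).mono hsub) fun x _ => Or.inl (by linarith)
  have hcont : ContinuousOn (renewalBound r b R L) (Set.Icc 1 (alpha0 b R L)) := by
    refine (hrκ.sub continuousOn_const).div (continuousOn_const.mul
      ((((continuousOn_id.inv₀ fun x hx => (hsub hx).ne').mul
        ((continuousOn_D hb1).mono hsub)).sub hrκ).add continuousOn_const)) fun x hx => ?_
    have h1 := rpow_kappa_lt hb0 hb1 (hsub hx) (one_le_kappa_of_mem hR hb1 hL hx) (by linarith)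
      (hr.trans_le (r0_le_radius hR hb0 hb1 hL hα0 hx))
    rw [div_eq_inv_mul] at h1
    refine mul_ne_zero (by linarith) ?_
    exact ne_of_gt (by linarith : 0 < x⁻¹ * D b x - r ^ kappa b R L x + 1)
  exact le_csSup (isCompact_Icc.image_of_continuousOn hcont).bddAbove (Set.mem_image_of_mem _ hα)

theorem IsRenewalPair.abs_sub_mul_pow_le_K0 {c u : ℕ → ℝ} (h : IsRenewalPair c u)
    {b R L r : ℝ} (hA : HasGeomTail c R ((L - 1) / (R - 1) - 1)) (hb0 : 0 < b) (hb1 : b < 1)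
    (hb : c 1 ≤ 1 - b) (hL : R ≤ L) (hα0 : 1 ≤ alpha0 b R L) (hr1 : 1 < r) (hr : r < r0 b R L)
    (n : ℕ) : |u n - (1 + ∑' k, c (k + 1))⁻¹| * r ^ n ≤ K0 r b R L := by
  have hR := hA.one_lt
  have hrR : r < R := hr.trans_le (min_le_left _ _)
  have hrad := fun {α : ℝ} (hα : α ∈ Set.Icc 1 (alpha0 b R L)) =>
    hr.trans_le (r0_le_radius hR hb0 hb1 hL hα0 hα)
  have hm0 : 0 ≤ ∑' k, c (k + 1) := tsum_nonneg fun k => h.nonneg _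
  rcases le_or_gt (∑' k, c (k + 1)) (1 - b) with hm | hm
  · have hmem : (1 : ℝ) ∈ Set.Icc 1 (alpha0 b R L) := ⟨le_rfl, hα0⟩
    exact (h.abs_sub_mul_pow_le_renewalBound_one hA hb0 hb1 hm
      (tail_pos_of_one_le_alpha0 hR hb1 hL hα0) hr1 hrR (hrad hmem) n).trans
      (renewalBound_le_K0 hR hb0 hb1 hL hα0 hr1 hr hmem)
  · have hb' : 0 < 1 - b := by linarith
    set α := (∑' k, c (k + 1)) / (1 - b) with hαdef
    have hmα : ∑' k, c (k + 1) = (1 - b) * α := by rw [hαdef]; field_simp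
    have hα1 : 1 ≤ α := (one_le_div hb').2 hm.le
    have hmem : α ∈ Set.Icc 1 (alpha0 b R L) :=
      ⟨hα1, hA.le_alpha0 h.anti h.nonneg hb1 hb hL hmα⟩
    refine (h.abs_sub_mul_pow_le_renewalBound hA hb0 hb1 hb (by linarith) hmα hr1 hrR
      (hrad hmem) n).trans (le_trans ?_ (renewalBound_le_K0 hR hb0 hb1 hL hα0 hr1 hr hmem))
    -- The factor p ≤ 1 is dropped, since K₀ does not carry it when π(C) is unknown.
    exact mul_le_of_le_one_left (renewalBound_nonneg hb0 hb1 (by linarith)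
      (one_le_kappa_of_mem hR hb1 hL hmem) hr1 (hrad hmem))
      (inv_le_one_of_one_le₀ (by linarith))

/-- A qualitative version, free of the conditions b < 1 and α₀ ≥ 1; it supplies the unconditional
part of the theorem. -/
theorem IsRenewalPair.exists_abs_sub_mul_pow_le {c u : ℕ → ℝ} (h : IsRenewalPair c u)
    {R A : ℝ} (hA : HasGeomTail c R A) (hc1 : c 1 < 1) :
    ∃ r k : ℝ, 1 < r ∧ r < R ∧ 0 ≤ k ∧
      ∀ n, |u n - (1 + ∑' k, c (k + 1))⁻¹| * r ^ n ≤ k := by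
  have hR := hA.one_lt
  have hm0 : 0 ≤ ∑' k, c (k + 1) := tsum_nonneg fun k => h.nonneg _
  rcases hm0.eq_or_lt with hm | hm
  · obtain ⟨r, hr1, hrR⟩ := exists_between hR
    refine ⟨r, 0 / (r * (1 - 0)), hr1, hrR, by simp,
      fun n => h.abs_sub_mul_pow_le_of_tsum_lt_one hr1.le
      (hA.summable_of_le h.nonneg (by linarith) hrR.le) ?_ one_pos n⟩
    have h1 : ∀ k, c (k + 1) = 0 := by
      have := (hasSum_zero_iff_of_nonneg (fun k => h.nonneg (k + 1))).1
        (hm ▸ ((summable_nat_add_iff 1).2 (hA.summable_one h.nonneg)).hasSum)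
      exact fun k => congrFun this k
    simp [h1]
  -- Any b in (0, 1) with c 1 ≤ 1 - b would do, independently of the given minorization.
  · set b := min ((1 - c 1) / 2) (1 / 2) with hb
    have hb0 : 0 < b := lt_min (by linarith) (by norm_num)
    have hb1 : b < 1 := (min_le_right _ _).trans_lt (by norm_num)
    have hbc : c 1 ≤ 1 - b := by
      have : b ≤ (1 - c 1) / 2 := min_le_left _ _
      linarith [h.nonneg 1]
    have hb' : 0 < 1 - b := by linarith
    set α := (∑' k, c (k + 1)) / (1 - b) with hαdef
    have hα : 0 < α := div_pos hm hb'
    have hmα : ∑' k, c (k + 1) = (1 - b) * α := by rw [hαdef]; field_simp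
    -- Chosen so that N - 1 becomes A.
    set L := 1 + (A + 1) * (R - 1) with hL
    have hAL : (L - 1) / (R - 1) - 1 = A := by
      have : R - 1 ≠ 0 := by linarith
      rw [hL]; field_simp; ring
    have hA' : HasGeomTail c R ((L - 1) / (R - 1) - 1) := hAL ▸ hA
    have hκ := one_le_kappa hR hb1 hα (L := L) (hmα ▸ hA'.mul_tsum_le h.nonneg)
    obtain ⟨r, hr1, hr⟩ := exists_between (lt_min hR (one_lt_radius hb0 hb1 hα hκ))
    rw [lt_min_iff] at hr
    refine ⟨r, _, hr1, hr.1, ?_,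
      h.abs_sub_mul_pow_le_renewalBound hA' hb0 hb1 hbc hα hmα hr1 hr.1 hr.2⟩
    exact mul_nonneg (inv_nonneg.2 (by linarith)) (renewalBound_nonneg hb0 hb1 hα hκ hr1 hr.2)

section

/-! ### The chain killed on leaving `C` -/

variable {S : Type*} [MeasurableSpace S]

open Classical in
/-- The kernel `P` killed on `C`. -/
noncomputable def killed (P : Kernel S S) {C : Set S} (hC : MeasurableSet C) : Kernel S S :=
  Kernel.piecewise hC 0 P

/-- The expected occupation, `n` steps after a regeneration, before the next visit to `C`. -/
noncomputable def excursion (P : Kernel S S) {C : Set S} (hC : MeasurableSet C) (ν : Measure S)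
    (n : ℕ) : Measure S := ν.bind ⇑(killed P hC ^ n)

/-- The law of the chain started from `ν`. -/
noncomputable def lawFrom (P : Kernel S S) (ν : Measure S) (n : ℕ) : Measure S := ν.bind ⇑(P ^ n)

lemma kernel_pow_succ (P : Kernel S S) (n : ℕ) (x : S) :
    (P ^ (n + 1)) x = (P x).bind ⇑(P ^ n) := by
  rw [Kernel.pow_add, pow_one, Kernel.comp_apply]

lemma kernel_pow_succ' (P : Kernel S S) (n : ℕ) (x : S) :
    (P ^ (n + 1)) x = ((P ^ n) x).bind P := by
  rw [add_comm, Kernel.pow_add, pow_one, Kernel.comp_apply]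

lemma bind_kernel_pow_succ (P : Kernel S S) (μ : Measure S) (n : ℕ) :
    μ.bind ⇑(P ^ (n + 1)) = (μ.bind ⇑(P ^ n)).bind P := by
  rw [Measure.bind_bind (Kernel.aemeasurable _) (Kernel.aemeasurable _)]
  congr 1
  ext1 x
  exact kernel_pow_succ' P n x

lemma kernel_pow_zero (P : Kernel S S) (x : S) : (P ^ 0) x = Measure.dirac x := by
  rw [pow_zero]
  exact Kernel.id_apply x

lemma bind_kernel_pow_zero (P : Kernel S S) (μ : Measure S) : μ.bind ⇑(P ^ 0) = μ := by
  have : ⇑(P ^ 0) = Measure.dirac := by ext1 x; exact kernel_pow_zero P x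
  rw [this, Measure.bind_dirac]

instance isMarkovKernel_pow (P : Kernel S S) [IsMarkovKernel P] (n : ℕ) :
    IsMarkovKernel (P ^ n) := by
  induction n with
  | zero => exact ⟨fun x => by rw [kernel_pow_zero]; infer_instance⟩
  | succ n ih => rw [Kernel.pow_add, pow_one]; infer_instance

lemma lintegral_kernel_pow_succ' (P : Kernel S S) (n : ℕ) (x : S) {f : S → ℝ≥0∞}
    (hf : Measurable f) :
    ∫⁻ y, f y ∂((P ^ (n + 1)) x) = ∫⁻ y, ∫⁻ z, f z ∂(P y) ∂((P ^ n) x) := by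
  rw [kernel_pow_succ', Measure.lintegral_bind (Kernel.aemeasurable _) hf.aemeasurable]

/-- A Markov kernel with an atom `C`, on which it equals the probability measure `ν`, and a
geometric drift towards `C`. -/
structure IsAtomicDrift (P : Kernel S S) (C : Set S) (ν : Measure S) (V : Weight S)
    (lam K : ℝ) : Prop where
  meas : MeasurableSet C
  eq_of_mem : ∀ x ∈ C, P x = ν
  lam_pos : 0 < lam
  lam_lt_one : lam < 1
  drift : ∀ x ∉ C, ∫⁻ y, ENNReal.ofReal (V y) ∂(P x) ≤ ENNReal.ofReal (lam * V x)
  lintegral_le : ∫⁻ y, ENNReal.ofReal (V y) ∂ν ≤ ENNReal.ofReal K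

section Decomposition

variable {P : Kernel S S} {C : Set S} (hC : MeasurableSet C) {ν : Measure S}

lemma killed_of_mem {x : S} (hx : x ∈ C) : killed P hC x = 0 := by
  exact if_pos hx

lemma killed_of_notMem {x : S} (hx : x ∉ C) : killed P hC x = P x := by
  exact if_neg hx

lemma killed_apply_add (hP : ∀ x ∈ C, P x = ν) (x : S) (A : Set S) :
    P x A = killed P hC x A + C.indicator (fun _ => ν A) x := by
  by_cases hx : x ∈ C
  · rw [killed_of_mem hC hx, Set.indicator_of_mem hx, hP x hx]; simp
  · rw [killed_of_notMem hC hx, Set.indicator_of_notMem hx, add_zero]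

lemma bind_eq_bind_killed_add (hP : ∀ x ∈ C, P x = ν) (μ : Measure S) :
    μ.bind P = μ.bind (killed P hC) + μ C • ν := by
  ext A hA
  rw [Measure.add_apply, Measure.smul_apply, Measure.bind_apply hA (Kernel.aemeasurable _),
    Measure.bind_apply hA (Kernel.aemeasurable _), smul_eq_mul]
  simp only [killed_apply_add hC hP _ A]
  rw [lintegral_add_left (Kernel.measurable_coe _ hA), lintegral_indicator_const hC, mul_comm]

/-- First entrance decomposition. -/
lemma kernel_pow_eq_killed_add (hP : ∀ x ∈ C, P x = ν) (n : ℕ) (x : S) :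
    (P ^ n) x = (killed P hC ^ n) x +
      ∑ j ∈ Finset.range n, (killed P hC ^ j) x C • lawFrom P ν (n - 1 - j) := by
  induction n generalizing x with
  | zero => simp
  | succ n ih =>
    rw [Finset.sum_range_succ', kernel_pow_succ, kernel_pow_succ, kernel_pow_zero,
      -- The term j = 0 is split off: it carries everything when the start is in C and vanishes
      -- otherwise.
      Measure.dirac_apply' _ hC]
    by_cases hx : x ∈ C
    · rw [hP x hx, killed_of_mem hC hx, Set.indicator_of_mem hx]
      have : ∀ j, (killed P hC ^ (j + 1)) x C = 0 := fun j => by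
        rw [kernel_pow_succ, killed_of_mem hC hx]; simp
      simp [this, lawFrom]
    · rw [killed_of_notMem hC hx, Set.indicator_of_notMem hx, zero_smul, add_zero]
      ext A hA
      rw [Measure.add_apply, Measure.bind_apply hA (Kernel.aemeasurable _),
        Measure.bind_apply hA (Kernel.aemeasurable _), Measure.finsetSum_apply]
      simp only [ih, Measure.add_apply, Measure.finsetSum_apply, Measure.smul_apply, smul_eq_mul]
      rw [lintegral_add_left (Kernel.measurable_coe _ hA), lintegral_finsetSum]
      · congr 1
        refine Finset.sum_congr rfl fun j _ => ?_
        rw [lintegral_mul_const _ (Kernel.measurable_coe _ hC), kernel_pow_succ,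
          killed_of_notMem hC hx, Measure.bind_apply hC (Kernel.aemeasurable _)]
        congr 3; omega
      · exact fun j _ => (Kernel.measurable_coe _ hC).mul_const _

/-- The renewal sequence of the visits to `C`. -/
noncomputable def renewalMass (P : Kernel S S) (C : Set S) (ν : Measure S) : ℕ → ℝ≥0∞
  | 0 => 1
  | n + 1 => lawFrom P ν n C

/-- Last exit decomposition. -/
lemma lawFrom_eq_sum (hP : ∀ x ∈ C, P x = ν) (n : ℕ) :
    lawFrom P ν n =
      ∑ i ∈ Finset.range (n + 1), renewalMass P C ν (n - i) • excursion P hC ν i := by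
  induction n with
  | zero => simp [lawFrom, excursion, renewalMass]
  | succ n ih =>
    have h1 : lawFrom P ν (n + 1) = (lawFrom P ν n).bind P := bind_kernel_pow_succ P ν n
    rw [h1, bind_eq_bind_killed_add hC hP, Finset.sum_range_succ']
    congr 1
    · conv_lhs => rw [ih]
      ext A hA
      rw [Measure.bind_apply hA (Kernel.aemeasurable _), lintegral_finsetSum_measure,
        Measure.finsetSum_apply]
      refine Finset.sum_congr rfl fun i _ => ?_
      rw [lintegral_smul_measure, Measure.smul_apply, excursion, excursion, bind_kernel_pow_succ,
        Measure.bind_apply hA (Kernel.aemeasurable _)]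
      congr 2; omega
    · rw [excursion, bind_kernel_pow_zero, Nat.sub_zero, renewalMass]

lemma excursion_succ (n : ℕ) :
    excursion P hC ν (n + 1) = (excursion P hC ν n).bind (killed P hC) :=
  bind_kernel_pow_succ _ ν n

lemma excursion_zero : excursion P hC ν 0 = ν := bind_kernel_pow_zero _ ν

lemma killed_univ [IsMarkovKernel P] (x : S) :
    killed P hC x Set.univ = Cᶜ.indicator (fun _ => 1) x := by
  by_cases hx : x ∈ C
  · rw [killed_of_mem hC hx, Set.indicator_of_notMem (by simpa using hx)]; simp
  · rw [killed_of_notMem hC hx, Set.indicator_of_mem (by simpa using hx), measure_univ]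

/-- The mass lost in one step is what sits on C, since the killed kernel vanishes there and is
Markov elsewhere. -/
lemma excursion_add [IsMarkovKernel P] (n : ℕ) :
    excursion P hC ν n C + excursion P hC ν (n + 1) Set.univ = excursion P hC ν n Set.univ := by
  rw [excursion_succ, Measure.bind_apply MeasurableSet.univ (Kernel.aemeasurable _)]
  simp only [killed_univ]
  rw [lintegral_indicator_const hC.compl, one_mul, measure_add_measure_compl hC]

lemma lintegral_excursion (n : ℕ) {f : S → ℝ≥0∞} (hf : Measurable f) :
    ∫⁻ x, f x ∂(excursion P hC ν n) = ∫⁻ x, ∫⁻ y, f y ∂((killed P hC ^ n) x) ∂ν := by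
  rw [excursion, Measure.lintegral_bind (Kernel.aemeasurable _) hf.aemeasurable]

instance isProbabilityMeasure_lawFrom [IsMarkovKernel P] [IsProbabilityMeasure ν] (n : ℕ) :
    IsProbabilityMeasure (lawFrom P ν n) := by
  rw [lawFrom]; infer_instance

end Decomposition

/-! ### Drift estimates -/

section Drift

variable {P : Kernel S S} {C : Set S} {ν : Measure S} {V : Weight S} {lam K : ℝ}
  (h : IsAtomicDrift P C ν V lam K)

lemma Weight.measurable_ofReal (V : Weight S) : Measurable fun x => ENNReal.ofReal (V x) :=
  V.measurable'.ennreal_ofReal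

include h

lemma IsAtomicDrift.lintegral_killed_le (x : S) :
    ∫⁻ y, ENNReal.ofReal (V y) ∂(killed P h.meas x) ≤
      ENNReal.ofReal lam * ENNReal.ofReal (V x) := by
  by_cases hx : x ∈ C
  · rw [killed_of_mem _ hx]; simp
  · rw [killed_of_notMem _ hx, ← ENNReal.ofReal_mul h.lam_pos.le]
    exact h.drift x hx

lemma IsAtomicDrift.lintegral_killed_pow_le (n : ℕ) (x : S) :
    ∫⁻ y, ENNReal.ofReal (V y) ∂((killed P h.meas ^ n) x) ≤
      ENNReal.ofReal lam ^ n * ENNReal.ofReal (V x) := by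
  induction n with
  | zero => rw [kernel_pow_zero, lintegral_dirac' _ V.measurable_ofReal]; simp
  | succ n ih =>
    rw [lintegral_kernel_pow_succ' _ _ _ V.measurable_ofReal]
    calc _ ≤ ∫⁻ y, ENNReal.ofReal lam * ENNReal.ofReal (V y) ∂((killed P h.meas ^ n) x) :=
          lintegral_mono fun y => h.lintegral_killed_le y
      _ = ENNReal.ofReal lam * ∫⁻ y, ENNReal.ofReal (V y) ∂((killed P h.meas ^ n) x) :=
          lintegral_const_mul _ V.measurable_ofReal
      _ ≤ _ := by rw [pow_succ', mul_assoc]; gcongr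

lemma IsAtomicDrift.ofReal_inv_mul : ENNReal.ofReal lam⁻¹ * ENNReal.ofReal lam = 1 := by
  rw [← ENNReal.ofReal_mul (inv_nonneg.2 h.lam_pos.le), inv_mul_cancel₀ h.lam_pos.ne',
    ENNReal.ofReal_one]

/-- With Q the killed kernel and R = 1/λ, the drift gives R·QV + 1_C ≤ V everywhere. Iterating
telescopes, so the R-th exponential moment of the hitting time of C is at most V. -/
lemma IsAtomicDrift.sum_killed_pow_atom_le (n : ℕ) (x : S) :
    ∑ j ∈ Finset.range n, ENNReal.ofReal lam⁻¹ ^ j * (killed P h.meas ^ j) x C ≤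
      ENNReal.ofReal (V x) := by
  set R := ENNReal.ofReal lam⁻¹ with hR
  have hstep : ∀ y, R * ∫⁻ z, ENNReal.ofReal (V z) ∂(killed P h.meas y) +
      C.indicator (fun _ => 1) y ≤ ENNReal.ofReal (V y) := by
    intro y
    by_cases hy : y ∈ C
    · rw [killed_of_mem _ hy, Set.indicator_of_mem hy]
      simpa using V.one_le' y
    · rw [Set.indicator_of_notMem hy, add_zero]
      calc _ ≤ R * (ENNReal.ofReal lam * ENNReal.ofReal (V y)) := by
            gcongr; exact h.lintegral_killed_le y
        _ = _ := by rw [← mul_assoc, h.ofReal_inv_mul, one_mul]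
  have key : ∑ j ∈ Finset.range n, R ^ j * (killed P h.meas ^ j) x C +
      R ^ n * ∫⁻ y, ENNReal.ofReal (V y) ∂((killed P h.meas ^ n) x) ≤ ENNReal.ofReal (V x) := by
    induction n with
    | zero => rw [kernel_pow_zero, lintegral_dirac' _ V.measurable_ofReal]; simp
    | succ n ih =>
      refine le_trans ?_ ih
      rw [Finset.sum_range_succ, add_assoc]
      gcongr
      rw [lintegral_kernel_pow_succ' _ _ _ V.measurable_ofReal, pow_succ, mul_assoc, ← mul_add]
      gcongr
      rw [← lintegral_const_mul _ (Measurable.lintegral_kernel V.measurable_ofReal), add_comm,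
        ← lintegral_indicator_one h.meas, ← lintegral_add_right _
        (measurable_one.indicator h.meas)]
      exact lintegral_mono fun y => hstep y
  exact le_self_add.trans key

/-- The same telescoping for V - 1: off C, R·PV ≤ V becomes R·P(V - 1) + (R - 1) ≤ V - 1.
Subtracting 1 is what yields the sharp constant N - 1 for the tails. -/
lemma IsAtomicDrift.sum_killed_pow_univ_le [IsMarkovKernel P] (n : ℕ) (x : S) :
    ∑ j ∈ Finset.range n, ENNReal.ofReal lam⁻¹ ^ j *
      (ENNReal.ofReal (lam⁻¹ - 1) * (killed P h.meas ^ (j + 1)) x Set.univ) ≤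
      ENNReal.ofReal (V x - 1) := by
  set R := ENNReal.ofReal lam⁻¹ with hR
  have hR1 : R = ENNReal.ofReal (lam⁻¹ - 1) + 1 := by
    rw [hR, ← ENNReal.ofReal_one, ← ENNReal.ofReal_add _ zero_le_one, sub_add_cancel]
    linarith [(one_lt_inv₀ h.lam_pos).2 h.lam_lt_one]
  have hV : ∀ y, ENNReal.ofReal (V y) = ENNReal.ofReal (V y - 1) + 1 := fun y => by
    rw [← ENNReal.ofReal_one, ← ENNReal.ofReal_add _ zero_le_one, sub_add_cancel]
    linarith [V.one_le' y]
  have hmeas : Measurable fun y => ENNReal.ofReal (V y - 1) :=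
    (V.measurable'.sub_const 1).ennreal_ofReal
  have hstep : ∀ y, R * ∫⁻ z, ENNReal.ofReal (V z - 1) ∂(killed P h.meas y) +
      ENNReal.ofReal (lam⁻¹ - 1) * killed P h.meas y Set.univ ≤ ENNReal.ofReal (V y - 1) := by
    intro y
    by_cases hy : y ∈ C
    · rw [killed_of_mem _ hy]; simp
    · rw [killed_of_notMem _ hy, measure_univ, mul_one]
      have h1 : R * ∫⁻ z, ENNReal.ofReal (V z) ∂(P y) ≤ ENNReal.ofReal (V y) := by
        have := h.lintegral_killed_le y
        rw [killed_of_notMem _ hy] at this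
        calc _ ≤ R * (ENNReal.ofReal lam * ENNReal.ofReal (V y)) := by gcongr
          _ = _ := by rw [← mul_assoc, h.ofReal_inv_mul, one_mul]
      simp only [hV] at h1
      rw [lintegral_add_left hmeas, lintegral_one, measure_univ, mul_add, mul_one] at h1
      nth_rewrite 2 [hR1] at h1
      rw [← add_assoc] at h1
      exact (ENNReal.add_le_add_iff_right ENNReal.one_ne_top).1 h1
  have key : ∑ j ∈ Finset.range n, R ^ j *
      (ENNReal.ofReal (lam⁻¹ - 1) * (killed P h.meas ^ (j + 1)) x Set.univ) +
      R ^ n * ∫⁻ y, ENNReal.ofReal (V y - 1) ∂((killed P h.meas ^ n) x) ≤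
      ENNReal.ofReal (V x - 1) := by
    induction n with
    | zero => rw [kernel_pow_zero, lintegral_dirac' _ hmeas]; simp
    | succ n ih =>
      refine le_trans ?_ ih
      rw [Finset.sum_range_succ, add_assoc]
      gcongr
      rw [lintegral_kernel_pow_succ' _ _ _ hmeas, kernel_pow_succ',
        Measure.bind_apply MeasurableSet.univ (Kernel.aemeasurable _), pow_succ R n, mul_assoc,
        ← mul_add]
      gcongr
      rw [← lintegral_const_mul _ (Measurable.lintegral_kernel hmeas),
        ← lintegral_const_mul _ (Kernel.measurable_coe _ MeasurableSet.univ), add_comm,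
        ← lintegral_add_left ((Measurable.lintegral_kernel hmeas).const_mul _)]
      exact lintegral_mono fun y => hstep y
  exact le_self_add.trans key

end Drift

end

section

variable {S : Type*} [MeasurableSpace S]

/-! ### The renewal pair of the chain and the invariant measure -/

/-- The tails of the return time to the atom. -/
noncomputable def tailMass (P : Kernel S S) {C : Set S} (hC : MeasurableSet C) (ν : Measure S)
    (n : ℕ) : ℝ := (excursion P hC ν n).real Set.univ

/-- The renewal sequence of the visits to the atom. -/
noncomputable def visitProb (P : Kernel S S) (C : Set S) (ν : Measure S) (n : ℕ) : ℝ :=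
  (renewalMass P C ν n).toReal

section Mass

variable {P : Kernel S S} [IsMarkovKernel P] {C : Set S} (hC : MeasurableSet C) {ν : Measure S}
  [IsProbabilityMeasure ν]

omit [IsProbabilityMeasure ν] in
lemma excursion_univ_antitone : Antitone fun n => excursion P hC ν n Set.univ :=
  antitone_nat_of_succ_le fun n => by rw [← excursion_add hC n]; exact le_add_self

lemma excursion_univ_le_one (n : ℕ) : excursion P hC ν n Set.univ ≤ 1 := by
  have := excursion_univ_antitone (P := P) (ν := ν) hC (Nat.zero_le n)
  simp only [excursion_zero, measure_univ] at this
  exact this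

instance isFiniteMeasure_excursion (n : ℕ) : IsFiniteMeasure (excursion P hC ν n) :=
  ⟨(excursion_univ_le_one hC n).trans_lt ENNReal.one_lt_top⟩

lemma ofReal_tailMass (n : ℕ) :
    ENNReal.ofReal (tailMass P hC ν n) = excursion P hC ν n Set.univ :=
  ENNReal.ofReal_toReal (measure_ne_top _ _)

lemma renewalMass_le_one (n : ℕ) : renewalMass P C ν n ≤ 1 := by
  cases n with
  | zero => exact le_rfl
  | succ n => exact prob_le_one

lemma ofReal_visitProb (n : ℕ) :
    ENNReal.ofReal (visitProb P C ν n) = renewalMass P C ν n :=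
  ENNReal.ofReal_toReal ((renewalMass_le_one n).trans_lt ENNReal.one_lt_top).ne

/-- The convolution identity is the total mass of the last exit decomposition. -/
lemma isRenewalPair_tailMass (hP : ∀ x ∈ C, P x = ν) :
    IsRenewalPair (tailMass P hC ν) (visitProb P C ν) where
  anti i j hij := ENNReal.toReal_mono (measure_ne_top _ _) (excursion_univ_antitone hC hij)
  nonneg _ := measureReal_nonneg
  zero := by simp [tailMass, excursion_zero]
  u_nonneg _ := ENNReal.toReal_nonneg
  u_le_one n := ENNReal.toReal_mono ENNReal.one_ne_top (renewalMass_le_one n)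
  conv n := by
    have h1 := congrArg (fun μ : Measure S => μ Set.univ) (lawFrom_eq_sum hC hP n)
    simp only [measure_univ, Measure.finsetSum_apply, Measure.smul_apply, smul_eq_mul,
      ← ofReal_tailMass, ← ofReal_visitProb] at h1
    have h2 := congrArg ENNReal.toReal h1
    rw [ENNReal.toReal_sum (fun i _ => by finiteness), ENNReal.toReal_one] at h2
    rw [h2]
    refine Finset.sum_congr rfl fun i _ => ?_
    rw [ENNReal.toReal_mul, ENNReal.toReal_ofReal (show 0 ≤ visitProb P C ν (n - i) from
      ENNReal.toReal_nonneg), ENNReal.toReal_ofReal (show 0 ≤ tailMass P hC ν i from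
      measureReal_nonneg), mul_comm]

lemma tailMass_one : tailMass P hC ν 1 = 1 - ν.real C := by
  have h1 := excursion_add (P := P) (ν := ν) hC 0
  rw [excursion_zero, measure_univ (μ := ν), ← ofReal_tailMass] at h1
  have h2 := congrArg ENNReal.toReal h1
  rw [ENNReal.toReal_add (measure_ne_top _ _) ENNReal.ofReal_ne_top,
    ENNReal.toReal_ofReal (show 0 ≤ tailMass P hC ν (0 + 1) from measureReal_nonneg),
    ENNReal.toReal_one, zero_add] at h2
  rw [Measure.real]; linarith

omit [IsMarkovKernel P] [IsProbabilityMeasure ν] in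
lemma killed_pow_le (hP : ∀ x ∈ C, P x = ν) (n : ℕ) (x : S) : (killed P hC ^ n) x ≤ (P ^ n) x := by
  rw [kernel_pow_eq_killed_add hC hP n x]
  exact Measure.le_add_right le_rfl

omit [IsProbabilityMeasure ν] in
lemma isFiniteMeasure_killed_pow (hP : ∀ x ∈ C, P x = ν) (n : ℕ) (x : S) :
    IsFiniteMeasure ((killed P hC ^ n) x) :=
  isFiniteMeasure_of_le _ (killed_pow_le hC hP n x)

end Mass

section Drift

variable {P : Kernel S S} [IsMarkovKernel P] {C : Set S} {ν : Measure S} [IsProbabilityMeasure ν]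
  {V : Weight S} {lam K : ℝ} (h : IsAtomicDrift P C ν V lam K)

lemma Weight.one_le_ofReal (V : Weight S) (x : S) : 1 ≤ ENNReal.ofReal (V x) := by
  rw [← ENNReal.ofReal_one]; exact ENNReal.ofReal_le_ofReal (V.one_le' x)

include h

omit [IsMarkovKernel P] in
lemma IsAtomicDrift.one_le_K : 1 ≤ K := by
  have h1 : (1 : ℝ≥0∞) ≤ ENNReal.ofReal K := by
    refine le_trans ?_ h.lintegral_le
    calc (1 : ℝ≥0∞) = ∫⁻ _, 1 ∂ν := by simp
      _ ≤ _ := lintegral_mono V.one_le_ofReal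
  rw [← ENNReal.ofReal_one, ENNReal.ofReal_le_ofReal_iff'] at h1
  exact h1.resolve_right (by norm_num)

omit [IsMarkovKernel P] [IsProbabilityMeasure ν] in
lemma IsAtomicDrift.one_lt_inv : 1 < lam⁻¹ := (one_lt_inv₀ h.lam_pos).2 h.lam_lt_one

/-- The preceding occupation bound is integrated against ν, where V - 1 has integral at most K - 1;
then R(K - 1)/(R - 1) = N - 1. -/
lemma IsAtomicDrift.sum_tailMass_le (n : ℕ) :
    ∑ j ∈ Finset.range n, tailMass P h.meas ν (j + 1) * lam⁻¹ ^ (j + 1) ≤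
      (lam⁻¹ * K - 1) / (lam⁻¹ - 1) - 1 := by
  have hR := h.one_lt_inv
  have hw : ∫⁻ x, ENNReal.ofReal (V x - 1) ∂ν ≤ ENNReal.ofReal (K - 1) := by
    have h1 := h.lintegral_le
    have hV : ∀ y, ENNReal.ofReal (V y) = ENNReal.ofReal (V y - 1) + 1 := fun y => by
      rw [← ENNReal.ofReal_one, ← ENNReal.ofReal_add _ zero_le_one, sub_add_cancel]
      linarith [V.one_le' y]
    simp only [hV] at h1
    rw [lintegral_add_left ((V.measurable'.sub_const 1).ennreal_ofReal), lintegral_one,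
      measure_univ, show K = (K - 1) + 1 by ring, ENNReal.ofReal_add (by linarith [h.one_le_K])
      zero_le_one, ENNReal.ofReal_one] at h1
    exact (ENNReal.add_le_add_iff_right ENNReal.one_ne_top).1 h1
  have h2 : ENNReal.ofReal (∑ j ∈ Finset.range n, lam⁻¹ ^ j *
      ((lam⁻¹ - 1) * tailMass P h.meas ν (j + 1))) ≤ ENNReal.ofReal (K - 1) := by
    refine le_trans ?_ ((lintegral_mono fun x => h.sum_killed_pow_univ_le n x).trans hw)
    rw [lintegral_finsetSum _ fun j _ => (((Kernel.measurable_coe _ MeasurableSet.univ).const_mul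
      _).const_mul _), ENNReal.ofReal_sum_of_nonneg fun j _ => mul_nonneg (pow_nonneg
        (by linarith) _) (mul_nonneg (by linarith)
        (show 0 ≤ tailMass P h.meas ν (j + 1) from measureReal_nonneg))]
    refine (Finset.sum_congr rfl fun j _ => ?_).le
    rw [lintegral_const_mul _ ((Kernel.measurable_coe _ MeasurableSet.univ).const_mul _),
      lintegral_const_mul _ (Kernel.measurable_coe _ MeasurableSet.univ),
      ENNReal.ofReal_mul (pow_nonneg (by linarith) _), ENNReal.ofReal_mul (by linarith),
      ENNReal.ofReal_pow (by linarith), ofReal_tailMass, excursion,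
      Measure.bind_apply MeasurableSet.univ (Kernel.aemeasurable _)]
  rw [ENNReal.ofReal_le_ofReal_iff (by linarith [h.one_le_K])] at h2
  have h3 : ∑ j ∈ Finset.range n, lam⁻¹ ^ j * ((lam⁻¹ - 1) * tailMass P h.meas ν (j + 1)) =
      (lam⁻¹ - 1) / lam⁻¹ *
        ∑ j ∈ Finset.range n, tailMass P h.meas ν (j + 1) * lam⁻¹ ^ (j + 1) := by
    rw [Finset.mul_sum]
    refine Finset.sum_congr rfl fun j _ => ?_
    have : lam⁻¹ ≠ 0 := by linarith
    rw [pow_succ, div_mul_eq_mul_div, eq_div_iff this]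
    ring
  rw [h3] at h2
  have h4 : (lam⁻¹ * K - 1) / (lam⁻¹ - 1) - 1 = (K - 1) / ((lam⁻¹ - 1) / lam⁻¹) := by
    have h5 : lam⁻¹ ≠ 0 := by linarith
    have h6 : lam⁻¹ - 1 ≠ 0 := by linarith
    generalize lam⁻¹ = R at *
    field_simp; ring
  rw [h4, le_div_iff₀ (div_pos (by linarith) (by linarith))]
  linarith

lemma IsAtomicDrift.hasGeomTail :
    HasGeomTail (tailMass P h.meas ν) lam⁻¹ ((lam⁻¹ * K - 1) / (lam⁻¹ - 1) - 1) := by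
  have hR := h.one_lt_inv
  have hnn : ∀ j, 0 ≤ tailMass P h.meas ν (j + 1) * lam⁻¹ ^ (j + 1) := fun j =>
    mul_nonneg measureReal_nonneg (pow_nonneg (by linarith) _)
  have hs := summable_of_sum_range_le hnn h.sum_tailMass_le
  exact ⟨hR, (summable_nat_add_iff 1).1 hs, hs.tsum_le_of_sum_range_le h.sum_tailMass_le⟩

omit [IsProbabilityMeasure ν] in
lemma IsAtomicDrift.sum_real_killed_pow_atom_le {r : ℝ} (hr0 : 0 ≤ r) (hr : r ≤ lam⁻¹) (n : ℕ)
    (x : S) : ∑ j ∈ Finset.range n, r ^ j * ((killed P h.meas ^ j) x).real C ≤ V x := by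
  have hR := h.one_lt_inv
  have h1 := h.sum_killed_pow_atom_le n x
  have h2 : ENNReal.ofReal (∑ j ∈ Finset.range n, lam⁻¹ ^ j * ((killed P h.meas ^ j) x).real C) ≤
      ENNReal.ofReal (V x) := by
    refine le_trans (le_of_eq ?_) h1
    rw [ENNReal.ofReal_sum_of_nonneg fun j _ => mul_nonneg (pow_nonneg (by linarith) _)
      measureReal_nonneg]
    refine Finset.sum_congr rfl fun j _ => ?_
    have := isFiniteMeasure_killed_pow h.meas h.eq_of_mem j x
    rw [ENNReal.ofReal_mul (pow_nonneg (by linarith) _), ENNReal.ofReal_pow (by linarith),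
      ofReal_measureReal]
  rw [ENNReal.ofReal_le_ofReal_iff (V.pos x).le] at h2
  refine le_trans (Finset.sum_le_sum fun j _ => ?_) h2
  exact mul_le_mul_of_nonneg_right (pow_le_pow_left₀ hr0 hr j) measureReal_nonneg

-- A single term of `sum_killed_pow_univ_le` is kept.
omit [IsProbabilityMeasure ν] in
lemma IsAtomicDrift.pow_mul_real_killed_pow_le {r : ℝ} (hr0 : 0 ≤ r) (hr : r ≤ lam⁻¹) {n : ℕ}
    (hn : 1 ≤ n) (x : S) :
    r ^ n * ((killed P h.meas ^ n) x).real Set.univ ≤ r * lam / (1 - lam) * V x := by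
  obtain ⟨n, rfl⟩ : ∃ k, n = k + 1 := ⟨n - 1, by omega⟩
  have hR := h.one_lt_inv
  have := isFiniteMeasure_killed_pow h.meas h.eq_of_mem (n + 1) x
  have h1 : ENNReal.ofReal (lam⁻¹ ^ n * ((lam⁻¹ - 1) *
      ((killed P h.meas ^ (n + 1)) x).real Set.univ)) ≤ ENNReal.ofReal (V x - 1) := by
    refine le_trans ?_ (h.sum_killed_pow_univ_le (n + 1) x)
    rw [ENNReal.ofReal_mul (pow_nonneg (by linarith) _), ENNReal.ofReal_mul (by linarith),
      ENNReal.ofReal_pow (by linarith), ofReal_measureReal]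
    exact Finset.single_le_sum (f := fun j => ENNReal.ofReal lam⁻¹ ^ j *
      (ENNReal.ofReal (lam⁻¹ - 1) * (killed P h.meas ^ (j + 1)) x Set.univ))
      (fun _ _ => zero_le) (Finset.self_mem_range_succ n)
  rw [ENNReal.ofReal_le_ofReal_iff (by linarith [V.one_le' x])] at h1
  have h2 : lam⁻¹ - 1 = (1 - lam) / lam := by have := h.lam_pos.ne'; field_simp
  have h3 : 0 < 1 - lam := by linarith [h.lam_lt_one]
  set q := ((killed P h.meas ^ (n + 1)) x).real Set.univ with hq
  have hq0 : 0 ≤ q := measureReal_nonneg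
  have h4 : lam⁻¹ ^ n * q ≤ lam / (1 - lam) * V x := by
    rw [h2] at h1
    have h5 : lam⁻¹ ^ n * q = lam / (1 - lam) * (lam⁻¹ ^ n * ((1 - lam) / lam * q)) := by
      have := h.lam_pos.ne'
      have := h3.ne'
      field_simp
    rw [h5]
    refine mul_le_mul_of_nonneg_left (by linarith) (div_nonneg h.lam_pos.le h3.le)
  calc r ^ (n + 1) * q = r * (r ^ n * q) := by ring
    _ ≤ r * (lam⁻¹ ^ n * q) := by gcongr
    _ ≤ r * (lam / (1 - lam) * V x) := by gcongr
    _ = _ := by ring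

omit [IsMarkovKernel P] in
lemma IsAtomicDrift.lintegral_excursion_le (n : ℕ) :
    ∫⁻ x, ENNReal.ofReal (V x) ∂(excursion P h.meas ν n) ≤ ENNReal.ofReal (K * lam ^ n) := by
  rw [lintegral_excursion _ _ V.measurable_ofReal]
  refine (lintegral_mono fun x => h.lintegral_killed_pow_le n x).trans ?_
  rw [lintegral_const_mul _ V.measurable_ofReal, ENNReal.ofReal_mul (by linarith [h.one_le_K]),
    ENNReal.ofReal_pow h.lam_pos.le, mul_comm]
  gcongr
  exact h.lintegral_le

end Drift

/-- The invariant probability measure, given by the occupation before the return to `C`. -/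
noncomputable def invariantMeasure (P : Kernel S S) {C : Set S} (hC : MeasurableSet C)
    (ν : Measure S) : Measure S :=
  ENNReal.ofReal (1 + ∑' k, tailMass P hC ν (k + 1))⁻¹ • Measure.sum (excursion P hC ν)

lemma sum_excursion_apply (P : Kernel S S) {C : Set S} (hC : MeasurableSet C) (ν : Measure S)
    (A : Set S) :
    ∑' n, excursion P hC ν n A = ν A + ∑' n, excursion P hC ν (n + 1) A := by
  have h1 : ∀ f : ℕ → ℝ≥0∞, ∑' n, f n = f 0 + ∑' n, f (n + 1) := fun f =>
    tsum_eq_zero_add' ENNReal.summable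
  rw [h1 fun n => excursion P hC ν n A]
  congr 1
  exact congrArg (fun μ : Measure S => μ A) (excursion_zero hC)

lemma sum_excursion_bind (P : Kernel S S) {C : Set S} (hC : MeasurableSet C) (ν : Measure S) :
    (Measure.sum (excursion P hC ν)).bind (killed P hC) + ν = Measure.sum (excursion P hC ν) := by
  ext A hA
  have h1 : ∀ n, ∫⁻ x, killed P hC x A ∂(excursion P hC ν n) = excursion P hC ν (n + 1) A :=
    fun n => by
      have h2 := congrArg (fun μ : Measure S => μ A) (excursion_succ (P := P) (ν := ν) hC n)
      exact (h2.trans (Measure.bind_apply hA (Kernel.aemeasurable _))).symm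
  have h3 : (Measure.sum (excursion P hC ν)).bind (killed P hC) A =
      ∑' n, excursion P hC ν (n + 1) A := by
    rw [Measure.bind_apply hA (Kernel.aemeasurable _), lintegral_sum_measure]
    exact tsum_congr h1
  rw [Measure.add_apply, Measure.sum_apply _ hA, h3, add_comm]
  exact (sum_excursion_apply P hC ν A).symm

section Invariant

variable {P : Kernel S S} [IsMarkovKernel P] {C : Set S} {ν : Measure S} [IsProbabilityMeasure ν]
  {V : Weight S} {lam K : ℝ} (h : IsAtomicDrift P C ν V lam K)

include h

omit [IsMarkovKernel P] [IsProbabilityMeasure ν] in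
lemma IsAtomicDrift.one_le_total : 1 ≤ 1 + ∑' k, tailMass P h.meas ν (k + 1) := by
  have : 0 ≤ ∑' k, tailMass P h.meas ν (k + 1) := tsum_nonneg fun k => measureReal_nonneg
  linarith

lemma IsAtomicDrift.tsum_excursion_univ :
    ∑' n, excursion P h.meas ν n Set.univ =
      ENNReal.ofReal (1 + ∑' k, tailMass P h.meas ν (k + 1)) := by
  have hp := isRenewalPair_tailMass h.meas h.eq_of_mem
  have hs := h.hasGeomTail.summable_one hp.nonneg
  simp only [← ofReal_tailMass]
  rw [← ENNReal.ofReal_tsum_of_nonneg hp.nonneg hs, hs.tsum_eq_zero_add, hp.zero]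

/-- The masses lost on C telescope, and the surviving mass tends to 0: a return to C is certain. It
follows that π(C) is exactly the normalizing constant p. -/
lemma IsAtomicDrift.tsum_excursion_atom : ∑' n, excursion P h.meas ν n C = 1 := by
  have hp := isRenewalPair_tailMass h.meas h.eq_of_mem
  have hs := h.hasGeomTail.summable_one hp.nonneg
  have h1 : ∀ n, ∑ j ∈ Finset.range n, excursion P h.meas ν j C +
      ENNReal.ofReal (tailMass P h.meas ν n) = 1 := by
    intro n
    induction n with
    | zero => simp [hp.zero]
    | succ n ih =>
      rw [Finset.sum_range_succ, add_assoc, ofReal_tailMass, excursion_add, ← ofReal_tailMass, ih]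
  have h2 : Tendsto (fun n => ∑ j ∈ Finset.range n, excursion P h.meas ν j C +
      ENNReal.ofReal (tailMass P h.meas ν n)) atTop
      (𝓝 (∑' n, excursion P h.meas ν n C + ENNReal.ofReal 0)) :=
    ENNReal.summable.hasSum.tendsto_sum_nat.add (ENNReal.tendsto_ofReal hs.tendsto_atTop_zero)
  simp only [h1, ENNReal.ofReal_zero, add_zero] at h2
  exact tendsto_nhds_unique h2 tendsto_const_nhds

lemma IsAtomicDrift.isProbabilityMeasure_invariantMeasure :
    IsProbabilityMeasure (invariantMeasure P h.meas ν) := by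
  refine ⟨?_⟩
  have h1 := h.one_le_total
  rw [invariantMeasure, Measure.smul_apply, Measure.sum_apply _ MeasurableSet.univ,
    h.tsum_excursion_univ, smul_eq_mul, ← ENNReal.ofReal_mul (inv_nonneg.2 (by linarith)),
    inv_mul_cancel₀ (by linarith), ENNReal.ofReal_one]

lemma IsAtomicDrift.invariantMeasure_atom :
    invariantMeasure P h.meas ν C = ENNReal.ofReal (1 + ∑' k, tailMass P h.meas ν (k + 1))⁻¹ := by
  rw [invariantMeasure, Measure.smul_apply, Measure.sum_apply _ h.meas, h.tsum_excursion_atom,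
    smul_eq_mul, mul_one]

lemma IsAtomicDrift.invariantMeasure_real_atom :
    (invariantMeasure P h.meas ν).real C = (1 + ∑' k, tailMass P h.meas ν (k + 1))⁻¹ := by
  rw [Measure.real, h.invariantMeasure_atom, ENNReal.toReal_ofReal]
  exact inv_nonneg.2 (by linarith [h.one_le_total])

/-- One step of P is one killed step plus a restart from ν weighted by π(C) = p, and that restart
replaces precisely the initial term of the normalized occupation sum. -/
lemma IsAtomicDrift.invariant : P.Invariant (invariantMeasure P h.meas ν) := by
  have h1 := bind_eq_bind_killed_add h.meas h.eq_of_mem (invariantMeasure P h.meas ν)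
  rw [Kernel.Invariant, h1, h.invariantMeasure_atom]
  conv_rhs => rw [invariantMeasure, ← sum_excursion_bind P h.meas ν]
  rw [invariantMeasure, Measure.bind_smul, smul_add]

omit [IsMarkovKernel P] in
lemma IsAtomicDrift.lintegral_invariantMeasure_lt_top :
    ∫⁻ x, ENNReal.ofReal (V x) ∂(invariantMeasure P h.meas ν) < ∞ := by
  rw [invariantMeasure, lintegral_smul_measure, lintegral_sum_measure, smul_eq_mul]
  refine ENNReal.mul_lt_top ENNReal.ofReal_lt_top ?_
  refine (ENNReal.tsum_le_tsum fun n => h.lintegral_excursion_le n).trans_lt ?_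
  rw [← ENNReal.ofReal_tsum_of_nonneg]
  · exact ENNReal.ofReal_lt_top
  · exact fun n => mul_nonneg (by linarith [h.one_le_K]) (pow_nonneg h.lam_pos.le _)
  · exact (summable_geometric_of_lt_one h.lam_pos.le h.lam_lt_one).mul_left K

omit [IsMarkovKernel P] [IsProbabilityMeasure ν] in
lemma IsAtomicDrift.lintegral_killed_pow_lt_top (n : ℕ) (x : S) :
    ∫⁻ y, ENNReal.ofReal (V y) ∂((killed P h.meas ^ n) x) < ∞ :=
  (h.lintegral_killed_pow_le n x).trans_lt (by finiteness)

lemma IsAtomicDrift.lintegral_lawFrom_lt_top (n : ℕ) :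
    ∫⁻ x, ENNReal.ofReal (V x) ∂(lawFrom P ν n) < ∞ := by
  rw [lawFrom_eq_sum h.meas h.eq_of_mem, lintegral_finsetSum_measure]
  refine ENNReal.sum_lt_top.2 fun i _ => ?_
  rw [lintegral_smul_measure, smul_eq_mul, ← ofReal_visitProb]
  exact ENNReal.mul_lt_top ENNReal.ofReal_lt_top
    ((h.lintegral_excursion_le i).trans_lt ENNReal.ofReal_lt_top)

lemma IsAtomicDrift.lintegral_pow_lt_top (n : ℕ) (x : S) :
    ∫⁻ y, ENNReal.ofReal (V y) ∂((P ^ n) x) < ∞ := by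
  rw [kernel_pow_eq_killed_add h.meas h.eq_of_mem, lintegral_add_measure,
    lintegral_finsetSum_measure]
  refine ENNReal.add_lt_top.2 ⟨h.lintegral_killed_pow_lt_top n x, ENNReal.sum_lt_top.2 fun i _ => ?_⟩
  have := isFiniteMeasure_killed_pow h.meas h.eq_of_mem i x
  rw [lintegral_smul_measure, smul_eq_mul]
  exact ENNReal.mul_lt_top (measure_lt_top _ _) (h.lintegral_lawFrom_lt_top _)

end Invariant

end

section

variable {S : Type*} [MeasurableSpace S]

/-! ### Convergence of the chain from the convergence of the renewal sequence -/

lemma integrable_of_norm_le_mul {E : Type*} [NormedAddCommGroup E] {V : Weight S} {f : S → E}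
    (hf : StronglyMeasurable f) {B : ℝ} (hB : ∀ x, ‖f x‖ ≤ B * V x) {μ : Measure S}
    (hμ : ∫⁻ x, ENNReal.ofReal (V x) ∂μ < ∞) : Integrable f μ := by
  have hV : Integrable (fun x => V x) μ :=
    ⟨V.measurable'.aestronglyMeasurable, by
      rw [hasFiniteIntegral_iff_ofReal (Eventually.of_forall fun x => (V.pos x).le)]; exact hμ⟩
  exact (hV.const_mul B).mono' hf.aestronglyMeasurable (Eventually.of_forall hB)

lemma norm_integral_le_mul_of_lintegral_le {E : Type*} [NormedAddCommGroup E] [NormedSpace ℝ E]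
    {V : Weight S} {f : S → E} {B : ℝ} (hB0 : 0 ≤ B) (hB : ∀ x, ‖f x‖ ≤ B * V x)
    {μ : Measure S} {a : ℝ} (ha : 0 ≤ a)
    (hμ : ∫⁻ x, ENNReal.ofReal (V x) ∂μ ≤ ENNReal.ofReal a) : ‖∫ x, f x ∂μ‖ ≤ B * a := by
  have hV : Integrable (fun x => V x) μ :=
    integrable_of_norm_le_mul (V := V) V.measurable'.stronglyMeasurable (B := 1)
      (fun x => by rw [Real.norm_of_nonneg (V.pos x).le, one_mul])
      (hμ.trans_lt ENNReal.ofReal_lt_top)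
  refine (norm_integral_le_of_norm_le (hV.const_mul B) (Eventually.of_forall hB)).trans ?_
  rw [integral_const_mul]
  refine mul_le_mul_of_nonneg_left ?_ hB0
  rw [integral_eq_lintegral_of_nonneg_ae (Eventually.of_forall fun x => (V.pos x).le)
    V.measurable'.aestronglyMeasurable]
  exact ENNReal.toReal_le_of_le_ofReal ha hμ

/-- The error splits into ∑ (u_{n-i} - p) F_i, a convolution of two geometrically small sequences,
and p times the tail of ∑ F_i. -/
lemma pow_mul_norm_sum_sub_le {E : Type*} [NormedAddCommGroup E] [NormedSpace ℝ E]
    {F : ℕ → E} {G : E} {s u : ℕ → ℝ} {p r k₀ T τ : ℝ} (hF : ∀ i, ‖F i‖ ≤ s i)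
    (hs : Summable s) (hG : HasSum F G) (hr : 0 ≤ r) (hp0 : 0 ≤ p) (hp1 : p ≤ 1)
    (hu : ∀ n, |u n - p| * r ^ n ≤ k₀) (hT : ∀ n, ∑ i ∈ Finset.range n, s i * r ^ i ≤ T)
    (hτ : ∀ n, (∑' i, s (i + (n + 1))) * r ^ n ≤ τ) (n : ℕ) :
    r ^ n * ‖∑ i ∈ Finset.range (n + 1), u (n - i) • F i - p • G‖ ≤ k₀ * T + τ := by
  have hs0 : ∀ i, 0 ≤ s i := fun i => (norm_nonneg _).trans (hF i)
  have hk0 : 0 ≤ k₀ := le_trans (mul_nonneg (abs_nonneg _) (pow_nonneg hr 0)) (hu 0)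
  have htail := (hasSum_nat_add_iff' (n + 1)).2 hG
  have htail_le : ‖G - ∑ i ∈ Finset.range (n + 1), F i‖ ≤ ∑' i, s (i + (n + 1)) :=
    htail.norm_le_of_bounded ((summable_nat_add_iff (n + 1)).2 hs).hasSum fun i => hF _
  have hdecomp : ∑ i ∈ Finset.range (n + 1), u (n - i) • F i - p • G =
      ∑ i ∈ Finset.range (n + 1), (u (n - i) - p) • F i -
        p • (G - ∑ i ∈ Finset.range (n + 1), F i) := by
    simp only [sub_smul, Finset.sum_sub_distrib, smul_sub, Finset.smul_sum]
    abel
  rw [hdecomp]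
  have h1 : r ^ n * ‖∑ i ∈ Finset.range (n + 1), (u (n - i) - p) • F i‖ ≤ k₀ * T := by
    calc _ ≤ r ^ n * ∑ i ∈ Finset.range (n + 1), |u (n - i) - p| * s i := by
          refine mul_le_mul_of_nonneg_left ((norm_sum_le _ _).trans
            (Finset.sum_le_sum fun i _ => ?_)) (pow_nonneg hr n)
          rw [norm_smul, Real.norm_eq_abs]
          exact mul_le_mul_of_nonneg_left (hF i) (abs_nonneg _)
      _ ≤ ∑ i ∈ Finset.range (n + 1), k₀ * (s i * r ^ i) := by
          rw [Finset.mul_sum]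
          refine Finset.sum_le_sum fun i hi => ?_
          have h2 : r ^ n = r ^ (n - i) * r ^ i := by
            rw [← pow_add]; congr 1
            have := Finset.mem_range.1 hi
            omega
          calc r ^ n * (|u (n - i) - p| * s i) =
                (|u (n - i) - p| * r ^ (n - i)) * (s i * r ^ i) := by rw [h2]; ring
            _ ≤ _ := mul_le_mul_of_nonneg_right (hu _) (mul_nonneg (hs0 i) (pow_nonneg hr i))
      _ ≤ k₀ * T := by
          rw [← Finset.mul_sum]
          exact mul_le_mul_of_nonneg_left (hT _) hk0
  have h2 : r ^ n * ‖p • (G - ∑ i ∈ Finset.range (n + 1), F i)‖ ≤ τ := by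
    refine le_trans ?_ (hτ n)
    rw [mul_comm]
    refine mul_le_mul_of_nonneg_right ?_ (pow_nonneg hr n)
    rw [norm_smul, Real.norm_of_nonneg hp0]
    exact (mul_le_of_le_one_left (norm_nonneg _) hp1).trans htail_le
  have h3 := mul_le_mul_of_nonneg_left (norm_sub_le
    (∑ i ∈ Finset.range (n + 1), (u (n - i) - p) • F i)
    (p • (G - ∑ i ∈ Finset.range (n + 1), F i))) (pow_nonneg hr n)
  linarith

section Convergence

variable {P : Kernel S S} [IsMarkovKernel P] {C : Set S} {ν : Measure S} [IsProbabilityMeasure ν]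
  {V : Weight S} {lam K : ℝ} (h : IsAtomicDrift P C ν V lam K)
  {E : Type*} [NormedAddCommGroup E] [NormedSpace ℝ E] {f : S → E}

include h

lemma IsAtomicDrift.integral_lawFrom (hf : StronglyMeasurable f) {B : ℝ}
    (hB : ∀ x, ‖f x‖ ≤ B * V x) (n : ℕ) :
    ∫ x, f x ∂(lawFrom P ν n) =
      ∑ i ∈ Finset.range (n + 1), visitProb P C ν (n - i) • ∫ x, f x ∂(excursion P h.meas ν i) := by
  rw [lawFrom_eq_sum h.meas h.eq_of_mem, integral_finsetSum_measure]
  · exact Finset.sum_congr rfl fun i _ => integral_smul_measure _ _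
  · intro i _
    refine (integrable_of_norm_le_mul hf hB
      ((h.lintegral_excursion_le i).trans_lt ENNReal.ofReal_lt_top)).smul_measure ?_
    exact ((renewalMass_le_one _).trans_lt ENNReal.one_lt_top).ne

lemma IsAtomicDrift.integral_pow (hf : StronglyMeasurable f) {B : ℝ}
    (hB : ∀ x, ‖f x‖ ≤ B * V x) (n : ℕ) (x : S) :
    ∫ y, f y ∂((P ^ n) x) = ∫ y, f y ∂((killed P h.meas ^ n) x) +
      ∑ j ∈ Finset.range n, ((killed P h.meas ^ j) x).real C •
        ∫ y, f y ∂(lawFrom P ν (n - 1 - j)) := by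
  have hint : ∀ j ∈ Finset.range n, Integrable f
      ((killed P h.meas ^ j) x C • lawFrom P ν (n - 1 - j)) := fun j _ => by
    have := isFiniteMeasure_killed_pow h.meas h.eq_of_mem j x
    exact (integrable_of_norm_le_mul hf hB (h.lintegral_lawFrom_lt_top _)).smul_measure
      (measure_ne_top _ _)
  rw [kernel_pow_eq_killed_add h.meas h.eq_of_mem, integral_add_measure
    (integrable_of_norm_le_mul hf hB (h.lintegral_killed_pow_lt_top n x))
    (integrable_finsetSum_measure.2 hint), integral_finsetSum_measure hint]
  congr 1
  exact Finset.sum_congr rfl fun j _ => integral_smul_measure _ _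

lemma IsAtomicDrift.real_killed_pow_add_sum (n : ℕ) (x : S) :
    ((killed P h.meas ^ n) x).real Set.univ +
      ∑ j ∈ Finset.range n, ((killed P h.meas ^ j) x).real C = 1 := by
  have := h.integral_pow (f := fun _ => (1 : ℝ)) stronglyMeasurable_const (B := 1)
    (fun x => by simpa using V.one_le' x) n x
  simpa using this.symm

omit [IsMarkovKernel P] in
lemma IsAtomicDrift.hasSum_integral_excursion (hf : StronglyMeasurable f) {B : ℝ}
    (hB : ∀ x, ‖f x‖ ≤ B * V x) : HasSum (fun i => ∫ x, f x ∂(excursion P h.meas ν i))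
      (∫ x, f x ∂(Measure.sum (excursion P h.meas ν))) := by
  refine hasSum_integral_measure (integrable_of_norm_le_mul hf hB ?_)
  have h1 := h.lintegral_invariantMeasure_lt_top
  rw [invariantMeasure, lintegral_smul_measure, smul_eq_mul] at h1
  refine ENNReal.lt_top_of_mul_ne_top_right h1.ne ?_
  exact (ENNReal.ofReal_pos.2 (inv_pos.2 (by linarith [h.one_le_total]))).ne'

omit [IsMarkovKernel P] [IsProbabilityMeasure ν] in
lemma IsAtomicDrift.integral_invariantMeasure :
    ∫ x, f x ∂(invariantMeasure P h.meas ν) = (1 + ∑' k, tailMass P h.meas ν (k + 1))⁻¹ •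
      ∫ x, f x ∂(Measure.sum (excursion P h.meas ν)) := by
  rw [invariantMeasure, integral_smul_measure, ENNReal.toReal_ofReal]
  exact inv_nonneg.2 (by linarith [h.one_le_total])

/-- Reduction of the convergence from `x` to the convergence from `ν`. -/
lemma IsAtomicDrift.pow_mul_norm_integral_pow_sub_le (hf : StronglyMeasurable f) {B : ℝ}
    (hB : ∀ x, ‖f x‖ ≤ B * V x) {r M : ℝ} (hr0 : 0 ≤ r) (hr : r ≤ lam⁻¹)
    (hM : ∀ k, r ^ k * ‖∫ x, f x ∂(lawFrom P ν k) - ∫ x, f x ∂(invariantMeasure P h.meas ν)‖ ≤ M)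
    (n : ℕ) (x : S) :
    r ^ n * ‖∫ y, f y ∂((P ^ n) x) - ∫ y, f y ∂(invariantMeasure P h.meas ν)‖ ≤
      r ^ n * ‖∫ y, f y ∂((killed P h.meas ^ n) x)‖ +
        r ^ n * ((killed P h.meas ^ n) x).real Set.univ *
          ‖∫ y, f y ∂(invariantMeasure P h.meas ν)‖ + r * M * V x := by
  set I := ∫ y, f y ∂(invariantMeasure P h.meas ν) with hI
  have hM0 : 0 ≤ M := le_trans (mul_nonneg (pow_nonneg hr0 0) (norm_nonneg _)) (hM 0)
  have h1 : ∫ y, f y ∂((P ^ n) x) - I = ∫ y, f y ∂((killed P h.meas ^ n) x) -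
      ((killed P h.meas ^ n) x).real Set.univ • I +
      ∑ j ∈ Finset.range n, ((killed P h.meas ^ j) x).real C •
        (∫ y, f y ∂(lawFrom P ν (n - 1 - j)) - I) := by
    rw [h.integral_pow hf hB]
    simp only [smul_sub, Finset.sum_sub_distrib, ← Finset.sum_smul]
    have h2 := h.real_killed_pow_add_sum n x
    have h3 : I = ((killed P h.meas ^ n) x).real Set.univ • I +
        (∑ j ∈ Finset.range n, ((killed P h.meas ^ j) x).real C) • I := by
      rw [← add_smul, h2, one_smul]
    nth_rewrite 1 [h3]
    abel
  have h4 : r ^ n * ‖∑ j ∈ Finset.range n, ((killed P h.meas ^ j) x).real C •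
        (∫ y, f y ∂(lawFrom P ν (n - 1 - j)) - I)‖ ≤ r * M * V x := by
    calc _ ≤ r ^ n * ∑ j ∈ Finset.range n, ((killed P h.meas ^ j) x).real C *
          ‖∫ y, f y ∂(lawFrom P ν (n - 1 - j)) - I‖ := by
          refine mul_le_mul_of_nonneg_left ((norm_sum_le _ _).trans
            (Finset.sum_le_sum fun j _ => ?_)) (pow_nonneg hr0 n)
          rw [norm_smul, Real.norm_of_nonneg measureReal_nonneg]
      _ ≤ ∑ j ∈ Finset.range n, r * M * (r ^ j * ((killed P h.meas ^ j) x).real C) := by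
          rw [Finset.mul_sum]
          refine Finset.sum_le_sum fun j hj => ?_
          have h5 : r ^ n = r * r ^ j * r ^ (n - 1 - j) := by
            rw [← pow_succ', ← pow_add]; congr 1
            have := Finset.mem_range.1 hj
            omega
          have h6 : 0 ≤ r * (r ^ j * ((killed P h.meas ^ j) x).real C) :=
            mul_nonneg hr0 (mul_nonneg (pow_nonneg hr0 j) measureReal_nonneg)
          calc _ = r * (r ^ j * ((killed P h.meas ^ j) x).real C) *
                (r ^ (n - 1 - j) * ‖∫ y, f y ∂(lawFrom P ν (n - 1 - j)) - I‖) := by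
                rw [h5]; ring
            _ ≤ r * (r ^ j * ((killed P h.meas ^ j) x).real C) * M :=
                mul_le_mul_of_nonneg_left (hM _) h6
            _ = _ := by ring
      _ ≤ r * M * V x := by
          rw [← Finset.mul_sum]
          exact mul_le_mul_of_nonneg_left (h.sum_real_killed_pow_atom_le hr0 hr n x)
            (mul_nonneg hr0 hM0)
  rw [h1]
  have h7 := mul_le_mul_of_nonneg_left (norm_add_le
    (∫ y, f y ∂((killed P h.meas ^ n) x) - ((killed P h.meas ^ n) x).real Set.univ • I)
    (∑ j ∈ Finset.range n, ((killed P h.meas ^ j) x).real C •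
        (∫ y, f y ∂(lawFrom P ν (n - 1 - j)) - I))) (pow_nonneg hr0 n)
  have h8 := mul_le_mul_of_nonneg_left (norm_sub_le (∫ y, f y ∂((killed P h.meas ^ n) x))
    (((killed P h.meas ^ n) x).real Set.univ • I)) (pow_nonneg hr0 n)
  rw [norm_smul, Real.norm_of_nonneg measureReal_nonneg] at h8
  linarith

/-- Convergence from `ν` in terms of the renewal sequence. -/
lemma IsAtomicDrift.pow_mul_norm_integral_lawFrom_sub_le (hf : StronglyMeasurable f) {B : ℝ}
    (hB : ∀ x, ‖f x‖ ≤ B * V x) {r k₀ T τ : ℝ} {s : ℕ → ℝ} (hr0 : 0 ≤ r)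
    (hk : ∀ n, |visitProb P C ν n - (1 + ∑' k, tailMass P h.meas ν (k + 1))⁻¹| * r ^ n ≤ k₀)
    (hs : ∀ i, ‖∫ x, f x ∂(excursion P h.meas ν i)‖ ≤ s i) (hsum : Summable s)
    (hT : ∀ n, ∑ i ∈ Finset.range n, s i * r ^ i ≤ T)
    (hτ : ∀ n, (∑' i, s (i + (n + 1))) * r ^ n ≤ τ) (n : ℕ) :
    r ^ n * ‖∫ x, f x ∂(lawFrom P ν n) - ∫ x, f x ∂(invariantMeasure P h.meas ν)‖ ≤
      k₀ * T + τ := by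
  rw [h.integral_lawFrom hf hB, h.integral_invariantMeasure]
  have h1 := h.one_le_total
  exact pow_mul_norm_sum_sub_le hs hsum (h.hasSum_integral_excursion hf hB) hr0
    (inv_nonneg.2 (by linarith)) (inv_le_one_of_one_le₀ h1) hk hT hτ n

/-- Convergence for bounded functions with an explicit constant. -/
theorem IsAtomicDrift.pow_mul_norm_integral_pow_sub_le_M1Bound (hf : StronglyMeasurable f) {B : ℝ}
    (hB : ∀ x, ‖f x‖ ≤ B) {r k₀ : ℝ} (hr1 : 1 ≤ r) (hr : r ≤ lam⁻¹)
    (hk : ∀ n, |visitProb P C ν n - (1 + ∑' k, tailMass P h.meas ν (k + 1))⁻¹| * r ^ n ≤ k₀)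
    {n : ℕ} (hn : 1 ≤ n) (x : S) :
    r ^ n * ‖∫ y, f y ∂((P ^ n) x) - ∫ y, f y ∂(invariantMeasure P h.meas ν)‖ ≤
      M1Bound lam K r k₀ * B * V x := by
  have hr0 : 0 ≤ r := by linarith
  have hB0 : 0 ≤ B := (norm_nonneg _).trans (hB x)
  have hBV : ∀ x, ‖f x‖ ≤ B * V x := fun x => (hB x).trans (le_mul_of_one_le_right hB0 (V.one_le' x))
  have hl0 := h.lam_pos
  have hl1 : 0 < 1 - lam := by linarith [h.lam_lt_one]
  have hR := h.one_lt_inv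
  have hp := isRenewalPair_tailMass h.meas h.eq_of_mem
  have hg := h.hasGeomTail
  have hK := h.one_le_K
  have hA : (lam⁻¹ * K - 1) / (lam⁻¹ - 1) - 1 = (K - 1) / (1 - lam) := by
    have h1 : lam⁻¹ - 1 = (1 - lam) / lam := by field_simp
    rw [h1]
    have := hl1.ne'
    field_simp
    ring
  rw [hA] at hg
  set A := (K - 1) / (1 - lam) with hAdef
  have hA0 : 0 ≤ A := div_nonneg (by linarith) hl1.le
  set c := tailMass P h.meas ν with hc
  have hsr := hg.summable_of_le hp.nonneg hr0 hr
  have htail : ∑' k, c (k + 1) * r ^ (k + 1) ≤ r * lam * A := by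
    have h1 : r * lam * A ≥ r * lam * ∑' k, c (k + 1) * lam⁻¹ ^ (k + 1) :=
      mul_le_mul_of_nonneg_left hg.tsum_le (mul_nonneg hr0 hl0.le)
    refine le_trans ?_ h1
    rw [← tsum_mul_left]
    refine Summable.tsum_le_tsum (fun k => ?_) ((summable_nat_add_iff 1).2 hsr)
      (((summable_nat_add_iff 1).2 hg.summable).mul_left _)
    have h2 : r ^ k ≤ lam⁻¹ ^ k := pow_le_pow_left₀ hr0 hr k
    calc c (k + 1) * r ^ (k + 1) = c (k + 1) * r * r ^ k := by ring
      _ ≤ c (k + 1) * r * lam⁻¹ ^ k :=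
          mul_le_mul_of_nonneg_left h2 (mul_nonneg (hp.nonneg _) hr0)
      _ = _ := by rw [pow_succ]; field_simp
  have hlaw := h.pow_mul_norm_integral_lawFrom_sub_le hf hBV (r := r) (k₀ := k₀)
    -- For |f| ≤ B the i-th excursion contributes at most B c_i. The bound 1 + A for ∑ c_i r^i comes
    -- from rλ ≤ 1, and λA bounds the weighted tails.
    (T := B * (1 + A)) (τ := B * (lam * A)) (s := fun i => B * c i) hr0 hk
    (fun i => by
      refine (norm_integral_le_of_norm_le_const (Eventually.of_forall hB)).trans_eq ?_
      rfl)
    ((hg.summable_one hp.nonneg).mul_left B)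
    (fun n => by
      simp only [mul_assoc]
      rw [← Finset.mul_sum]
      refine mul_le_mul_of_nonneg_left ?_ hB0
      refine (hsr.sum_le_tsum _ fun i _ => mul_nonneg (hp.nonneg i) (pow_nonneg hr0 i)).trans ?_
      rw [hsr.tsum_eq_zero_add, pow_zero, mul_one, hp.zero]
      have : r * lam ≤ 1 := by
        calc r * lam ≤ lam⁻¹ * lam := mul_le_mul_of_nonneg_right hr hl0.le
          _ = 1 := inv_mul_cancel₀ hl0.ne'
      nlinarith)
    (fun n => by
      rw [tsum_mul_left, mul_assoc]
      refine mul_le_mul_of_nonneg_left ?_ hB0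
      refine (sub_sum_mul_pow_le hp.nonneg (hg.summable_one hp.nonneg) hr1 hsr n).trans ?_
      rw [div_le_iff₀ (by linarith)]
      linarith)
  have hmain := h.pow_mul_norm_integral_pow_sub_le hf hBV hr0 hr hlaw n x
  have hq := h.pow_mul_real_killed_pow_le hr0 hr hn x
  have hq0 : 0 ≤ r ^ n * ((killed P h.meas ^ n) x).real Set.univ :=
    mul_nonneg (pow_nonneg hr0 n) measureReal_nonneg
  have := isFiniteMeasure_killed_pow h.meas h.eq_of_mem n x
  have := h.isProbabilityMeasure_invariantMeasure
  have h1 : r ^ n * ‖∫ y, f y ∂((killed P h.meas ^ n) x)‖ ≤ r * lam / (1 - lam) * V x * B := by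
    have h2 : ‖∫ y, f y ∂((killed P h.meas ^ n) x)‖ ≤
        B * ((killed P h.meas ^ n) x).real Set.univ :=
      norm_integral_le_of_norm_le_const (Eventually.of_forall hB)
    calc _ ≤ r ^ n * (B * ((killed P h.meas ^ n) x).real Set.univ) :=
          mul_le_mul_of_nonneg_left h2 (pow_nonneg hr0 n)
      _ = r ^ n * ((killed P h.meas ^ n) x).real Set.univ * B := by ring
      _ ≤ _ := mul_le_mul_of_nonneg_right hq hB0
  have h3 : ‖∫ y, f y ∂(invariantMeasure P h.meas ν)‖ ≤ B := by
    simpa using norm_integral_le_of_norm_le_const (μ := invariantMeasure P h.meas ν)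
      (Eventually.of_forall hB)
  have h4 : r ^ n * ((killed P h.meas ^ n) x).real Set.univ *
      ‖∫ y, f y ∂(invariantMeasure P h.meas ν)‖ ≤ r * lam / (1 - lam) * V x * B :=
    mul_le_mul hq h3 (norm_nonneg _) (hq0.trans hq)
  -- A factor 1/(1 - λ) is given away here: the argument yields this term with 1 - λ in place of its
  -- square.
  have h5 : r * (lam * A) ≤ r * lam * (K - 1) / (1 - lam) ^ 2 := by
    rw [hAdef, ← mul_assoc, ← mul_div_assoc]
    refine div_le_div_of_nonneg_left ?_ (by positivity) ?_
    · exact mul_nonneg (mul_nonneg hr0 hl0.le) (by linarith)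
    · rw [sq]; exact mul_le_of_le_one_left hl1.le (by linarith)
  have h6 : 1 + A = (K - lam) / (1 - lam) := by
    rw [hAdef]; field_simp; ring
  refine hmain.trans ?_
  have hBVx : 0 ≤ B * V x := mul_nonneg hB0 (V.pos x).le
  have h7 : r * (k₀ * (B * (1 + A)) + B * (lam * A)) * V x ≤
      (r * (K - lam) / (1 - lam) * k₀ + r * lam * (K - 1) / (1 - lam) ^ 2) * (B * V x) := by
    calc _ = (r * (1 + A) * k₀ + r * (lam * A)) * (B * V x) := by ring
      _ ≤ _ := by
          refine mul_le_mul_of_nonneg_right ?_ hBVx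
          rw [h6, ← mul_div_assoc]
          linarith
  have h8 : M1Bound lam K r k₀ * B * V x = r * lam / (1 - lam) * V x * B +
      r * lam / (1 - lam) * V x * B +
      (r * (K - lam) / (1 - lam) * k₀ + r * lam * (K - 1) / (1 - lam) ^ 2) * (B * V x) := by
    rw [M1Bound]; ring
  linarith

/-- Convergence for functions dominated by the drift function. -/
theorem IsAtomicDrift.exists_pow_mul_norm_integral_pow_sub_le {r k₀ : ℝ} (hr1 : 1 ≤ r)
    (hr : r < lam⁻¹)
    (hk : ∀ n, |visitProb P C ν n - (1 + ∑' k, tailMass P h.meas ν (k + 1))⁻¹| * r ^ n ≤ k₀) :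
    ∃ M : ℝ, 0 ≤ M ∧ ∀ (f : S → E), StronglyMeasurable f → ∀ B : ℝ, (∀ x, ‖f x‖ ≤ B * V x) →
      ∀ (n : ℕ) (x : S), r ^ n * ‖∫ y, f y ∂((P ^ n) x) -
        ∫ y, f y ∂(invariantMeasure P h.meas ν)‖ ≤ M * B * V x := by
  have hr0 : 0 ≤ r := by linarith
  have hl0 := h.lam_pos
  have hK := h.one_le_K
  have hrl0 : 0 ≤ r * lam := mul_nonneg hr0 hl0.le
  have hrl : r * lam < 1 := by
    calc r * lam < lam⁻¹ * lam := mul_lt_mul_of_pos_right hr hl0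
      _ = 1 := inv_mul_cancel₀ hl0.ne'
  have hk0 : 0 ≤ k₀ := le_trans (mul_nonneg (abs_nonneg _) (pow_nonneg hr0 0)) (hk 0)
  set W := (∫⁻ x, ENNReal.ofReal (V x) ∂(invariantMeasure P h.meas ν)).toReal with hW
  have hW0 : 0 ≤ W := ENNReal.toReal_nonneg
  have hgeo := summable_geometric_of_lt_one hl0.le h.lam_lt_one
  have hgeor := summable_geometric_of_lt_one hrl0 hrl
  have hl1 : 0 < 1 - lam := by linarith [h.lam_lt_one]
  have hrl1 : 0 < 1 - r * lam := by linarith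
  refine ⟨1 + W + r * (k₀ * (K * (1 - r * lam)⁻¹) + K * (1 - lam)⁻¹), by positivity, ?_⟩
  intro f hf B hB n x
  have hB0 : 0 ≤ B := nonneg_of_mul_nonneg_left ((norm_nonneg _).trans (hB x)) (V.pos x)
  have hlaw := h.pow_mul_norm_integral_lawFrom_sub_le hf hB (r := r) (k₀ := k₀)
    (T := B * (K * (1 - r * lam)⁻¹)) (τ := B * (K * (1 - lam)⁻¹))
    (s := fun i => B * (K * lam ^ i)) hr0 hk
    (fun i => norm_integral_le_mul_of_lintegral_le hB0 hB (by positivity)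
      (h.lintegral_excursion_le i))
    ((hgeo.mul_left K).mul_left B)
    (fun n => by
      simp only [mul_assoc]
      rw [← Finset.mul_sum, ← Finset.mul_sum]
      refine mul_le_mul_of_nonneg_left (mul_le_mul_of_nonneg_left ?_ (by linarith)) hB0
      rw [← tsum_geometric_of_lt_one hrl0 hrl]
      simp only [← mul_pow, mul_comm lam r]
      exact hgeor.sum_le_tsum _ fun i _ => pow_nonneg hrl0 i)
    (fun n => by
      have h1 : ∀ i, B * (K * lam ^ (i + (n + 1))) * r ^ n =
          B * (K * (lam * (r * lam) ^ n)) * lam ^ i := fun i => by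
        rw [mul_pow, pow_add, pow_succ]; ring
      rw [← tsum_mul_right]
      simp only [h1]
      rw [tsum_mul_left, tsum_geometric_of_lt_one hl0.le h.lam_lt_one, mul_assoc B, mul_assoc K]
      have h2 : lam * (r * lam) ^ n ≤ 1 := by
        have := pow_le_one₀ (n := n) hrl0 hrl.le
        have := pow_nonneg hrl0 n
        nlinarith [h.lam_lt_one]
      refine mul_le_mul_of_nonneg_left (mul_le_mul_of_nonneg_left ?_ (by linarith)) hB0
      exact mul_le_of_le_one_left (inv_nonneg.2 hl1.le) h2)
  have hmain := h.pow_mul_norm_integral_pow_sub_le hf hB hr0 hr.le hlaw n x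
  have h1 : ‖∫ y, f y ∂(invariantMeasure P h.meas ν)‖ ≤ B * W :=
    norm_integral_le_mul_of_lintegral_le hB0 hB hW0
      (ENNReal.ofReal_toReal h.lintegral_invariantMeasure_lt_top.ne).ge
  have h2 : ‖∫ y, f y ∂((killed P h.meas ^ n) x)‖ ≤ B * (lam ^ n * V x) :=
    norm_integral_le_mul_of_lintegral_le hB0 hB (mul_nonneg (pow_nonneg hl0.le n) (V.pos x).le) (by
      rw [ENNReal.ofReal_mul (pow_nonneg hl0.le n), ENNReal.ofReal_pow hl0.le]
      exact h.lintegral_killed_pow_le n x)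
  have hrn : r ^ n * lam ^ n ≤ 1 := by rw [← mul_pow]; exact pow_le_one₀ hrl0 hrl.le
  have hBV : 0 ≤ B * V x := mul_nonneg hB0 (V.pos x).le
  have h3 : r ^ n * ‖∫ y, f y ∂((killed P h.meas ^ n) x)‖ ≤ B * V x := by
    calc _ ≤ r ^ n * (B * (lam ^ n * V x)) := mul_le_mul_of_nonneg_left h2 (pow_nonneg hr0 n)
      _ = r ^ n * lam ^ n * (B * V x) := by ring
      _ ≤ _ := mul_le_of_le_one_left hBV hrn
  have h4 : r ^ n * ((killed P h.meas ^ n) x).real Set.univ ≤ V x := by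
    have hfin := isFiniteMeasure_killed_pow h.meas h.eq_of_mem n x
    have h5 : ((killed P h.meas ^ n) x).real Set.univ ≤ lam ^ n * V x := by
      refine ENNReal.toReal_le_of_le_ofReal (mul_nonneg (pow_nonneg hl0.le n) (V.pos x).le) ?_
      rw [ENNReal.ofReal_mul (pow_nonneg hl0.le n), ENNReal.ofReal_pow hl0.le]
      refine le_trans ?_ (h.lintegral_killed_pow_le n x)
      rw [← lintegral_one]
      exact lintegral_mono V.one_le_ofReal
    calc _ ≤ r ^ n * (lam ^ n * V x) := mul_le_mul_of_nonneg_left h5 (pow_nonneg hr0 n)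
      _ = r ^ n * lam ^ n * V x := by ring
      _ ≤ _ := mul_le_of_le_one_left (V.pos x).le hrn
  have h6 := mul_le_mul h4 h1 (norm_nonneg _) (V.pos x).le
  refine hmain.trans ?_
  calc _ ≤ B * V x + V x * (B * W) +
        r * (k₀ * (B * (K * (1 - r * lam)⁻¹)) + B * (K * (1 - lam)⁻¹)) * V x := by linarith
    _ = _ := by ring

end Convergence

end

/-! ### The Banach space `B_V` and the centered operator -/

section Space

variable {S : Type*} [MeasurableSpace S] {𝕜 : Type*} [RCLike 𝕜] {V : Weight S}

lemma BV.measurable (f : BV 𝕜 V) : Measurable f := f.2.1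

lemma BV.norm_apply_le (f : BV 𝕜 V) (x : S) : ‖f x‖ ≤ ‖f‖ * V x :=
  (div_le_iff₀ (V.pos x)).1 (f.div_le_norm x)

/-- The element of `B_V` given by a measurable function dominated by a multiple of `V`. -/
def BV.ofBound (f : S → 𝕜) (hf : Measurable f) (c : ℝ) (hc : ∀ x, ‖f x‖ ≤ c * V x) : BV 𝕜 V :=
  (⟨f, hf, c, fun x => (div_le_iff₀ (V.pos x)).2 (hc x)⟩ : BVSubmodule 𝕜 V)

lemma BV.norm_le {f : BV 𝕜 V} {c : ℝ} (hc0 : 0 ≤ c) (hc : ∀ x, ‖f x‖ ≤ c * V x) : ‖f‖ ≤ c :=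
  Real.iSup_le (fun x => (div_le_iff₀ (V.pos x)).2 (hc x)) hc0

lemma BV.ext_apply {f g : BV 𝕜 V} (h : ∀ x, f x = g x) : f = g := Subtype.ext (funext h)

instance BV.completeSpace : CompleteSpace (BV 𝕜 V) := by
  refine Metric.complete_of_cauchySeq_tendsto fun u hu => ?_
  have hdist : ∀ m n x, ‖u m x - u n x‖ ≤ dist (u m) (u n) * V x := fun m n x => by
    rw [dist_eq_norm]; exact (u m - u n).norm_apply_le x
  have hcau : ∀ x, CauchySeq fun n => u n x := fun x => by
    rw [Metric.cauchySeq_iff'] at hu ⊢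
    intro ε hε
    obtain ⟨N, hN⟩ := hu (ε / V x) (div_pos hε (V.pos x))
    refine ⟨N, fun n hn => ?_⟩
    rw [dist_eq_norm]
    exact (hdist n N x).trans_lt ((lt_div_iff₀ (V.pos x)).1 (hN n hn))
  choose g hg using fun x => cauchySeq_tendsto_of_complete (hcau x)
  have hgm : Measurable g := measurable_of_tendsto_metrizable (fun n => (u n).measurable)
    (tendsto_pi_nhds.2 hg)
  obtain ⟨R, -, hR⟩ := cauchySeq_bdd hu
  have hlim : ∀ ε : ℝ, ∀ n, (∀ᶠ m in atTop, dist (u n) (u m) ≤ ε) →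
      ∀ x, ‖u n x - g x‖ ≤ ε * V x := fun ε n h x =>
    le_of_tendsto (tendsto_const_nhds.sub (hg x)).norm (h.mono fun m hm =>
      (hdist n m x).trans (mul_le_mul_of_nonneg_right hm (V.pos x).le))
  have hb : ∀ x, ‖g x‖ ≤ (‖u 0‖ + R) * V x := fun x => by
    have h1 := hlim R 0 (Eventually.of_forall fun m => (hR 0 m).le) x
    have h2 := norm_sub_norm_le (g x) (u 0 x)
    rw [norm_sub_rev] at h2
    have h3 := (u 0).norm_apply_le x
    rw [add_mul]
    linarith
  refine ⟨BV.ofBound g hgm _ hb, ?_⟩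
  rw [Metric.tendsto_atTop]
  intro ε hε
  obtain ⟨N, hN⟩ := Metric.cauchySeq_iff.1 hu (ε / 2) (half_pos hε)
  refine ⟨N, fun n hn => ?_⟩
  rw [dist_eq_norm]
  refine (BV.norm_le (half_pos hε).le fun x => ?_).trans_lt (half_lt_self hε)
  exact hlim (ε / 2) n (eventually_atTop.2 ⟨N, fun m hm => (hN n hn m hm).le⟩) x

end Space

/-! ### Spectral radius and growth of powers -/

section Gelfand

variable {A : Type*} [NormedRing A] [NormedAlgebra ℂ A] [CompleteSpace A]

lemma spectralRadius_le_of_norm_pow_le {a : A} {M ρ : ℝ} (hρ : 0 ≤ ρ)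
    (h : ∀ n : ℕ, 1 ≤ n → ‖a ^ n‖ ≤ M * ρ ^ n) : spectralRadius ℂ a ≤ ENNReal.ofReal ρ := by
  set M' := max M 1
  have hM : 0 < M' := lt_of_lt_of_le one_pos (le_max_right _ _)
  have h1 := spectrum.pow_norm_pow_one_div_tendsto_nhds_spectralRadius a
  have h2 : Tendsto (fun n : ℕ => ENNReal.ofReal (M' ^ (1 / n : ℝ) * ρ)) atTop
      (𝓝 (ENNReal.ofReal (M' ^ (0 : ℝ) * ρ))) :=
    ENNReal.tendsto_ofReal ((((Real.continuous_const_rpow hM.ne').tendsto 0).comp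
      tendsto_one_div_atTop_nhds_zero_nat).mul_const ρ)
  rw [Real.rpow_zero, one_mul] at h2
  refine le_of_tendsto_of_tendsto h1 h2 (eventually_atTop.2 ⟨1, fun n hn => ?_⟩)
  refine ENNReal.ofReal_le_ofReal ?_
  have hn0 : n ≠ 0 := by omega
  calc ‖a ^ n‖ ^ (1 / n : ℝ) ≤ (M' * ρ ^ n) ^ (1 / n : ℝ) := by
        refine Real.rpow_le_rpow (norm_nonneg _) ((h n hn).trans ?_) (by positivity)
        exact mul_le_mul_of_nonneg_right (le_max_left _ _) (pow_nonneg hρ n)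
    _ = M' ^ (1 / n : ℝ) * ρ := by
        rw [Real.mul_rpow hM.le (pow_nonneg hρ n), one_div, Real.pow_rpow_inv_natCast hρ hn0]

lemma exists_norm_pow_le_of_spectralRadius_lt {a : A} {ρ : ℝ} (hρ : 0 < ρ)
    (h : spectralRadius ℂ a < ENNReal.ofReal ρ) :
    ∃ M : ℝ, 0 ≤ M ∧ ∀ n : ℕ, ‖a ^ n‖ ≤ M * ρ ^ n := by
  have h1 := (spectrum.pow_norm_pow_one_div_tendsto_nhds_spectralRadius a).eventually_lt_const h
  have h2 : ∀ᶠ n : ℕ in atTop, ‖a ^ n‖ / ρ ^ n ≤ 1 := by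
    filter_upwards [h1, eventually_ge_atTop 1] with n hn hn1
    rw [div_le_one (pow_pos hρ n)]
    have h3 := (ENNReal.ofReal_lt_ofReal_iff hρ).1 hn
    have h4 := pow_le_pow_left₀ (Real.rpow_nonneg (norm_nonneg _) _) h3.le n
    rwa [one_div, Real.rpow_inv_natCast_pow (norm_nonneg _) (by omega)] at h4
  obtain ⟨M, hM⟩ := (isBoundedUnder_of_eventually_le h2).bddAbove_range
  refine ⟨M, le_trans (by positivity) (hM ⟨0, rfl⟩), fun n => ?_⟩
  exact (div_le_iff₀ (pow_pos hρ n)).1 (hM ⟨n, rfl⟩)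

end Gelfand

/-! ### The operator P - 1 ⊗ π, optimal constants and uniqueness -/

section Operator

variable {S : Type*} [MeasurableSpace S] {P : Kernel S S} [IsMarkovKernel P] {C : Set S}
  {ν : Measure S} [IsProbabilityMeasure ν] {V : Weight S} {lam K : ℝ}
  (h : IsAtomicDrift P C ν V lam K)

lemma bind_pow_of_invariant {P : Kernel S S} {π : Measure S} (hπ : P.Invariant π) (n : ℕ) :
    π.bind ⇑(P ^ n) = π := by
  induction n with
  | zero => exact bind_kernel_pow_zero P π
  | succ n ih => rw [bind_kernel_pow_succ, ih, hπ.def]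

omit [IsMarkovKernel P] in
lemma integral_pow_succ {E : Type*} [NormedAddCommGroup E] [NormedSpace ℝ E] {f : S → E} (n : ℕ)
    (x : S) (hf : Integrable f ((P ^ (n + 1)) x)) :
    ∫ y, f y ∂((P ^ (n + 1)) x) = ∫ y, ∫ z, f z ∂((P ^ n) y) ∂(P x) := by
  rw [Kernel.pow_add, pow_one] at hf ⊢
  exact Kernel.integral_comp hf

omit [IsMarkovKernel P] in
lemma integral_integral_pow_of_invariant {E : Type*} [NormedAddCommGroup E] [NormedSpace ℝ E]
    {f : S → E} {π : Measure S} (hπ : P.Invariant π) (n : ℕ) (hf : Integrable f π) :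
    ∫ y, ∫ z, f z ∂((P ^ n) y) ∂π = ∫ y, f y ∂π := by
  have h1 : ((P ^ n) ∘ₖ Kernel.const Unit π) () = π := by
    rw [Kernel.comp_apply, Kernel.const_apply, bind_pow_of_invariant hπ]
  have h2 := Kernel.integral_comp (κ := Kernel.const Unit π) (η := P ^ n) (a := ()) (f := f)
    (by rwa [h1])
  rw [h1, Kernel.const_apply] at h2
  exact h2.symm

include h

lemma IsAtomicDrift.integrable_pow (f : BV ℂ V) (n : ℕ) (x : S) : Integrable f ((P ^ n) x) :=
  integrable_of_norm_le_mul f.measurable.stronglyMeasurable f.norm_apply_le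
    (h.lintegral_pow_lt_top n x)

lemma IsAtomicDrift.integrable_kernel (f : BV ℂ V) (x : S) : Integrable f (P x) := by
  have := h.integrable_pow f 1 x
  rwa [pow_one] at this

omit [IsMarkovKernel P] in
lemma IsAtomicDrift.integrable_invariantMeasure (f : BV ℂ V) :
    Integrable f (invariantMeasure P h.meas ν) :=
  integrable_of_norm_le_mul f.measurable.stronglyMeasurable f.norm_apply_le
    h.lintegral_invariantMeasure_lt_top

/-- Boundedness needs no rate: the convergence estimate is used at r = 1 and n = 1 with the trivial
bound |u_n - p| ≤ 1. -/
lemma IsAtomicDrift.exists_norm_integral_sub_le : ∃ M : ℝ, 0 ≤ M ∧ ∀ (f : BV ℂ V) (x : S),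
    ‖∫ y, f y ∂(P x) - ∫ y, f y ∂(invariantMeasure P h.meas ν)‖ ≤ M * ‖f‖ * V x := by
  have hp := isRenewalPair_tailMass h.meas h.eq_of_mem
  have h1 := h.one_le_total
  obtain ⟨M, hM0, hM⟩ := h.exists_pow_mul_norm_integral_pow_sub_le (E := ℂ) (r := 1) (k₀ := 1)
    le_rfl h.one_lt_inv (fun n => by
      rw [one_pow, mul_one, abs_le]
      have h2 := hp.u_nonneg n
      have h3 := hp.u_le_one n
      have h4 : 0 ≤ (1 + ∑' k, tailMass P h.meas ν (k + 1))⁻¹ := inv_nonneg.2 (by linarith)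
      have h5 := inv_le_one_of_one_le₀ h1
      constructor <;> linarith)
  refine ⟨M, hM0, fun f x => ?_⟩
  have := hM f f.measurable.stronglyMeasurable ‖f‖ f.norm_apply_le 1 x
  rwa [one_pow, one_mul, pow_one] at this

lemma IsAtomicDrift.exists_isCenteredOperator :
    ∃ T : BV ℂ V →L[ℂ] BV ℂ V, IsCenteredOperator P (invariantMeasure P h.meas ν) V T := by
  obtain ⟨M, hM0, hM⟩ := h.exists_norm_integral_sub_le
  have hmeas : ∀ f : BV ℂ V, Measurable fun x =>
      ∫ y, f y ∂(P x) - ∫ y, f y ∂(invariantMeasure P h.meas ν) := fun f =>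
    (f.measurable.stronglyMeasurable.integral_kernel (κ := P)).measurable.sub_const _
  let L : BV ℂ V →ₗ[ℂ] BV ℂ V :=
    { toFun := fun f => BV.ofBound _ (hmeas f) _ (hM f)
      map_add' := fun f g => BV.ext_apply fun x => by
        change ∫ y, (f y + g y) ∂(P x) - ∫ y, (f y + g y) ∂(invariantMeasure P h.meas ν) =
          (∫ y, f y ∂(P x) - ∫ y, f y ∂(invariantMeasure P h.meas ν)) +
          (∫ y, g y ∂(P x) - ∫ y, g y ∂(invariantMeasure P h.meas ν))
        rw [integral_add (h.integrable_kernel f x) (h.integrable_kernel g x),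
          integral_add (h.integrable_invariantMeasure f) (h.integrable_invariantMeasure g)]
        ring
      map_smul' := fun a f => BV.ext_apply fun x => by
        change ∫ y, (a * f y) ∂(P x) - ∫ y, (a * f y) ∂(invariantMeasure P h.meas ν) =
          a * (∫ y, f y ∂(P x) - ∫ y, f y ∂(invariantMeasure P h.meas ν))
        rw [integral_const_mul, integral_const_mul]
        ring }
  exact ⟨L.mkContinuous M fun f => BV.norm_le (mul_nonneg hM0 (norm_nonneg _)) (hM f),
    fun f x => rfl⟩

/-- Since π is invariant and P fixes constants, the centering is performed only once. The exponent
must be positive, as the zeroth power is the identity without centering. -/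
lemma IsAtomicDrift.pow_apply {T : BV ℂ V →L[ℂ] BV ℂ V}
    (hT : IsCenteredOperator P (invariantMeasure P h.meas ν) V T) (n : ℕ) (f : BV ℂ V) (x : S) :
    (T ^ (n + 1)) f x =
      ∫ y, f y ∂((P ^ (n + 1)) x) - ∫ y, f y ∂(invariantMeasure P h.meas ν) := by
  have := h.isProbabilityMeasure_invariantMeasure
  induction n generalizing x with
  | zero => simpa using hT f x
  | succ n ih =>
    have h1 : (T ^ (n + 1 + 1)) f = T ((T ^ (n + 1)) f) := by
      rw [pow_succ']; rfl
    have hint : ∀ μ : Measure S, IsProbabilityMeasure μ → Integrable ((T ^ (n + 1)) f : S → ℂ) μ →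
        ∫ y, (T ^ (n + 1)) f y ∂μ = ∫ y, ∫ z, f z ∂((P ^ (n + 1)) y) ∂μ -
          ∫ y, f y ∂(invariantMeasure P h.meas ν) := fun μ hμ hi => by
      have h2 : ∀ y, ∫ z, f z ∂((P ^ (n + 1)) y) =
          (T ^ (n + 1)) f y + ∫ y, f y ∂(invariantMeasure P h.meas ν) := fun y => by
        rw [ih y]; ring
      simp only [h2]
      rw [integral_add hi (integrable_const _)]
      simp
    rw [h1, hT, hint _ inferInstance (h.integrable_kernel _ x),
      hint _ inferInstance (h.integrable_invariantMeasure _),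
      integral_integral_pow_of_invariant h.invariant _ (h.integrable_invariantMeasure f),
      ← integral_pow_succ _ _ (h.integrable_pow f _ x)]
    ring

lemma IsAtomicDrift.spectralRadius_le {T : BV ℂ V →L[ℂ] BV ℂ V}
    (hT : IsCenteredOperator P (invariantMeasure P h.meas ν) V T) {r k₀ : ℝ} (hr1 : 1 < r)
    (hr : r < lam⁻¹)
    (hk : ∀ n, |visitProb P C ν n - (1 + ∑' k, tailMass P h.meas ν (k + 1))⁻¹| * r ^ n ≤ k₀) :
    spectralRadius ℂ T ≤ ENNReal.ofReal r⁻¹ := by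
  obtain ⟨M, hM0, hM⟩ := h.exists_pow_mul_norm_integral_pow_sub_le (E := ℂ) hr1.le hr hk
  have hr0 : 0 < r := by linarith
  refine spectralRadius_le_of_norm_pow_le (M := M) (inv_nonneg.2 hr0.le) fun n hn => ?_
  refine ContinuousLinearMap.opNorm_le_bound _ (by positivity) fun f => ?_
  refine BV.norm_le (by positivity) fun x => ?_
  obtain ⟨n, rfl⟩ : ∃ k, n = k + 1 := ⟨n - 1, by omega⟩
  rw [h.pow_apply hT]
  have h1 := hM f f.measurable.stronglyMeasurable ‖f‖ f.norm_apply_le (n + 1) x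
  rw [← le_div_iff₀' (pow_pos hr0 _)] at h1
  refine h1.trans_eq ?_
  rw [inv_pow, div_eq_mul_inv]; ring

omit [IsMarkovKernel P] [IsProbabilityMeasure ν] h in
lemma optConst_le_of_isConvConst {π : Measure S} {W : Weight S} {ρ M : ℝ} (hM : 0 ≤ M)
    (h : IsConvConst P π V W ρ M) : optConst P π V W ρ ≤ ENNReal.ofReal M :=
  iInf₂_le M.toNNReal (by rwa [Real.coe_toNNReal _ hM])

lemma IsAtomicDrift.optConst_lt_top {T : BV ℂ V →L[ℂ] BV ℂ V}
    (hT : IsCenteredOperator P (invariantMeasure P h.meas ν) V T) {ρ : ℝ}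
    (hρ : spectralRadius ℂ T < ENNReal.ofReal ρ) :
    optConst P (invariantMeasure P h.meas ν) V V ρ < ∞ := by
  have hρ0 : 0 < ρ := ENNReal.ofReal_pos.1 (pos_of_gt hρ)
  obtain ⟨M, hM0, hM⟩ := exists_norm_pow_le_of_spectralRadius_lt hρ0 hρ
  refine (optConst_le_of_isConvConst hM0 fun n hn g x => ?_).trans_lt ENNReal.ofReal_lt_top
  obtain ⟨n, rfl⟩ : ∃ k, n = k + 1 := ⟨n - 1, by omega⟩
  have hgb : ∀ x, ‖((g x : ℝ) : ℂ)‖ ≤ ‖g‖ * V x := fun x => by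
    rw [Complex.norm_real]; exact g.norm_apply_le x
  set G : BV ℂ V := BV.ofBound (fun x => ((g x : ℝ) : ℂ))
    (Complex.measurable_ofReal.comp g.measurable) ‖g‖ hgb with hG
  have hGn : ‖G‖ ≤ ‖g‖ := BV.norm_le (norm_nonneg _) hgb
  have h1 : (T ^ (n + 1)) G x = ((∫ y, g y ∂((P ^ (n + 1)) x) -
      ∫ y, g y ∂(invariantMeasure P h.meas ν) : ℝ) : ℂ) := by
    rw [h.pow_apply hT, Complex.ofReal_sub]
    exact congrArg₂ _ integral_ofReal integral_ofReal
  rw [← Real.norm_eq_abs, ← Complex.norm_real, ← h1]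
  refine ((T ^ (n + 1)) G).norm_apply_le x |>.trans ?_
  refine mul_le_mul_of_nonneg_right ?_ (V.pos x).le
  refine ((T ^ (n + 1)).le_opNorm G).trans ?_
  exact mul_le_mul (hM _) hGn (norm_nonneg _) (by positivity)

lemma IsAtomicDrift.optConst_one_le {r k₀ : ℝ} (hr1 : 1 < r) (hr : r < lam⁻¹)
    (hk : ∀ n, |visitProb P C ν n - (1 + ∑' k, tailMass P h.meas ν (k + 1))⁻¹| * r ^ n ≤ k₀) :
    optConst P (invariantMeasure P h.meas ν) V 1 r⁻¹ ≤ ENNReal.ofReal (M1Bound lam K r k₀) := by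
  have hr0 : 0 < r := by linarith
  have hk0 : 0 ≤ k₀ := le_trans (mul_nonneg (abs_nonneg _) (pow_nonneg hr0.le 0)) (hk 0)
  have hK := h.one_le_K
  have hl0 := h.lam_pos
  have hl1 : 0 < 1 - lam := by linarith [h.lam_lt_one]
  have hK1 : 0 ≤ K - 1 := by linarith
  have hKl : 0 ≤ K - lam := by linarith
  refine optConst_le_of_isConvConst (by rw [M1Bound]; positivity) fun n hn g x => ?_
  have hgb : ∀ x, ‖g x‖ ≤ ‖g‖ := fun x => by
    have h1 := g.norm_apply_le x
    rwa [show (1 : Weight S) x = 1 from rfl, mul_one] at h1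
  have h1 := h.pow_mul_norm_integral_pow_sub_le_M1Bound g.measurable.stronglyMeasurable hgb
    hr1.le hr.le hk hn x
  rw [← le_div_iff₀' (pow_pos hr0 _)] at h1
  rw [← Real.norm_eq_abs]
  refine h1.trans_eq ?_
  rw [inv_pow, div_eq_mul_inv]; ring

/-- P^n(x, A) converges for every x to the same limit; integrating against another invariant
probability measure, by dominated convergence, identifies the two. -/
lemma IsAtomicDrift.eq_invariantMeasure {r k₀ : ℝ} (hr1 : 1 < r) (hr : r < lam⁻¹)
    (hk : ∀ n, |visitProb P C ν n - (1 + ∑' k, tailMass P h.meas ν (k + 1))⁻¹| * r ^ n ≤ k₀)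
    {π : Measure S} [IsProbabilityMeasure π] (hπ : P.Invariant π) :
    π = invariantMeasure P h.meas ν := by
  have := h.isProbabilityMeasure_invariantMeasure
  have hr0 : 0 < r := by linarith
  ext A hA
  have hpt : ∀ x, Tendsto (fun n => (P ^ n) x A) atTop (𝓝 (invariantMeasure P h.meas ν A)) := by
    intro x
    rw [← ENNReal.tendsto_toReal_iff (fun n => measure_ne_top _ _) (measure_ne_top _ _)]
    obtain ⟨M, -, hM⟩ := h.exists_pow_mul_norm_integral_pow_sub_le (E := ℝ) hr1.le hr hk
    have hf : StronglyMeasurable (A.indicator fun _ => (1 : ℝ)) :=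
      stronglyMeasurable_const.indicator hA
    have hb : ∀ y, ‖A.indicator (fun _ => (1 : ℝ)) y‖ ≤ 1 * V y := fun y => by
      rw [one_mul]
      exact (norm_indicator_le_norm_self _ _).trans (by simpa using V.one_le' y)
    have hlim : Tendsto (fun n : ℕ => M * 1 * V x * r⁻¹ ^ n) atTop (𝓝 (M * 1 * V x * 0)) :=
      (tendsto_pow_atTop_nhds_zero_of_lt_one (inv_nonneg.2 hr0.le)
        (inv_lt_one_of_one_lt₀ hr1)).const_mul _
    rw [mul_zero] at hlim
    refine tendsto_iff_norm_sub_tendsto_zero.2 (squeeze_zero (fun n => norm_nonneg _)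
      (fun n => ?_) hlim)
    have h1 := hM _ hf 1 hb n x
    rw [integral_indicator_const _ hA, integral_indicator_const _ hA, smul_eq_mul, smul_eq_mul,
      mul_one, mul_one, ← le_div_iff₀' (pow_pos hr0 _)] at h1
    refine h1.trans_eq ?_
    rw [inv_pow, div_eq_mul_inv]
  have hint : ∀ n, ∫⁻ x, (P ^ n) x A ∂π = π A := fun n => by
    rw [← Measure.bind_apply hA (Kernel.aemeasurable _), bind_pow_of_invariant hπ]
  have hdom := tendsto_lintegral_of_dominated_convergence (μ := π) (fun _ => (1 : ℝ≥0∞))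
    (fun n => Kernel.measurable_coe (P ^ n) hA)
    (fun n => Eventually.of_forall fun x => prob_le_one) (by simp)
    (Eventually.of_forall hpt)
  simp only [hint, lintegral_const, measure_univ, mul_one] at hdom
  exact tendsto_nhds_unique tendsto_const_nhds hdom

end Operator

/-! ### From the hypotheses of the theorem to the atomic setting -/

lemma le_ofReal_inv_of_forall_lt {s : ℝ≥0∞} {r₀ : ℝ} (h0 : 1 < r₀)
    (h : ∀ r, 1 < r → r < r₀ → s ≤ ENNReal.ofReal r⁻¹) : s ≤ ENNReal.ofReal r₀⁻¹ := by
  have h1 : Tendsto (fun r : ℝ => ENNReal.ofReal r⁻¹) (𝓝[<] r₀) (𝓝 (ENNReal.ofReal r₀⁻¹)) :=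
    ENNReal.tendsto_ofReal ((continuousAt_inv₀ (by linarith)).tendsto.mono_left nhdsWithin_le_nhds)
  refine ge_of_tendsto h1 ?_
  filter_upwards [Ioo_mem_nhdsLT h0] with r hr
  exact h r hr.1 hr.2

/-- On C, ν ≤ P(x, ·) are measures of equal mass, hence equal. Strong aperiodicity makes C nonempty,
and a point of C turns the drift bound K into a bound for the integral of V against ν. -/
lemma isAtomicDrift_of_minorization {S : Type*} [MeasurableSpace S] {P : Kernel S S}
    [IsMarkovKernel P] {C : Set S} (hC : MeasurableSet C) {ν : Measure S} [IsProbabilityMeasure ν]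
    {V : Weight S} {b lam K : ℝ} (hlam0 : 0 < lam) (hlam1 : lam < 1)
    (hmin : Minorization P C 1 ν) (hdrift : Drift P C V lam K)
    (haper : StronglyAperiodic C 1 b ν) : IsAtomicDrift P C ν V lam K := by
  have hP : ∀ x ∈ C, P x = ν := fun x hx => by
    have h1 : ν ≤ P x := Measure.le_iff.2 fun A hA => by simpa using hmin x hx A hA
    exact (Measure.eq_of_le_of_measure_univ_eq h1 (by simp)).symm
  have hne : C.Nonempty := by
    by_contra hc
    rw [Set.not_nonempty_iff_eq_empty] at hc
    have := haper.1
    have := haper.2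
    simp [hc] at this
    linarith
  obtain ⟨x, hx⟩ := hne
  exact ⟨hC, hP, hlam0, hlam1, hdrift.1, hP x hx ▸ hdrift.2 x hx⟩

end GeomErg

theorem theorem1 {S : Type*} [MeasurableSpace S] (P : Kernel S S) [IsMarkovKernel P]
    (C : Set S) (hC : MeasurableSet C) (ν : Measure S) [IsProbabilityMeasure ν]
    (V : Weight S) (b lam K : ℝ) (hlam0 : 0 < lam) (hlam1 : lam < 1)
    (hmin : Minorization P C 1 ν) (hdrift : Drift P C V lam K)
    (haper : StronglyAperiodic C 1 b ν) :
    ∃ π : Measure S, IsProbabilityMeasure π ∧ P.Invariant π ∧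
      (∀ π' : Measure S, IsProbabilityMeasure π' → P.Invariant π' → π' = π) ∧
      ∫⁻ x, ENNReal.ofReal (V x) ∂π < ∞ ∧
      ∃ T : BV ℂ V →L[ℂ] BV ℂ V, IsCenteredOperator P π V T ∧
        -- geometric ergodicity
        spectralRadius ℂ T < 1 ∧
        (∀ ρ : ℝ, spectralRadius ℂ T < ENNReal.ofReal ρ → ρ ≤ 1 → optConst P π V V ρ < ∞) ∧
        -- explicit bounds in terms of `b`, `lam`, `K` only
        (b < 1 → 1 ≤ alpha0 b lam⁻¹ (lam⁻¹ * K) →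
          1 < r0 b lam⁻¹ (lam⁻¹ * K) ∧
          spectralRadius ℂ T ≤ ENNReal.ofReal (r0 b lam⁻¹ (lam⁻¹ * K))⁻¹ ∧
          ∀ r : ℝ, 1 < r → r < r0 b lam⁻¹ (lam⁻¹ * K) →
            optConst P π V 1 r⁻¹ ≤
              ENNReal.ofReal (M1Bound lam K r (K0 r b lam⁻¹ (lam⁻¹ * K)))) ∧
        -- explicit bounds when `π(C)` is known
        (π.real C < 1 →
          1 < r0Known b lam⁻¹ (lam⁻¹ * K) (π.real C) ∧
          spectralRadius ℂ T ≤ ENNReal.ofReal (r0Known b lam⁻¹ (lam⁻¹ * K) (π.real C))⁻¹ ∧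
          ∀ r : ℝ, 1 < r → r < r0Known b lam⁻¹ (lam⁻¹ * K) (π.real C) →
            optConst P π V 1 r⁻¹ ≤
              ENNReal.ofReal
                (M1Bound lam K r (K0Known r b lam⁻¹ (lam⁻¹ * K) (π.real C)))) := by
  have h := isAtomicDrift_of_minorization hC hlam0 hlam1 hmin hdrift haper
  have hp := isRenewalPair_tailMass h.meas h.eq_of_mem
  have hg := h.hasGeomTail
  obtain ⟨hb0, hbν⟩ := haper
  have hc1 := tailMass_one (P := P) (ν := ν) h.meas
  rw [one_mul] at hbν
  have hR := h.one_lt_inv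
  have hb : tailMass P h.meas ν 1 ≤ 1 - b := by linarith
  have hL : lam⁻¹ ≤ lam⁻¹ * K := le_mul_of_one_le_right (by linarith) h.one_le_K
  -- Some rate, obtained from b > 0 alone, gives uniqueness and spectral radius below 1 even where
  -- the explicit bounds do not apply.
  obtain ⟨s, k, hs1, hsR, -, hk⟩ := hp.exists_abs_sub_mul_pow_le hg (by linarith)
  obtain ⟨T, hT⟩ := h.exists_isCenteredOperator
  refine ⟨invariantMeasure P h.meas ν, h.isProbabilityMeasure_invariantMeasure, h.invariant,
    fun π' hπ' hinv => h.eq_invariantMeasure hs1 hsR hk hinv, h.lintegral_invariantMeasure_lt_top,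
    T, hT, (h.spectralRadius_le hT hs1 hsR hk).trans_lt
      (ENNReal.ofReal_lt_one.2 (inv_lt_one_of_one_lt₀ hs1)),
    fun ρ hρ _ => h.optConst_lt_top hT hρ, fun hb1 hα0 => ?_, fun hπ => ?_⟩
  · have hr0 := one_lt_r0 hR hb0 hb1 hL hα0
    have hrR : ∀ r, r < r0 b lam⁻¹ (lam⁻¹ * K) → r < lam⁻¹ := fun r hr =>
      hr.trans_le (min_le_left _ _)
    exact ⟨hr0,
      le_ofReal_inv_of_forall_lt hr0 fun r hr1 hr => h.spectralRadius_le hT hr1 (hrR r hr)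
        (hp.abs_sub_mul_pow_le_K0 hg hb0 hb1 hb hL hα0 hr1 hr),
      fun r hr1 hr => h.optConst_one_le hr1 (hrR r hr)
        (hp.abs_sub_mul_pow_le_K0 hg hb0 hb1 hb hL hα0 hr1 hr)⟩
  · have hpC := h.invariantMeasure_real_atom
    have hs := hg.summable_one hp.nonneg
    have hm0 : 0 < ∑' j, tailMass P h.meas ν (j + 1) := by
      have := inv_lt_one_iff₀.1 (hpC ▸ hπ)
      rcases this with h1 | h1 <;> linarith [h.one_le_total]
    -- π(C) < 1 forces a positive tail somewhere, hence at index 1 by monotonicity; this is where b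
    -- < 1 comes from.
    have hc0 : 0 < tailMass P h.meas ν 1 := by
      by_contra! hc
      refine hm0.ne' (tsum_congr (fun j => ?_) |>.trans tsum_zero)
      exact le_antisymm ((hp.anti (by omega)).trans hc) (hp.nonneg _)
    have hb1 : b < 1 := by linarith
    have hb' : 0 < 1 - b := by linarith
    rw [r0Known, hpC]
    simp only [K0Known]
    set α := alphaOf b (1 + ∑' j, tailMass P h.meas ν (j + 1))⁻¹ with hαdef
    have hm : ∑' j, tailMass P h.meas ν (j + 1) = (1 - b) * α := by
      rw [hαdef, alphaOf, inv_inv, mul_div_cancel₀ _ hb'.ne', add_sub_cancel_left]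
    have hα : 0 < α := (mul_pos_iff_of_pos_left hb').1 (hm ▸ hm0)
    have hκ := one_le_kappa hR hb1 hα (hm ▸ hg.mul_tsum_le hp.nonneg)
    have hr0 := lt_min hR (one_lt_radius hb0 hb1 hα hκ)
    exact ⟨hr0,
      le_ofReal_inv_of_forall_lt hr0 fun r hr1 hr =>
        h.spectralRadius_le hT hr1 (lt_min_iff.1 hr).1
          (hp.abs_sub_mul_pow_le_renewalBound hg hb0 hb1 hb hα hm hr1 (lt_min_iff.1 hr).1
            (lt_min_iff.1 hr).2),
      fun r hr1 hr => h.optConst_one_le hr1 (lt_min_iff.1 hr).1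
        (hp.abs_sub_mul_pow_le_renewalBound hg hb0 hb1 hb hα hm hr1 (lt_min_iff.1 hr).1
          (lt_min_iff.1 hr).2)⟩
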